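/- Let $V$ be a separable Hilbert space with complete orthonormal base $(e_i)_{i\in\mathbb N}$ and let $L_2(V)$ be the space of Hilbert–Schmidt operators on $V$. Let $A$ be an operator on $V$ such that $-A$ is strictly positive and symmetric and has a compact inverse, let $S$ be the strongly continuous semigroup generated by $A$, and let $G:V\to L_2(V)$ be twice continuously Fréchet differentiable with bounded first and second derivatives. Let $\tfrac12<\beta<\beta'<\beta''<H<1$, $1-\beta'<\alpha<\beta$ and $\mu>0$, and write $$|||\omega|||_{\gamma,a,b}=\sup_{a\le s<t\le b}\frac{|\omega(t)-\omega(s)|}{|t-s|^{\gamma}} .$$ Let $C_0(\mathbb R,V)$ be the space of continuous $\omega:\mathbb R\to V$ with $\omega(0)=0$, with the topology of locally uniform convergence, its Borel $\sigma$-algebra, and the shifts $\theta_t\omega=\omega(t+\cdot)-\omega(t)$. Let $P$ be the law on $C_0(\mathbb R,V)$ of a $V$-valued fractional Brownian motion with Hurst parameter $H$ and positive symmetric trace class covariance operator $Q$. Put $X(\omega)=\sup_{r\in[0,1]}|||\theta_r\omega|||_{\beta'',-1,0}$ and $Y=\big(\tfrac{X+\mu}{\mu}\big)^{1/(\beta''-\beta')}$.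 Let $\Omega_1$ and $\Omega_2$ be $(\theta_t)$-invariant Borel sets of full $P$-measure such that $\lim_{t\to\pm\infty}\frac1t\int_0^tY(\theta_q\omega)\,dq=E_PY$ for $\omega\in\Omega_1$, and $\lim_{|t|\to\infty}X(\theta_t\omega)/|t|=0$ for $\omega\in\Omega_2$. Let $\Omega$ be the set of all $\omega\in\Omega_1\cap\Omega_2$ that are $\beta''$-Hölder continuous on every interval $[-k,k]$, $k\in\mathbb N$, and let $\mathcal F$ be the trace $\sigma$-algebra on $\Omega$. For $\omega\in\Omega$ and $u_0\in V$ consider the mild equation $$u(t)=S(t)u_0+\int_0^tS(t-r)G(u(r))\,d\omega(r),\qquad t\in[0,T],$$ where $\int_0^tK\,d\omega=(-1)^\alpha\int_0^tD^\alpha_{0+}K[r]\,D^{1-\alpha}_{t-}\omega_{t-}[r]\,dr$, with $\omega_{t-}=\omega-\omega(t)$ and Weyl fractional derivatives $$D^\alpha_{0+}K[r]=\frac1{\Gamma(1-\alpha)}\Big(\frac{K(r)}{r^\alpha}+\alpha\int_0^r\frac{K(r)-K(q)}{(r-q)^{1+\alpha}}dq\Big),$$ $$D^{1-\alpha}_{t-}\omega_{t-}[r]=\frac{(-1)^{1-\alpha}}{\Gamma(\alpha)}\Big(\frac{\omega(r)-\omega(t)}{(t-r)^{1-\alpha}}+(1-\alpha)\int_r^t\frac{\omega(r)-\omega(q)}{(q-r)^{2-\alpha}}dq\Big),$$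 the constants being combined to $(-1)^\alpha(-1)^{1-\alpha}=-1$. Solutions are sought in the space $C^{\beta,\sim}([0,T];V)$ of continuous $u:[0,T]\to V$ with $\sup_{0<s<t\le T}s^\beta\frac{|u(t)-u(s)|}{|t-s|^\beta}<\infty$. For every $\omega\in\Omega$ and $u_0\in V$ there is a $u:[0,\infty)\to V$ whose restriction to $[0,T]$ is, for every $T>0$, the unique solution in $C^{\beta,\sim}([0,T];V)$; let $\phi(t,\omega,u_0)=u(t)$ be the solution map so defined. Then: (i) $\phi:\mathbb R^+\times\Omega\times V\to V$ is $\mathcal B(\mathbb R^+)\otimes\mathcal F\otimes\mathcal B(V),\mathcal B(V)$-measurable. Moreover $\phi(0,\omega,u_0)=u_0$ and $\phi(t+\tau,\omega,u_0)=\phi(t,\theta_\tau\omega,\phi(\tau,\omega,u_0))$ for all $t,\tau\in\mathbb R^+$, $\omega\in\Omega$, $u_0\in V$, so that $\phi$ is a random dynamical system over the flow $\theta$ on $(\Omega,\mathcal F)$. (ii) The stopping times $$T(\omega)=\inf\{\tau>0:|||\omega|||_{\beta',0,\tau}+\mu\tau^{1-\beta'}\ge\mu\},\qquad \hat T(\omega)=\sup\{\tau<0:|||\omega|||_{\beta',\tau,0}+\mu|\tau|^{1-\beta'}\ge\mu\}$$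 are measurable functions of $\omega\in\Omega$. -/

import Mathlib

open MeasureTheory ProbabilityTheory Filter Topology Set
open scoped ENNReal NNReal

noncomputable section

namespace FBMEvolution

/-! ### Hilbert-Schmidt operators -/

section HilbertSchmidtOperators

variable {V : Type*} [NormedAddCommGroup V] [InnerProductSpace ℝ V]

/-- The bounded operators `T` on `V` with `∑ i, ‖T (e i)‖ ^ 2 < ∞`. -/
def hsSubmodule (e : HilbertBasis ℕ ℝ V) : Submodule ℝ (V →L[ℝ] V) where
  carrier := {T | Memℓp (fun i => T (e i)) 2}
  add_mem' := fun {S T} hS hT => by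
    simpa using! hS.add hT
  zero_mem' := by
    simpa using! (zero_memℓp (E := fun _ : ℕ => V) (p := 2))
  smul_mem' := fun c T hT => by
    simpa using! hT.const_smul c

/-- The space `L₂(V)` of Hilbert-Schmidt operators on `V`, as a type of its own, because it carries
the Hilbert-Schmidt norm and not the operator norm. Membership and norm are computed in the
orthonormal base `e`; neither depends on that choice. -/
def HS (e : HilbertBasis ℕ ℝ V) : Type _ := hsSubmodule e

namespace HS

variable {e : HilbertBasis ℕ ℝ V}

instance : AddCommGroup (HS e) := inferInstanceAs (AddCommGroup (hsSubmodule e))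

instance : Module ℝ (HS e) := inferInstanceAs (Module ℝ (hsSubmodule e))

/-- The bounded operator underlying a Hilbert-Schmidt operator. -/
def toCLM : HS e →ₗ[ℝ] (V →L[ℝ] V) := (hsSubmodule e).subtype

theorem toCLM_injective : Function.Injective (toCLM (e := e)) := Subtype.val_injective

theorem memℓp (K : HS e) : Memℓp (fun i => toCLM K (e i)) 2 := K.2

/-- The square-summable sequence `(K (e i))_i`. -/
def toLp : HS e →ₗ[ℝ] lp (fun _ : ℕ => V) 2 where
  toFun K := ⟨fun i => toCLM K (e i), K.memℓp⟩
  map_add' _ _ := rfl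
  map_smul' _ _ := rfl

theorem toLp_apply (K : HS e) (i : ℕ) : toLp K i = toCLM K (e i) := rfl

theorem toLp_injective : Function.Injective (toLp (e := e)) := by
  intro K L h
  apply toCLM_injective
  refine ContinuousLinearMap.ext_on (s := Set.range e) ?_ ?_
  · have h' := e.dense_span
    rw [Submodule.dense_iff_topologicalClosure_eq_top]
    exact h'
  · rintro _ ⟨i, rfl⟩
    rw [← toLp_apply, ← toLp_apply, h]

/-- The Hilbert-Schmidt norm `‖K‖ = (∑ i, ‖K (e i)‖ ^ 2) ^ (1 / 2)`. -/
instance : NormedAddCommGroup (HS e) :=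
  NormedAddCommGroup.induced (HS e) (lp (fun _ : ℕ => V) 2) toLp toLp_injective

instance : NormedSpace ℝ (HS e) :=
  NormedSpace.induced ℝ (HS e) (lp (fun _ : ℕ => V) 2) toLp

theorem norm_eq (K : HS e) : ‖K‖ = ‖toLp K‖ := rfl

theorem norm_sq_eq (K : HS e) : ‖K‖ ^ 2 = ∑' i, ‖toCLM K (e i)‖ ^ 2 := by
  have h := lp.norm_rpow_eq_tsum (p := 2) (by norm_num) (toLp K)
  simpa [norm_eq, toLp_apply] using h

theorem isometry_toLp : Isometry (toLp (e := e)) :=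
  AddMonoidHomClass.isometry_of_norm _ fun K => (norm_eq K).symm

theorem summable_and_le (f : lp (fun _ : ℕ => V) 2) (x : V) :
    Summable (fun i => ‖e.repr x i‖ * ‖f i‖) ∧
      ∑' i, ‖e.repr x i‖ * ‖f i‖ ≤ ‖f‖ * ‖x‖ := by
  have hx : HasSum (fun i => ‖e.repr x i‖ ^ (2 : ℝ)) (‖x‖ ^ (2 : ℝ)) := by
    have h := lp.hasSum_norm (p := 2) (by norm_num) (e.repr x)
    rwa [ENNReal.toReal_ofNat, LinearIsometryEquiv.norm_map] at h
  have hf : HasSum (fun i => ‖f i‖ ^ (2 : ℝ)) (‖f‖ ^ (2 : ℝ)) := by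
    have h := lp.hasSum_norm (p := 2) (by norm_num) f
    rwa [ENNReal.toReal_ofNat] at h
  obtain ⟨C, -, hC, hs⟩ := Real.inner_le_Lp_mul_Lq_hasSum_of_nonneg
    Real.HolderConjugate.two_two (norm_nonneg x) (norm_nonneg f)
    (fun i => norm_nonneg _) (fun i => norm_nonneg _) hx hf
  refine ⟨hs.summable, ?_⟩
  rw [hs.tsum_eq, mul_comm]
  exact hC

theorem toLp_surjective [CompleteSpace V] : Function.Surjective (toLp (e := e)) := by
  intro f
  have hs (x : V) : Summable (fun i => e.repr x i • f i) :=
    Summable.of_norm (by simpa [norm_smul] using! (summable_and_le (e := e) f x).1)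
  let L : V →ₗ[ℝ] V :=
    { toFun := fun x => ∑' i, e.repr x i • f i
      map_add' := fun x y => by
        rw [← (hs x).tsum_add (hs y)]
        simp [add_smul]
      map_smul' := fun c x => by
        simp only [RingHom.id_apply]
        rw [← (hs x).tsum_const_smul c]
        simp [mul_smul] }
  let T : V →L[ℝ] V := L.mkContinuous ‖f‖ fun x => by
    have h := summable_and_le (e := e) f x
    refine le_trans (norm_tsum_le_tsum_norm ?_) ?_
    · simpa [norm_smul] using! h.1
    · simpa [norm_smul] using! h.2
  have hT (i : ℕ) : T (e i) = f i := by
    change ∑' j, e.repr (e i) j • f j = f i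
    rw [tsum_eq_single i]
    · simp [HilbertBasis.repr_self]
    · intro j hj
      simp [HilbertBasis.repr_self, hj]
  refine ⟨⟨T, ?_⟩, ?_⟩
  · change Memℓp (fun i => T (e i)) 2
    simp only [hT]
    exact f.2
  · ext i
    exact hT i

instance [CompleteSpace V] : CompleteSpace (HS e) := by
  have h : IsUniformInducing (toLp (e := e)) := isometry_toLp.isUniformInducing
  rw [h.completeSpace_congr toLp_surjective]
  infer_instance

/-- The composition `B ∘ K` of a bounded operator with a Hilbert-Schmidt operator. -/
def lcomp (B : V →L[ℝ] V) (K : HS e) : HS e :=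
  ⟨B.comp (toCLM K), by
    exact (K.memℓp.norm.const_mul ‖B‖).mono fun i => B.le_opNorm _⟩

end HS

end HilbertSchmidtOperators

/-! ### Function spaces -/

section FunctionSpaces

variable {V : Type*} [NormedAddCommGroup V]

/-- The Hölder seminorm `|||w|||_{β,a,b} = sup_{a ≤ s < t ≤ b} |w(t) - w(s)| / |t - s|^β`,
with value `∞` if the supremum is infinite. -/
def holderSeminorm (β : ℝ) (w : ℝ → V) (a b : ℝ) : ℝ≥0∞ :=
  ⨆ (s : ℝ) (t : ℝ) (_ : a ≤ s) (_ : s < t) (_ : t ≤ b),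
    ENNReal.ofReal (‖w t - w s‖ / (t - s) ^ β)

/-- Membership of (the restriction to `[a,b]` of) `u` in `C^{β,∼}([a,b];V)`: `u` is continuous on
`[a,b]` and `sup_{a < s < t ≤ b} (s - a)^β |u(t) - u(s)| / |t - s|^β` is finite. -/
def MemHolderTilde (β : ℝ) (u : ℝ → V) (a b : ℝ) : Prop :=
  ContinuousOn u (Icc a b) ∧
    ∃ C : ℝ, ∀ s t : ℝ, a < s → s < t → t ≤ b →
      (s - a) ^ β * (‖u t - u s‖ / (t - s) ^ β) ≤ C

end FunctionSpaces

/-! ### The pathwise integral -/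

section FractionalIntegral

variable {E : Type*} [NormedAddCommGroup E] [NormedSpace ℝ E]

/-- The left-sided Weyl derivative `D^α_{a+} K [r]`. -/
def weylLeft (α a : ℝ) (K : ℝ → E) (r : ℝ) : E :=
  (Real.Gamma (1 - α))⁻¹ •
    (((r - a) ^ α)⁻¹ • K r + α • ∫ q in a..r, ((r - q) ^ (1 + α))⁻¹ • (K r - K q))

/-- The right-sided Weyl derivative `D^{1-α}_{b-} w_{b-} [r]` of order `1 - α` of
`w_{b-} = w - w(b-)`, for a `w` that is continuous at `b`, so that `w(b-) = w(b)`, and without its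
constant factor `(-1)^{1-α}`, which is accounted for in `fracIntegral`. -/
def weylRight (α b : ℝ) (w : ℝ → E) (r : ℝ) : E :=
  (Real.Gamma α)⁻¹ •
    (((b - r) ^ (1 - α))⁻¹ • (w r - w b) +
      (1 - α) • ∫ q in r..b, ((q - r) ^ (2 - α))⁻¹ • (w r - w q))

variable {V : Type*} [NormedAddCommGroup V] [InnerProductSpace ℝ V] {e : HilbertBasis ℕ ℝ V}

/-- The pathwise integral
`∫_a^b K dw = (-1)^α ∫_a^b D^α_{a+} K[r] D^{1-α}_{b-} w_{b-}[r] dr`.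
The constants combine to `(-1)^α (-1)^{1-α} = -1`. -/
def fracIntegral (α : ℝ) (K : ℝ → HS e) (w : ℝ → V) (a b : ℝ) : V :=
  -∫ r in a..b, HS.toCLM (weylLeft α a K r) (weylRight α b w r)

/-- All integrals in the definition of `∫_a^b K dw` converge: those in the two Weyl derivatives
(almost everywhere), the outer one, and `∫_a^b ‖D^α_{a+} K[r]‖ |D^{1-α}_{b-} w_{b-}[r]| dr`. -/
def FracIntegrable (α : ℝ) (K : ℝ → HS e) (w : ℝ → V) (a b : ℝ) : Prop :=
  (∀ᵐ r ∂(volume.restrict (Ioo a b)),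
    IntervalIntegrable (fun q => ((r - q) ^ (1 + α))⁻¹ • (K r - K q)) volume a r ∧
    IntervalIntegrable (fun q => ((q - r) ^ (2 - α))⁻¹ • (w r - w q)) volume r b) ∧
  IntervalIntegrable (fun r => HS.toCLM (weylLeft α a K r) (weylRight α b w r)) volume a b ∧
  IntervalIntegrable (fun r => ‖weylLeft α a K r‖ * ‖weylRight α b w r‖) volume a b

end FractionalIntegral

/-! ### The linear part -/

section LinearPart

variable {V : Type*} [NormedAddCommGroup V] [InnerProductSpace ℝ V]

/-- `-A` is a strictly positive symmetric operator with a compact inverse `R` on `V`. -/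
structure IsNegativeWithCompactInverse (A : V →ₗ.[ℝ] V) : Prop where
  symmetric : ∀ x y : A.domain, inner ℝ (A x) (y : V) = inner ℝ (x : V) (A y)
  strictly_positive : ∀ x : A.domain, (x : V) ≠ 0 → 0 < inner ℝ (-A x) (x : V)
  compact_inverse : ∃ R : V →L[ℝ] V, IsCompactOperator R ∧
    (∀ x : A.domain, R (-A x) = x) ∧
    ∀ y : V, ∃ h : R y ∈ A.domain, -A ⟨R y, h⟩ = y

/-- `(S(t))_{t ≥ 0}` is a strongly continuous semigroup on `V` whose generator is `A`; the values
`S(t)` for `t < 0` play no role. -/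
structure IsSemigroupGeneratedBy (A : V →ₗ.[ℝ] V) (S : ℝ → V →L[ℝ] V) : Prop where
  zero : S 0 = ContinuousLinearMap.id ℝ V
  add : ∀ s t : ℝ, 0 ≤ s → 0 ≤ t → S (s + t) = (S s).comp (S t)
  strongly_continuous : ∀ x : V, Tendsto (fun t => S t x) (𝓝[>] 0) (𝓝 x)
  generator : ∀ x y : V,
    (x, y) ∈ A.graph ↔ Tendsto (fun h : ℝ => h⁻¹ • (S h x - x)) (𝓝[>] 0) (𝓝 y)

end LinearPart

/-! ### Path space, shift and fractional Brownian motion -/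

section PathSpace

/-- The space `C₀(ℝ, V)` of continuous paths that vanish at zero, with the topology of uniform
convergence on compact sets. -/
def PathSpace (V : Type*) [NormedAddCommGroup V] : Type _ := {w : C(ℝ, V) // w 0 = 0}

variable {V : Type*} [NormedAddCommGroup V]

instance : TopologicalSpace (PathSpace V) :=
  inferInstanceAs (TopologicalSpace {w : C(ℝ, V) // w 0 = 0})

/-- The Borel `σ`-algebra of `C₀(ℝ, V)`. -/
instance : MeasurableSpace (PathSpace V) := borel _

instance : BorelSpace (PathSpace V) := ⟨rfl⟩

instance : CoeFun (PathSpace V) (fun _ => ℝ → V) := ⟨fun w => w.1⟩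

/-- The shift `θ_t ω = ω(t + ·) - ω(t)`. -/
def shift (t : ℝ) (w : PathSpace V) : PathSpace V :=
  ⟨⟨fun s => w (t + s) - w t, by
    have h : Continuous (fun s : ℝ => w s) := w.1.continuous
    fun_prop⟩, by simp⟩

@[simp] theorem shift_apply (t s : ℝ) (w : PathSpace V) : shift t w s = w (t + s) - w t := rfl

/-- The set of paths that are `β`-Hölder continuous on every interval `[-k, k]`. -/
def holderPaths (V : Type*) [NormedAddCommGroup V] (β : ℝ) : Set (PathSpace V) :=
  {w | ∀ k : ℕ, holderSeminorm β w (-k) k < ∞}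

/-- Invariance of a set of paths under the flow of shifts. -/
def ShiftInvariant (Ω : Set (PathSpace V)) : Prop := ∀ t : ℝ, shift t ⁻¹' Ω = Ω

/-- The restriction of the shift to an invariant set of paths. -/
def shiftOn {Ω : Set (PathSpace V)} (hΩ : ShiftInvariant Ω) (t : ℝ) (w : Ω) : Ω :=
  ⟨shift t w, (hΩ t).ge w.2⟩

theorem shiftInvariant_of_subset {Ω : Set (PathSpace V)}
    (h : ∀ (t : ℝ) (w : PathSpace V), w ∈ Ω → shift t w ∈ Ω) : ShiftInvariant Ω := by
  intro t
  refine Subset.antisymm (fun w hw => ?_) (fun w hw => h t w hw)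
  have h' : shift (-t) (shift t w) = w := by
    refine Subtype.ext (ContinuousMap.ext fun s => ?_)
    change shift (-t) (shift t w) s = w s
    have h0 : w 0 = 0 := w.2
    simp [h0]
  rw [← h']
  exact h (-t) _ hw

theorem shiftInvariant_holderPaths (β : ℝ) : ShiftInvariant (holderPaths V β) := by
  refine shiftInvariant_of_subset fun t w hw k => ?_
  obtain ⟨n, hn⟩ := exists_nat_ge (|t| + k)
  have h1 := neg_abs_le t
  have h2 := le_abs_self t
  refine lt_of_le_of_lt ?_ (hw n)
  refine iSup_le fun s => iSup_le fun s' => iSup_le fun hs => iSup_le fun hss => iSup_le fun hs' => ?_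
  have h3 : (t + s') - (t + s) = s' - s := by ring
  have key : ENNReal.ofReal (‖shift t w s' - shift t w s‖ / (s' - s) ^ β)
      = ENNReal.ofReal (‖w (t + s') - w (t + s)‖ / ((t + s') - (t + s)) ^ β) := by
    rw [h3]
    simp
  rw [key]
  unfold holderSeminorm
  refine le_iSup_of_le (t + s) (le_iSup_of_le (t + s') ?_)
  refine le_iSup_of_le (by linarith) (le_iSup_of_le (by linarith) (le_iSup_of_le (by linarith) ?_))
  exact le_rfl

theorem ShiftInvariant.inter {Ω Ω' : Set (PathSpace V)} (h : ShiftInvariant Ω)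
    (h' : ShiftInvariant Ω') : ShiftInvariant (Ω ∩ Ω') := fun t => by
  rw [preimage_inter, h t, h' t]

/-- `sup_{r ∈ [0,1]} |||θ_r ω|||_{β,-1,0}`. -/
def noiseSize (β : ℝ) (w : PathSpace V) : ℝ≥0∞ :=
  ⨆ r ∈ Icc (0 : ℝ) 1, holderSeminorm β (shift r w) (-1) 0

/-- `((sup_{r ∈ [0,1]} |||θ_r ω|||_{β'',-1,0} + μ) / μ) ^ (1 / (β'' - β'))`. -/
def noisePower (β' β'' μ : ℝ) (w : PathSpace V) : ℝ≥0∞ :=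
  ((noiseSize β'' w + ENNReal.ofReal μ) / ENNReal.ofReal μ) ^ (1 / (β'' - β'))

/-- An invariant Borel set of full measure on which the time averages of `noisePower` over `[0,t]`
and over `[-t,0]` converge to the expectation of `noisePower` as `t → ∞`. -/
structure IsErgodicSet (P : Measure (PathSpace V)) (β' β'' μ : ℝ) (Ω : Set (PathSpace V)) :
    Prop where
  measurableSet : MeasurableSet Ω
  full : P Ω = 1
  invariant : ShiftInvariant Ω
  forward : ∀ w ∈ Ω, Tendsto
    (fun t : ℝ => (∫⁻ q in Icc 0 t, noisePower β' β'' μ (shift q w)) / ENNReal.ofReal t)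
    atTop (𝓝 (∫⁻ w', noisePower β' β'' μ w' ∂P))
  backward : ∀ w ∈ Ω, Tendsto
    (fun t : ℝ => (∫⁻ q in Icc (-t) 0, noisePower β' β'' μ (shift q w)) / ENNReal.ofReal t)
    atTop (𝓝 (∫⁻ w', noisePower β' β'' μ w' ∂P))

/-- An invariant Borel set of full measure on which `t ↦ sup_{r ∈ [0,1]} |||θ_{t+r} ω|||_{β'',-1,0}`
has sublinear growth as `|t| → ∞`. -/
structure IsSublinearSet (P : Measure (PathSpace V)) (β'' : ℝ) (Ω : Set (PathSpace V)) :
    Prop where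
  measurableSet : MeasurableSet Ω
  full : P Ω = 1
  invariant : ShiftInvariant Ω
  sublinear : ∀ w ∈ Ω, Tendsto
    (fun t : ℝ => noiseSize β'' (shift t w) / ENNReal.ofReal |t|) (cocompact ℝ) (𝓝 0)

/-- The set of admissible paths: the paths in `Ω₁ ∩ Ω₂` that are locally `β''`-Hölder continuous. -/
def noiseSpace (β'' : ℝ) (Ω₁ Ω₂ : Set (PathSpace V)) : Set (PathSpace V) :=
  Ω₁ ∩ Ω₂ ∩ holderPaths V β''

theorem shiftInvariant_noiseSpace {P : Measure (PathSpace V)} {β' β'' μ : ℝ}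
    {Ω₁ Ω₂ : Set (PathSpace V)} (h₁ : IsErgodicSet P β' β'' μ Ω₁) (h₂ : IsSublinearSet P β'' Ω₂) :
    ShiftInvariant (noiseSpace β'' Ω₁ Ω₂) :=
  (h₁.invariant.inter h₂.invariant).inter (shiftInvariant_holderPaths β'')

/-- `T(ω) = inf {τ > 0 : |||ω|||_{β',0,τ} + μ τ^{1-β'} ≥ μ}`. -/
def stoppingTime (β' μ : ℝ) (w : PathSpace V) : ℝ :=
  sInf {τ : ℝ | 0 < τ ∧
    ENNReal.ofReal μ ≤ holderSeminorm β' w 0 τ + ENNReal.ofReal (μ * τ ^ (1 - β'))}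

/-- `T̂(ω) = sup {τ < 0 : |||ω|||_{β',τ,0} + μ |τ|^{1-β'} ≥ μ}`. -/
def stoppingTimeHat (β' μ : ℝ) (w : PathSpace V) : ℝ :=
  sSup {τ : ℝ | τ < 0 ∧
    ENNReal.ofReal μ ≤ holderSeminorm β' w τ 0 + ENNReal.ofReal (μ * |τ| ^ (1 - β'))}

/-- `P` is the law on `C₀(ℝ, V)` of a `V`-valued fractional Brownian motion with Hurst parameter `H`
and covariance operator `Q`: under `P`, the real random variables `⟨v, ω(t)⟩` form a centered
Gaussian process with
`E ⟨v, ω(s)⟩ ⟨v', ω(t)⟩ = (|t|^{2H} + |s|^{2H} - |t - s|^{2H}) / 2 * ⟨v, Q v'⟩`. -/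
structure IsFractionalBrownianLaw {V : Type*} [NormedAddCommGroup V] [InnerProductSpace ℝ V]
    (H : ℝ) (Q : V →L[ℝ] V) (P : Measure (PathSpace V)) : Prop where
  gaussian : IsGaussianProcess (fun (p : ℝ × V) (w : PathSpace V) => inner ℝ p.2 (w p.1)) P
  centered : ∀ (t : ℝ) (v : V), ∫ w : PathSpace V, inner ℝ v (w t) ∂P = 0
  covariance : ∀ (s t : ℝ) (v v' : V),
    ∫ w : PathSpace V, inner ℝ v (w s) * inner ℝ v' (w t) ∂P =
      (|t| ^ (2 * H) + |s| ^ (2 * H) - |t - s| ^ (2 * H)) / 2 * inner ℝ v (Q v')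

end PathSpace

/-! ### The evolution equation and its solution map -/

section Evolution

variable {V : Type*} [NormedAddCommGroup V] [InnerProductSpace ℝ V] {e : HilbertBasis ℕ ℝ V}

/-- `u` is a pathwise mild solution in `C^{β,∼}([0,T];V)` of `du = A u dt + G(u) dw`, `u(0) = u₀`:
`u(t) = S(t) u₀ + ∫_0^t S(t-r) G(u(r)) dw(r)` for `t ∈ [0,T]`. -/
structure IsMildSolution (S : ℝ → V →L[ℝ] V) (G : V → HS e) (α β : ℝ) (w : ℝ → V) (u₀ : V)
    (T : ℝ) (u : ℝ → V) : Prop where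
  mem : MemHolderTilde β u 0 T
  integrable : ∀ t ∈ Icc 0 T, FracIntegrable α (fun r => HS.lcomp (S (t - r)) (G (u r))) w 0 t
  eq : ∀ t ∈ Icc 0 T,
    u t = S t u₀ + fracIntegral α (fun r => HS.lcomp (S (t - r)) (G (u r))) w 0 t

open Classical in
/-- The solution map `φ(t, ω, u₀) = u(t)`, where `u : [0,∞) → V` solves the equation on every
interval `[0,T]` (and `0` if there is no such `u`). -/
def solutionMap (S : ℝ → V →L[ℝ] V) (G : V → HS e) (α β : ℝ) (t : ℝ≥0) (w : PathSpace V)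
    (u₀ : V) : V :=
  if h : ∃ u : ℝ → V, ∀ T : ℝ, 0 < T → IsMildSolution S G α β w u₀ T u then h.choose t else 0

/-- `φ` is a random dynamical system over the flow `θ`: it is
`B(ℝ⁺) ⊗ F ⊗ B(V), B(V)`-measurable and has the cocycle property. -/
structure IsRandomDynamicalSystem {Ω : Type*} [MeasurableSpace Ω] [MeasurableSpace V]
    (θ : ℝ → Ω → Ω) (φ : ℝ≥0 → Ω → V → V) : Prop where
  measurable : Measurable fun p : ℝ≥0 × Ω × V => φ p.1 p.2.1 p.2.2
  zero : ∀ (w : Ω) (u₀ : V), φ 0 w u₀ = u₀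
  cocycle : ∀ (t τ : ℝ≥0) (w : Ω) (u₀ : V), φ (t + τ) w u₀ = φ t (θ τ w) (φ τ w u₀)

end Evolution

end FBMEvolution

end

/-! The equation is solved path by path. Besides its continuity, a path `w` enters only through a
Hölder bound of order γ = β'' on bounded intervals, and randomness returns only as measurable
dependence on the path.

Solutions are controlled by ‖u(t)‖ ≤ N e^{ρt} and ‖u(t) - u(s)‖ ≤ N e^{ρt} (t-s)^β s^{-β}
(`WeightedHolder`); the singularity at zero is that of S(t)u₀. The key estimate is
`KernelBound.fracIntegrable_and_norm_le`: both Weyl derivatives are bounded by powers of the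
distances to the end points, the integral becomes a sum of Beta integrals, and writing e^{ρr} =
e^{ρt} e^{-ρ(t-r)} trades κ powers of t-r for a factor ρ^{-κ}. Hence convolution with the semigroup
has norm of order ρ^{-κ} (`weightedHolder_convolution`). On a fixed ball of the unweighted space,
G(u) - G(v) is controlled by u - v with a constant free of ρ, thanks to the bounded second
derivative. A large ρ therefore makes the map halve differences on all of [0,T] at once. This yields
uniqueness (`IsMildSolution.unique`) and convergence of the Picard iterates to a global solution
(`exists_mildSolution_tendsto_picard`), with no gluing of short intervals.

The estimates need ‖S(t+h) - S(t)‖ ≤ 2 (h/t)^θ. Symmetry and strict positivity of -A give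
self-adjoint contractions, and the bound then follows from the monotone differences of k ↦
⟨S(kh+τ)x, x⟩ (`norm_sub_apply_le_of_generator`), an elementary substitute for spectral calculus.

Hölder increments of the convolution, and the cocycle property, need ∫_0^t = ∫_0^s + ∫_s^t. This is
not visible from the definition, since both Weyl derivatives depend on the end points. If the
integrator has a bounded density v, Fubini and Abel's inversion of the Weyl derivative reduce the
integral to a constant times ∫ K v, which is additive. Steklov averages carry this over to Hölder
integrators (`KernelBound.fracIntegral_add`).

The Picard iterates are parametric integrals, hence jointly measurable in time, path and initial
value (`stronglyMeasurable_picard`), and so is their pointwise limit. The cocycle property follows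
from additivity, substitution under the shift, and uniqueness. For the stopping times, the defining
expression is monotone in τ, so rational τ suffice, and the Hölder seminorm is lower semicontinuous
in the path. -/

noncomputable section

set_option linter.unusedSectionVars false

namespace FBMEvolution

/-! ### Integrals over intervals -/

section IntervalIntegrals

variable {E : Type*} [NormedAddCommGroup E] [NormedSpace ℝ E]

/-- End points are null sets. Conditions on the open interval are the natural ones here, because the
integrands are singular at the ends. -/
theorem norm_integral_le_of_Ioo {a b : ℝ} (hab : a ≤ b) {f : ℝ → E} {g : ℝ → ℝ}
    (h : ∀ r ∈ Ioo a b, ‖f r‖ ≤ g r) (hg : IntervalIntegrable g volume a b) :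
    ‖∫ r in a..b, f r‖ ≤ ∫ r in a..b, g r := by
  rw [intervalIntegral.integral_of_le hab, intervalIntegral.integral_of_le hab,
    integral_Ioc_eq_integral_Ioo, integral_Ioc_eq_integral_Ioo]
  rw [intervalIntegrable_iff_integrableOn_Ioo_of_le hab] at hg
  exact norm_integral_le_of_norm_le hg ((ae_restrict_iff' measurableSet_Ioo).2 (ae_of_all _ h))

theorem intervalIntegrable_of_Ioo {a b : ℝ} (hab : a ≤ b) {f : ℝ → E} {g : ℝ → ℝ}
    (hf : AEStronglyMeasurable f (volume.restrict (Ioo a b)))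
    (h : ∀ r ∈ Ioo a b, ‖f r‖ ≤ g r) (hg : IntervalIntegrable g volume a b) :
    IntervalIntegrable f volume a b := by
  rw [intervalIntegrable_iff_integrableOn_Ioo_of_le hab] at hg ⊢
  exact Integrable.mono' hg hf ((ae_restrict_iff' measurableSet_Ioo).2 (ae_of_all _ h))

theorem integral_congr_Ioo {a b : ℝ} (hab : a ≤ b) {f g : ℝ → E}
    (h : ∀ r ∈ Ioo a b, f r = g r) : ∫ r in a..b, f r = ∫ r in a..b, g r := by
  rw [intervalIntegral.integral_of_le hab, intervalIntegral.integral_of_le hab,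
    integral_Ioc_eq_integral_Ioo, integral_Ioc_eq_integral_Ioo]
  exact setIntegral_congr_fun measurableSet_Ioo h

theorem intervalIntegrable_congr_Ioo {a b : ℝ} (hab : a ≤ b) {f g : ℝ → E}
    (hg : IntervalIntegrable g volume a b)
    (h : ∀ r ∈ Ioo a b, f r = g r) : IntervalIntegrable f volume a b := by
  rw [intervalIntegrable_iff_integrableOn_Ioo_of_le hab] at hg ⊢
  exact hg.congr_fun (fun r hr => (h r hr).symm) measurableSet_Ioo

theorem tendsto_integral_of_Ioo {a b : ℝ} (hab : a ≤ b) {F : ℕ → ℝ → E} {f : ℝ → E} {g : ℝ → ℝ}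
    (hF : ∀ n, AEStronglyMeasurable (F n) (volume.restrict (Ioo a b)))
    (h : ∀ n, ∀ r ∈ Ioo a b, ‖F n r‖ ≤ g r) (hg : IntervalIntegrable g volume a b)
    (hlim : ∀ r ∈ Ioo a b, Tendsto (fun n => F n r) atTop (𝓝 (f r))) :
    Tendsto (fun n => ∫ r in a..b, F n r) atTop (𝓝 (∫ r in a..b, f r)) := by
  simp only [intervalIntegral.integral_of_le hab, integral_Ioc_eq_integral_Ioo]
  rw [intervalIntegrable_iff_integrableOn_Ioo_of_le hab] at hg
  exact tendsto_integral_of_dominated_convergence g hF hg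
    (fun n => (ae_restrict_iff' measurableSet_Ioo).2 (ae_of_all _ (h n)))
    ((ae_restrict_iff' measurableSet_Ioo).2 (ae_of_all _ hlim))

end IntervalIntegrals

/-! ### Euler integrals of the first kind -/

section EulerIntegral

/-- `∫_0^1 u^x (1-u)^y du`. -/
def eulerIntegral (x y : ℝ) : ℝ := ∫ u in (0 : ℝ)..1, u ^ x * (1 - u) ^ y

theorem intervalIntegrable_euler {x y : ℝ} (hx : -1 < x) (hy : -1 < y) :
    IntervalIntegrable (fun u : ℝ => u ^ x * (1 - u) ^ y) volume 0 1 := by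
  have h := (Complex.betaIntegral_convergent (u := (x + 1 : ℝ)) (v := (y + 1 : ℝ))
    (by simp; linarith) (by simp; linarith)).norm
  refine intervalIntegrable_congr_Ioo zero_le_one h fun r hr => ?_
  have h1 : 0 < 1 - r := by linarith [hr.2]
  have e1 : (1 - r : ℂ) = ((1 - r : ℝ) : ℂ) := by push_cast; rfl
  rw [norm_mul, e1, Complex.norm_cpow_eq_rpow_re_of_pos hr.1,
    Complex.norm_cpow_eq_rpow_re_of_pos h1]
  simp

theorem eulerIntegral_nonneg (x y : ℝ) : 0 ≤ eulerIntegral x y := by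
  refine intervalIntegral.integral_nonneg zero_le_one fun u hu => ?_
  have := Real.rpow_nonneg hu.1 x
  have := Real.rpow_nonneg (sub_nonneg.2 hu.2) y
  positivity

theorem rpow_mul_rpow_eq_scaled {s t x y : ℝ} (hst : s < t) {r : ℝ} (hr : r ∈ Ioo s t) :
    (r - s) ^ x * (t - r) ^ y =
      (t - s) ^ (x + y) * (((r - s) / (t - s)) ^ x * (1 - (r - s) / (t - s)) ^ y) := by
  have h : 0 < t - s := sub_pos.2 hst
  have h1 : 0 < r - s := sub_pos.2 hr.1
  have h2 : 0 < t - r := sub_pos.2 hr.2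
  have e : 1 - (r - s) / (t - s) = (t - r) / (t - s) := by field_simp; ring
  rw [e, Real.div_rpow h1.le h.le, Real.div_rpow h2.le h.le, Real.rpow_add h]
  have := Real.rpow_pos_of_pos h x
  have := Real.rpow_pos_of_pos h y
  field_simp

theorem intervalIntegrable_rpow_mul_rpow {s t x y : ℝ} (hst : s ≤ t) (hx : -1 < x) (hy : -1 < y) :
    IntervalIntegrable (fun r : ℝ => (r - s) ^ x * (t - r) ^ y) volume s t := by
  rcases hst.eq_or_lt with rfl | hst'
  · exact IntervalIntegrable.refl
  have h : t - s ≠ 0 := (sub_pos.2 hst').ne'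
  have h0 := ((intervalIntegrable_euler hx hy).comp_mul_left (c := (t - s)⁻¹)).comp_sub_right s
  refine intervalIntegrable_congr_Ioo hst (g := fun r => (t - s) ^ (x + y) *
    (((r - s) / (t - s)) ^ x * (1 - (r - s) / (t - s)) ^ y)) ?_ fun r hr => rpow_mul_rpow_eq_scaled hst' hr
  convert! h0.const_mul ((t - s) ^ (x + y)) using 1
  · ext r
    simp [div_eq_inv_mul]
  · simp
  · simp

theorem integral_rpow_mul_rpow {s t x y : ℝ} (hst : s < t) :
    ∫ r in s..t, (r - s) ^ x * (t - r) ^ y = eulerIntegral x y * (t - s) ^ (x + y + 1) := by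
  have h : 0 < t - s := sub_pos.2 hst
  rw [integral_congr_Ioo hst.le (g := fun r => (t - s) ^ (x + y) *
    (((r - s) / (t - s)) ^ x * (1 - (r - s) / (t - s)) ^ y)) fun r hr => rpow_mul_rpow_eq_scaled hst hr,
    intervalIntegral.integral_const_mul,
    intervalIntegral.integral_comp_sub_right
      (fun r => ((r / (t - s)) ^ x * (1 - r / (t - s)) ^ y)) s,
    intervalIntegral.integral_comp_div (fun r => r ^ x * (1 - r) ^ y) h.ne',
    Real.rpow_add_one h.ne', sub_self, zero_div, div_self h.ne', smul_eq_mul, eulerIntegral]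
  ring

theorem intervalIntegrable_sub_rpow_left {s t x : ℝ} (hst : s ≤ t) (hx : -1 < x) :
    IntervalIntegrable (fun r : ℝ => (r - s) ^ x) volume s t := by
  simpa using intervalIntegrable_rpow_mul_rpow (y := 0) hst hx (by norm_num)

theorem intervalIntegrable_sub_rpow_right {s t y : ℝ} (hst : s ≤ t) (hy : -1 < y) :
    IntervalIntegrable (fun r : ℝ => (t - r) ^ y) volume s t := by
  simpa using intervalIntegrable_rpow_mul_rpow (x := 0) hst (by norm_num) hy

theorem integral_sub_rpow_left {s t x : ℝ} (hx : -1 < x) :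
    ∫ r in s..t, (r - s) ^ x = (t - s) ^ (x + 1) / (x + 1) := by
  rw [intervalIntegral.integral_comp_sub_right (fun r => r ^ x) s, integral_rpow (Or.inl hx)]
  simp [Real.zero_rpow (show x + 1 ≠ 0 by linarith)]

theorem integral_sub_rpow_right {s t x : ℝ} (hx : -1 < x) :
    ∫ r in s..t, (t - r) ^ x = (t - s) ^ (x + 1) / (x + 1) := by
  rw [intervalIntegral.integral_comp_sub_left (fun r => r ^ x) t, integral_rpow (Or.inl hx)]
  simp [Real.zero_rpow (show x + 1 ≠ 0 by linarith)]

theorem integral_sub_rpow_left_of_pos {a s t x : ℝ} (has : a < s) (hst : s ≤ t) (hx : x ≠ -1) :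
    ∫ r in s..t, (r - a) ^ x = ((t - a) ^ (x + 1) - (s - a) ^ (x + 1)) / (x + 1) := by
  rw [intervalIntegral.integral_comp_sub_right (fun r => r ^ x) a, integral_rpow (Or.inr ⟨hx, ?_⟩)]
  rw [uIcc_of_le (by linarith)]
  intro h
  linarith [h.1]

theorem integral_sub_rpow_right_of_pos {a s t x : ℝ} (hst : s ≤ t) (hta : t < a) (hx : x ≠ -1) :
    ∫ r in s..t, (a - r) ^ x = ((a - s) ^ (x + 1) - (a - t) ^ (x + 1)) / (x + 1) := by
  rw [intervalIntegral.integral_comp_sub_left (fun r => r ^ x) a, integral_rpow (Or.inr ⟨hx, ?_⟩)]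
  rw [uIcc_of_le (by linarith)]
  intro h
  linarith [h.1]

end EulerIntegral

/-! ### Fubini's theorem on a triangle -/

section Triangle

variable {E : Type*} [NormedAddCommGroup E] [NormedSpace ℝ E]

/-- The triangle `{(r, q) | a < q < r < b}`. -/
def openTriangle (a b : ℝ) : Set (ℝ × ℝ) := {p | a < p.2 ∧ p.2 < p.1 ∧ p.1 < b}

theorem measurableSet_openTriangle (a b : ℝ) : MeasurableSet (openTriangle a b) :=
  ((measurableSet_lt measurable_const measurable_snd).inter
    ((measurableSet_lt measurable_snd measurable_fst).inter
      (measurableSet_lt measurable_fst measurable_const)))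

theorem indicator_openTriangle_slice_fst {a b : ℝ} (F : ℝ → ℝ → E) (r : ℝ) :
    (fun q => (openTriangle a b).indicator (Function.uncurry F) (r, q)) =
      if r ∈ Ioo a b then (Ioo a r).indicator (F r) else 0 := by
  ext q
  by_cases hr : r ∈ Ioo a b
  · by_cases hq : q ∈ Ioo a r
    · have : (r, q) ∈ openTriangle a b := ⟨hq.1, hq.2, hr.2⟩
      simp [hr, hq, this]
    · have : (r, q) ∉ openTriangle a b := fun h => hq ⟨h.1, h.2.1⟩
      simp [hr, hq, this]
  · have : (r, q) ∉ openTriangle a b := fun h => hr ⟨h.1.trans h.2.1, h.2.2⟩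
    simp [hr, this]

theorem indicator_openTriangle_slice_snd {a b : ℝ} (F : ℝ → ℝ → E) (q : ℝ) :
    (fun r => (openTriangle a b).indicator (Function.uncurry F) (r, q)) =
      if q ∈ Ioo a b then (Ioo q b).indicator (fun r => F r q) else 0 := by
  ext r
  by_cases hq : q ∈ Ioo a b
  · by_cases hr : r ∈ Ioo q b
    · have : (r, q) ∈ openTriangle a b := ⟨hq.1, hr.1, hr.2⟩
      simp [hr, hq, this]
    · have : (r, q) ∉ openTriangle a b := fun h => hr ⟨h.2.1, h.2.2⟩
      simp [hr, hq, this]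
  · have : (r, q) ∉ openTriangle a b := fun h => hq ⟨h.1, h.2.1.trans h.2.2⟩
    simp [hq, this]

/-- Extend by zero off the triangle and apply Fubini on the plane; slices of the indicator are
indicators of intervals. -/
theorem integral_triangle_swap {a b : ℝ} (hab : a ≤ b) {F : ℝ → ℝ → E}
    (hF : IntegrableOn (Function.uncurry F) (openTriangle a b) (volume.prod volume)) :
    ∫ r in a..b, ∫ q in a..r, F r q = ∫ q in a..b, ∫ r in q..b, F r q := by
  rw [← integrable_indicator_iff (measurableSet_openTriangle a b)] at hF
  have h := integral_integral_swap (f := fun r q =>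
    (openTriangle a b).indicator (Function.uncurry F) (r, q)) hF
  simp only [intervalIntegral.integral_of_le hab, integral_Ioc_eq_integral_Ioo]
  rw [← integral_indicator measurableSet_Ioo, ← integral_indicator measurableSet_Ioo]
  convert h using 2
  · ext r
    rw [indicator_openTriangle_slice_fst]
    by_cases hr : r ∈ Ioo a b
    · rw [if_pos hr, indicator_of_mem hr, intervalIntegral.integral_of_le hr.1.le,
        integral_Ioc_eq_integral_Ioo, integral_indicator measurableSet_Ioo]
    · simp [hr]
  · ext q
    rw [indicator_openTriangle_slice_snd]
    by_cases hq : q ∈ Ioo a b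
    · rw [if_pos hq, indicator_of_mem hq, intervalIntegral.integral_of_le hq.2.le,
        integral_Ioc_eq_integral_Ioo, integral_indicator measurableSet_Ioo]
    · simp [hq]

/-- Tonelli with a majorant whose inner integrals can be computed. The companion
`integrableOn_triangle_of_snd` integrates in the other variable first; which one applies depends on
which inner integral is explicit. -/
theorem integrableOn_triangle_of_fst {a b : ℝ} (hab : a ≤ b) {F : ℝ → ℝ → E} {H : ℝ → ℝ → ℝ}
    {h : ℝ → ℝ}
    (hF : AEStronglyMeasurable (Function.uncurry F)
      ((volume.prod volume).restrict (openTriangle a b)))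
    (hFH : ∀ r ∈ Ioo a b, ∀ q ∈ Ioo a r, ‖F r q‖ ≤ H r q)
    (hH : ∀ r ∈ Ioo a b, IntervalIntegrable (H r) volume a r)
    (hHh : ∀ r ∈ Ioo a b, ∫ q in a..r, H r q ≤ h r)
    (hh : IntervalIntegrable h volume a b) :
    IntegrableOn (Function.uncurry F) (openTriangle a b) (volume.prod volume) := by
  rw [← integrable_indicator_iff (measurableSet_openTriangle a b)]
  have hm : AEStronglyMeasurable ((openTriangle a b).indicator (Function.uncurry F))
    (volume.prod volume) := (aestronglyMeasurable_indicator_iff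
      (measurableSet_openTriangle a b)).2 hF
  have hslice : ∀ᵐ r : ℝ, AEStronglyMeasurable
    (fun q => (openTriangle a b).indicator (Function.uncurry F) (r, q)) volume :=
    hm.prodMk_left
  rw [integrable_prod_iff hm]
  have hint : ∀ᵐ r : ℝ, Integrable
      (fun q => (openTriangle a b).indicator (Function.uncurry F) (r, q)) volume := by
    filter_upwards [hslice] with r hr
    rw [indicator_openTriangle_slice_fst] at hr ⊢
    by_cases hr' : r ∈ Ioo a b
    · rw [if_pos hr'] at hr ⊢
      rw [integrable_indicator_iff measurableSet_Ioo]
      rw [aestronglyMeasurable_indicator_iff measurableSet_Ioo] at hr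
      have := intervalIntegrable_of_Ioo hr'.1.le hr (hFH r hr') (hH r hr')
      rwa [intervalIntegrable_iff_integrableOn_Ioo_of_le hr'.1.le] at this
    · rw [if_neg hr']
      exact integrable_zero _ _ _
  refine ⟨hint, ?_⟩
  rw [intervalIntegrable_iff_integrableOn_Ioo_of_le hab,
    ← integrable_indicator_iff measurableSet_Ioo] at hh
  refine hh.mono' hm.norm.integral_prod_right' (hint.mono fun r hr => ?_)
  have e : (fun q => ‖(openTriangle a b).indicator (Function.uncurry F) (r, q)‖) =
      fun q => ‖(if r ∈ Ioo a b then (Ioo a r).indicator (F r) else 0) q‖ := by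
    rw [← indicator_openTriangle_slice_fst]
  rw [Real.norm_of_nonneg (integral_nonneg fun _ => norm_nonneg _), e]
  by_cases hr' : r ∈ Ioo a b
  · simp only [if_pos hr', norm_indicator_eq_indicator_norm]
    rw [indicator_of_mem hr', integral_indicator measurableSet_Ioo]
    refine le_trans ?_ (hHh r hr')
    rw [intervalIntegral.integral_of_le hr'.1.le, integral_Ioc_eq_integral_Ioo]
    refine setIntegral_mono_on ?_ ?_ measurableSet_Ioo (hFH r hr')
    · rw [indicator_openTriangle_slice_fst, if_pos hr',
        integrable_indicator_iff measurableSet_Ioo] at hr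
      exact hr.norm
    · have := hH r hr'
      rwa [intervalIntegrable_iff_integrableOn_Ioo_of_le hr'.1.le] at this
  · simp only [if_neg hr', indicator_of_notMem hr', Pi.zero_apply, norm_zero, integral_zero,
      le_refl]

theorem integrableOn_triangle_of_snd {a b : ℝ} (hab : a ≤ b) {F : ℝ → ℝ → E} {H : ℝ → ℝ → ℝ}
    {h : ℝ → ℝ}
    (hF : AEStronglyMeasurable (Function.uncurry F)
      ((volume.prod volume).restrict (openTriangle a b)))
    (hFH : ∀ q ∈ Ioo a b, ∀ r ∈ Ioo q b, ‖F r q‖ ≤ H r q)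
    (hH : ∀ q ∈ Ioo a b, IntervalIntegrable (fun r => H r q) volume q b)
    (hHh : ∀ q ∈ Ioo a b, ∫ r in q..b, H r q ≤ h q)
    (hh : IntervalIntegrable h volume a b) :
    IntegrableOn (Function.uncurry F) (openTriangle a b) (volume.prod volume) := by
  rw [← integrable_indicator_iff (measurableSet_openTriangle a b)]
  have hm : AEStronglyMeasurable ((openTriangle a b).indicator (Function.uncurry F))
    (volume.prod volume) := (aestronglyMeasurable_indicator_iff
      (measurableSet_openTriangle a b)).2 hF
  have hslice : ∀ᵐ q : ℝ, AEStronglyMeasurable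
    (fun r => (openTriangle a b).indicator (Function.uncurry F) (r, q)) volume :=
    hm.prod_swap.prodMk_left
  rw [integrable_prod_iff' hm]
  have hint : ∀ᵐ q : ℝ, Integrable
      (fun r => (openTriangle a b).indicator (Function.uncurry F) (r, q)) volume := by
    filter_upwards [hslice] with q hq
    rw [indicator_openTriangle_slice_snd] at hq ⊢
    by_cases hq' : q ∈ Ioo a b
    · rw [if_pos hq'] at hq ⊢
      rw [integrable_indicator_iff measurableSet_Ioo]
      rw [aestronglyMeasurable_indicator_iff measurableSet_Ioo] at hq
      have := intervalIntegrable_of_Ioo hq'.2.le hq (hFH q hq') (hH q hq')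
      rwa [intervalIntegrable_iff_integrableOn_Ioo_of_le hq'.2.le] at this
    · rw [if_neg hq']
      exact integrable_zero _ _ _
  refine ⟨hint, ?_⟩
  rw [intervalIntegrable_iff_integrableOn_Ioo_of_le hab,
    ← integrable_indicator_iff measurableSet_Ioo] at hh
  refine hh.mono' hm.norm.prod_swap.integral_prod_right' (hint.mono fun q hq => ?_)
  have e : (fun r => ‖(openTriangle a b).indicator (Function.uncurry F) (r, q)‖) =
      fun r => ‖(if q ∈ Ioo a b then (Ioo q b).indicator (fun r => F r q) else 0) r‖ := by
    rw [← indicator_openTriangle_slice_snd]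
  rw [Real.norm_of_nonneg (integral_nonneg fun _ => norm_nonneg _), e]
  by_cases hq' : q ∈ Ioo a b
  · simp only [if_pos hq', norm_indicator_eq_indicator_norm]
    rw [indicator_of_mem hq', integral_indicator measurableSet_Ioo]
    refine le_trans ?_ (hHh q hq')
    rw [intervalIntegral.integral_of_le hq'.2.le, integral_Ioc_eq_integral_Ioo]
    refine setIntegral_mono_on ?_ ?_ measurableSet_Ioo (hFH q hq')
    · rw [indicator_openTriangle_slice_snd, if_pos hq',
        integrable_indicator_iff measurableSet_Ioo] at hq
      exact hq.norm
    · have := hH q hq'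
      rwa [intervalIntegrable_iff_integrableOn_Ioo_of_le hq'.2.le] at this
  · simp only [if_neg hq', indicator_of_notMem hq', Pi.zero_apply, norm_zero, integral_zero,
      le_refl]

end Triangle

/-! ### Measurability of integrals depending on a parameter -/

section ParametricMeasurability

variable {E : Type*} [NormedAddCommGroup E] [NormedSpace ℝ E] {X : Type*} [MeasurableSpace X]

/-- Moving end points become a measurable region of the product space, so the integral is that of an
indicator against a fixed measure. The two orientations are treated separately and subtracted. -/
theorem stronglyMeasurable_intervalIntegral {f : X → ℝ → E} {l u : X → ℝ}
    (hf : StronglyMeasurable (Function.uncurry f)) (hl : Measurable l) (hu : Measurable u) :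
    StronglyMeasurable fun x => ∫ q in l x..u x, f x q := by
  have key : ∀ l u : X → ℝ, Measurable l → Measurable u →
      StronglyMeasurable fun x => ∫ q in Ioc (l x) (u x), f x q := by
    intro l u hl hu
    have h1 : MeasurableSet {p : X × ℝ | l p.1 < p.2 ∧ p.2 ≤ u p.1} :=
      (measurableSet_lt (hl.comp measurable_fst) measurable_snd).inter
        (measurableSet_le measurable_snd (hu.comp measurable_fst))
    have h2 := (hf.indicator h1).integral_prod_right' (ν := volume)
    convert h2 using 2 with x
    rw [← integral_indicator measurableSet_Ioc]
    rfl
  exact (key l u hl hu).sub (key u l hu hl)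

theorem stronglyMeasurable_weylLeft {α : ℝ} {a : X → ℝ} {K : X → ℝ → E}
    (hK : StronglyMeasurable (Function.uncurry K)) (ha : Measurable a) :
    StronglyMeasurable fun p : X × ℝ => weylLeft α (a p.1) (K p.1) p.2 := by
  unfold weylLeft
  refine StronglyMeasurable.const_smul (StronglyMeasurable.add ?_
    (StronglyMeasurable.const_smul ?_ _)) _
  · refine StronglyMeasurable.smul (Measurable.stronglyMeasurable ?_) hK
    fun_prop
  · refine stronglyMeasurable_intervalIntegral (X := X × ℝ)
      (f := fun p q => ((p.2 - q) ^ (1 + α))⁻¹ • (K p.1 p.2 - K p.1 q)) ?_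
      (ha.comp measurable_fst) measurable_snd
    refine StronglyMeasurable.smul (Measurable.stronglyMeasurable ?_) ?_
    · fun_prop
    · refine StronglyMeasurable.sub (f := fun p : (X × ℝ) × ℝ => K p.1.1 p.1.2)
        (g := fun p : (X × ℝ) × ℝ => K p.1.1 p.2) ?_ ?_
      · exact hK.comp_measurable measurable_fst
      · exact hK.comp_measurable (g := fun p : (X × ℝ) × ℝ => (p.1.1, p.2)) (by fun_prop)

theorem stronglyMeasurable_weylRight {α : ℝ} {b : X → ℝ} {w : X → ℝ → E}
    (hw : StronglyMeasurable (Function.uncurry w)) (hb : Measurable b) :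
    StronglyMeasurable fun p : X × ℝ => weylRight α (b p.1) (w p.1) p.2 := by
  unfold weylRight
  refine StronglyMeasurable.const_smul (StronglyMeasurable.add ?_
    (StronglyMeasurable.const_smul ?_ _)) _
  · refine StronglyMeasurable.smul (Measurable.stronglyMeasurable ?_) ?_
    · fun_prop
    · refine StronglyMeasurable.sub (f := fun p : X × ℝ => w p.1 p.2)
        (g := fun p : X × ℝ => w p.1 (b p.1)) hw ?_
      exact hw.comp_measurable (g := fun p : X × ℝ => (p.1, b p.1)) (by fun_prop)
  · refine stronglyMeasurable_intervalIntegral (X := X × ℝ)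
      (f := fun p q => ((q - p.2) ^ (2 - α))⁻¹ • (w p.1 p.2 - w p.1 q)) ?_
      measurable_snd (hb.comp measurable_fst)
    refine StronglyMeasurable.smul (Measurable.stronglyMeasurable ?_) ?_
    · fun_prop
    · refine StronglyMeasurable.sub (f := fun p : (X × ℝ) × ℝ => w p.1.1 p.1.2)
        (g := fun p : (X × ℝ) × ℝ => w p.1.1 p.2) ?_ ?_
      · exact hw.comp_measurable measurable_fst
      · exact hw.comp_measurable (g := fun p : (X × ℝ) × ℝ => (p.1.1, p.2)) (by fun_prop)

end ParametricMeasurability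

/-! ### Evaluation and composition of Hilbert-Schmidt operators -/

namespace HS

variable {V : Type*} [NormedAddCommGroup V] [InnerProductSpace ℝ V] {e : HilbertBasis ℕ ℝ V}

/-- Expand x in the base and apply Cauchy–Schwarz: the Hilbert–Schmidt norm dominates the operator
norm. -/
theorem norm_toCLM_apply_le (K : HS e) (x : V) : ‖toCLM K x‖ ≤ ‖K‖ * ‖x‖ := by
  have h := summable_and_le (e := e) (toLp K) x
  have hx : HasSum (fun i => toCLM K (e.repr x i • e i)) (toCLM K x) :=
    (e.hasSum_repr x).mapL (toCLM K)
  have hn (i : ℕ) : ‖toCLM K (e.repr x i • e i)‖ = ‖e.repr x i‖ * ‖toLp K i‖ := by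
    rw [map_smul, norm_smul, toLp_apply]
  rw [← hx.tsum_eq]
  refine (norm_tsum_le_tsum_norm ?_).trans ?_
  · simpa only [hn] using h.1
  · simpa only [hn, norm_eq] using h.2

/-- The bounded bilinear map `(K, x) ↦ K x`. -/
def evalL (e : HilbertBasis ℕ ℝ V) : HS e →L[ℝ] V →L[ℝ] V :=
  LinearMap.mkContinuous toCLM 1 fun K =>
    ContinuousLinearMap.opNorm_le_bound _ (by positivity) fun x => by
      simpa using norm_toCLM_apply_le K x

@[simp] theorem evalL_apply (K : HS e) (x : V) : evalL e K x = toCLM K x := rfl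

theorem norm_lcomp_le (B : V →L[ℝ] V) (K : HS e) : ‖lcomp B K‖ ≤ ‖B‖ * ‖K‖ := by
  have h1 : ‖K‖ ^ 2 = ∑' i, ‖toCLM K (e i)‖ ^ 2 := norm_sq_eq K
  have hs : Summable fun i => ‖toCLM K (e i)‖ ^ 2 := by
    have := K.memℓp.summable (by norm_num)
    simpa using this
  have hs' : Summable fun i => ‖toCLM (lcomp B K) (e i)‖ ^ 2 := by
    have := (lcomp B K).memℓp.summable (by norm_num)
    simpa using this
  refine (sq_le_sq₀ (by positivity) (by positivity)).1 ?_
  rw [mul_pow, h1, norm_sq_eq, ← tsum_mul_left]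
  refine hs'.tsum_le_tsum (fun i => ?_) (hs.mul_left _)
  rw [← mul_pow]
  gcongr
  exact B.le_opNorm _

@[simp] theorem toCLM_lcomp (B : V →L[ℝ] V) (K : HS e) :
    toCLM (lcomp B K) = B.comp (toCLM K) := rfl

/-- The bounded bilinear map `(B, K) ↦ B ∘ K`. -/
def lcompL (e : HilbertBasis ℕ ℝ V) : (V →L[ℝ] V) →L[ℝ] HS e →L[ℝ] HS e :=
  LinearMap.mkContinuous₂
    (LinearMap.mk₂ ℝ lcomp
      (fun B B' K => toCLM_injective (by simp [ContinuousLinearMap.add_comp]))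
      (fun c B K => toCLM_injective (by simp))
      (fun B K K' => toCLM_injective (by simp [ContinuousLinearMap.comp_add]))
      (fun c B K => toCLM_injective (by simp)))
    1 fun B K => by simpa using norm_lcomp_le B K

@[simp] theorem lcompL_apply (B : V →L[ℝ] V) (K : HS e) : lcompL e B K = lcomp B K := rfl

end HS

/-! ### Estimates of Weyl derivatives -/

section WeylEstimates

variable {E : Type*} [NormedAddCommGroup E] [NormedSpace ℝ E]

/-- The bound `M` and a Hölder condition of order `θ` and `β`, with singularities at the right and
the left end of `(a, t)`, respectively. -/
structure KernelBound (θ β : ℝ) (M : ℝ → ℝ) (a t : ℝ) (K : ℝ → E) : Prop where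
  norm_le : ∀ r, a < r → r < t → ‖K r‖ ≤ M r
  sub_le : ∀ q r, a < q → q < r → r < t →
    ‖K r - K q‖ ≤ M r * ((r - q) ^ θ * (t - r) ^ (-θ) + (r - q) ^ β * (q - a) ^ (-β))

/-- The Hölder condition `|w(t) - w(s)| ≤ C |t - s|^γ` on `[a, b]`. -/
def HolderBound (γ C a b : ℝ) (w : ℝ → E) : Prop :=
  ∀ s t, a ≤ s → s ≤ t → t ≤ b → ‖w t - w s‖ ≤ C * (t - s) ^ γ

theorem HolderBound.mono {γ C a b a' b' : ℝ} {w : ℝ → E} (h : HolderBound γ C a b w)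
    (ha : a ≤ a') (hb : b' ≤ b) : HolderBound γ C a' b' w :=
  fun s t hs hst ht => h s t (ha.trans hs) hst (ht.trans hb)

theorem inv_rpow_mul_rpow {x : ℝ} (hx : 0 < x) (y z : ℝ) : (x ^ y)⁻¹ * x ^ z = x ^ (z - y) := by
  rw [Real.rpow_sub hx, div_eq_inv_mul]

theorem KernelBound.nonneg {θ β : ℝ} {M : ℝ → ℝ} {a t : ℝ} {K : ℝ → E}
    (h : KernelBound θ β M a t K) {r : ℝ} (h1 : a < r) (h2 : r < t) : 0 ≤ M r :=
  (norm_nonneg _).trans (h.norm_le r h1 h2)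

theorem KernelBound.norm_increment_le {θ β : ℝ} {M : ℝ → ℝ} {a t : ℝ} {K : ℝ → E}
    (h : KernelBound θ β M a t K) (α : ℝ) {q r : ℝ} (h1 : a < q) (h2 : q < r) (h3 : r < t) :
    ‖((r - q) ^ (1 + α))⁻¹ • (K r - K q)‖ ≤ M r * ((t - r) ^ (-θ) * (r - q) ^ (θ - (1 + α)) +
      (q - a) ^ (-β) * (r - q) ^ (β - (1 + α))) := by
  have h0 : 0 < r - q := sub_pos.2 h2
  rw [norm_smul, norm_inv, Real.norm_of_nonneg (Real.rpow_nonneg h0.le _)]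
  calc _ ≤ ((r - q) ^ (1 + α))⁻¹ *
        (M r * ((r - q) ^ θ * (t - r) ^ (-θ) + (r - q) ^ β * (q - a) ^ (-β))) := by
        gcongr
        exact h.sub_le q r h1 h2 h3
    _ = _ := by
        rw [← inv_rpow_mul_rpow h0, ← inv_rpow_mul_rpow h0]
        ring

theorem intervalIntegrable_incrementBound {θ β α a r : ℝ} (c m : ℝ) (har : a ≤ r) (hθ : α < θ)
    (hβ : α < β) (hβ1 : β < 1) :
    IntervalIntegrable (fun q => m * (c * (r - q) ^ (θ - (1 + α)) +
      (q - a) ^ (-β) * (r - q) ^ (β - (1 + α)))) volume a r :=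
  (((intervalIntegrable_sub_rpow_right har (by linarith)).const_mul _).add
    (intervalIntegrable_rpow_mul_rpow har (by linarith) (by linarith))).const_mul _

theorem integral_incrementBound {θ β α a r : ℝ} (c m : ℝ) (har : a < r) (hθ : α < θ)
    (hβ : α < β) (hβ1 : β < 1) :
    ∫ q in a..r, m * (c * (r - q) ^ (θ - (1 + α)) +
      (q - a) ^ (-β) * (r - q) ^ (β - (1 + α))) =
    m * (c * ((r - a) ^ (θ - α) / (θ - α)) +
      eulerIntegral (-β) (β - (1 + α)) * (r - a) ^ (-α)) := by
  rw [intervalIntegral.integral_const_mul, intervalIntegral.integral_add,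
    intervalIntegral.integral_const_mul, integral_sub_rpow_right (by linarith),
    integral_rpow_mul_rpow har]
  · ring_nf
  · exact (intervalIntegrable_sub_rpow_right har.le (by linarith)).const_mul _
  · exact intervalIntegrable_rpow_mul_rpow har.le (by linarith) (by linarith)

theorem KernelBound.aestronglyMeasurable_increment {a t : ℝ} {K : ℝ → E}
    (hK : AEStronglyMeasurable K (volume.restrict (Ioo a t))) (α : ℝ) {r : ℝ} (h2 : r < t) :
    AEStronglyMeasurable (fun q => ((r - q) ^ (1 + α))⁻¹ • (K r - K q))
      (volume.restrict (Ioo a r)) := by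
  refine AEStronglyMeasurable.smul (Measurable.aestronglyMeasurable (by fun_prop)) ?_
  exact aestronglyMeasurable_const.sub (hK.mono_set (Ioo_subset_Ioo_right h2.le))

theorem KernelBound.intervalIntegrable_increment {θ β α : ℝ} {M : ℝ → ℝ} {a t : ℝ} {K : ℝ → E}
    (h : KernelBound θ β M a t K) (hK : AEStronglyMeasurable K (volume.restrict (Ioo a t)))
    (hθ : α < θ) (hβ : α < β) (hβ1 : β < 1) {r : ℝ} (h1 : a < r) (h2 : r < t) :
    IntervalIntegrable (fun q => ((r - q) ^ (1 + α))⁻¹ • (K r - K q)) volume a r :=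
  intervalIntegrable_of_Ioo h1.le (KernelBound.aestronglyMeasurable_increment hK α h2)
    (fun _ hq => h.norm_increment_le α hq.1 hq.2 h2)
    (intervalIntegrable_incrementBound _ _ h1.le hθ hβ hβ1)

/-- The constant in the estimate of the left-sided Weyl derivative. -/
def weylLeftConst (α θ β : ℝ) : ℝ :=
  (Real.Gamma (1 - α))⁻¹ * (1 + α * (eulerIntegral (-β) (β - (1 + α)) + (θ - α)⁻¹))

theorem weylLeftConst_nonneg {α θ β : ℝ} (hα : 0 < α) (hα1 : α < 1) (hθ : α < θ) :
    0 ≤ weylLeftConst α θ β := by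
  have h0 : 0 < Real.Gamma (1 - α) := Real.Gamma_pos_of_pos (by linarith)
  have h1 := eulerIntegral_nonneg (-β) (β - (1 + α))
  have h2 : 0 < θ - α := by linarith
  unfold weylLeftConst
  positivity

/-- In the increment integral the θ-part integrates to (r-a)^{θ-α} (t-r)^{-θ}, since θ > α. The
β-part is a Beta integral and scales like the boundary term (r-a)^{-α}. -/
theorem KernelBound.norm_weylLeft_le {θ β α : ℝ} {M : ℝ → ℝ} {a t : ℝ} {K : ℝ → E}
    (h : KernelBound θ β M a t K) (hα : 0 < α) (hθ : α < θ) (hβ : α < β) (hβ1 : β < 1)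
    {r : ℝ} (h1 : a < r) (h2 : r < t) :
    ‖weylLeft α a K r‖ ≤ weylLeftConst α θ β *
      (M r * ((r - a) ^ (-α) + (r - a) ^ (θ - α) * (t - r) ^ (-θ))) := by
  have h0 : 0 < Real.Gamma (1 - α) := Real.Gamma_pos_of_pos (by linarith)
  have hI := norm_integral_le_of_Ioo h1.le
    (fun q hq => h.norm_increment_le α hq.1 hq.2 h2)
    (intervalIntegrable_incrementBound ((t - r) ^ (-θ)) (M r) h1.le hθ hβ hβ1)
  rw [integral_incrementBound _ _ h1 hθ hβ hβ1] at hI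
  have hM := h.nonneg h1 h2
  have hK := h.norm_le r h1 h2
  have e1 := eulerIntegral_nonneg (-β) (β - (1 + α))
  have hra : 0 < r - a := sub_pos.2 h1
  have htr : 0 < t - r := sub_pos.2 h2
  have p1 : 0 < (r - a) ^ (-α) := Real.rpow_pos_of_pos hra _
  have p2 : 0 < (r - a) ^ (θ - α) := Real.rpow_pos_of_pos hra _
  have p3 : 0 < (t - r) ^ (-θ) := Real.rpow_pos_of_pos htr _
  have hθα : 0 < θ - α := by linarith
  unfold weylLeft weylLeftConst
  rw [norm_smul, norm_inv, Real.norm_of_nonneg h0.le, mul_assoc]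
  gcongr
  refine (norm_add_le _ _).trans ?_
  rw [norm_smul, norm_smul, norm_inv, Real.norm_of_nonneg (Real.rpow_nonneg hra.le _),
    Real.norm_of_nonneg hα.le, ← Real.rpow_neg hra.le]
  calc _ ≤ (r - a) ^ (-α) * M r + α * (M r * ((t - r) ^ (-θ) * ((r - a) ^ (θ - α) / (θ - α)) +
      eulerIntegral (-β) (β - (1 + α)) * (r - a) ^ (-α))) := by gcongr
    _ = M r * ((1 + α * eulerIntegral (-β) (β - (1 + α))) * (r - a) ^ (-α) +
        (α * (θ - α)⁻¹) * ((r - a) ^ (θ - α) * (t - r) ^ (-θ))) := by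
        rw [div_eq_mul_inv]; ring
    _ ≤ M r * ((1 + α * (eulerIntegral (-β) (β - (1 + α)) + (θ - α)⁻¹)) * (r - a) ^ (-α) +
        (1 + α * (eulerIntegral (-β) (β - (1 + α)) + (θ - α)⁻¹)) *
          ((r - a) ^ (θ - α) * (t - r) ^ (-θ))) := by
        have i1 : 0 < (θ - α)⁻¹ := inv_pos.2 hθα
        have i2 : 0 ≤ α * eulerIntegral (-β) (β - (1 + α)) := by positivity
        have i3 : 0 ≤ α * (θ - α)⁻¹ := by positivity
        gcongr
        · linarith
        · rw [mul_add]; linarith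
    _ = _ := by ring

/-- The derivative at r sees K only at r and almost everywhere on (a, r). This allows passing to a
measurable version of K, or freezing K after r. -/
theorem weylLeft_congr {α a r : ℝ} {K K' : ℝ → E} (har : a ≤ r) (hr : K r = K' r)
    (h : ∀ᵐ q ∂(volume.restrict (Ioo a r)), K q = K' q) :
    weylLeft α a K r = weylLeft α a K' r := by
  unfold weylLeft
  rw [hr, intervalIntegral.integral_of_le har, intervalIntegral.integral_of_le har,
    integral_Ioc_eq_integral_Ioo, integral_Ioc_eq_integral_Ioo]
  congr 3
  refine integral_congr_ae ?_
  filter_upwards [h] with q hq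
  rw [hq]

theorem aestronglyMeasurable_weylLeft {α a t : ℝ} {K : ℝ → E}
    (hK : AEStronglyMeasurable K (volume.restrict (Ioo a t))) :
    AEStronglyMeasurable (weylLeft α a K) (volume.restrict (Ioo a t)) := by
  have h := stronglyMeasurable_weylLeft (α := α) (X := Unit) (K := fun _ => hK.mk K)
    (a := fun _ => a) (hK.stronglyMeasurable_mk.comp_measurable measurable_snd) measurable_const
  have h' : StronglyMeasurable fun r => weylLeft α a (hK.mk K) r :=
    h.comp_measurable (g := fun r : ℝ => ((), r)) (by fun_prop)
  refine ⟨_, h', ?_⟩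
  filter_upwards [hK.ae_eq_mk, ae_restrict_mem measurableSet_Ioo] with r hr hr'
  exact weylLeft_congr hr'.1.le hr
    (ae_restrict_of_ae_restrict_of_subset (Ioo_subset_Ioo_right hr'.2.le) hK.ae_eq_mk)

/-- The increment bound carries the weight at the later time. It is constant when r is approached
from the left; from the right the continuity of M is needed. -/
theorem KernelBound.continuousOn {θ β : ℝ} {M : ℝ → ℝ} {a t : ℝ} {K : ℝ → E}
    (h : KernelBound θ β M a t K) (hM : ContinuousOn M (Ioo a t)) (hθ : 0 < θ) (hβ : 0 < β) :
    ContinuousOn K (Ioo a t) := by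
  intro r hr
  refine ContinuousAt.continuousWithinAt ?_
  have hMr : ContinuousAt M r := hM.continuousAt (Ioo_mem_nhds hr.1 hr.2)
  have hra : r - a ≠ 0 := (sub_pos.2 hr.1).ne'
  have htr : t - r ≠ 0 := (sub_pos.2 hr.2).ne'
  rw [continuousAt_iff_continuous_left'_right']
  constructor
  · rw [ContinuousWithinAt, tendsto_iff_norm_sub_tendsto_zero]
    have hlim : Tendsto (fun q => M r * ((r - q) ^ θ * (t - r) ^ (-θ) +
        (r - q) ^ β * (q - a) ^ (-β))) (𝓝[<] r) (𝓝 0) := by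
      have : ContinuousAt (fun q => M r * ((r - q) ^ θ * (t - r) ^ (-θ) +
          (r - q) ^ β * (q - a) ^ (-β))) r := by
        refine continuousAt_const.mul ((ContinuousAt.mul ?_ continuousAt_const).add
          (ContinuousAt.mul ?_ ?_))
        · exact ContinuousAt.rpow_const (by fun_prop) (Or.inr hθ.le)
        · exact ContinuousAt.rpow_const (by fun_prop) (Or.inr hβ.le)
        · exact ContinuousAt.rpow_const (by fun_prop) (Or.inl hra)
      have h2 := this.tendsto.mono_left (nhdsWithin_le_nhds (s := Iio r))
      simpa [Real.zero_rpow hθ.ne', Real.zero_rpow hβ.ne'] using h2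
    refine squeeze_zero' (Eventually.of_forall fun _ => norm_nonneg _) ?_ hlim
    filter_upwards [Ioo_mem_nhdsLT hr.1] with q hq
    rw [norm_sub_rev]
    exact h.sub_le q r hq.1 hq.2 hr.2
  · rw [ContinuousWithinAt, tendsto_iff_norm_sub_tendsto_zero]
    have hlim : Tendsto (fun q => M q * ((q - r) ^ θ * (t - q) ^ (-θ) +
        (q - r) ^ β * (r - a) ^ (-β))) (𝓝[>] r) (𝓝 0) := by
      have : ContinuousAt (fun q => M q * ((q - r) ^ θ * (t - q) ^ (-θ) +
          (q - r) ^ β * (r - a) ^ (-β))) r := by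
        refine hMr.mul ((ContinuousAt.mul ?_ ?_).add
          (ContinuousAt.mul ?_ continuousAt_const))
        · exact ContinuousAt.rpow_const (by fun_prop) (Or.inr hθ.le)
        · exact ContinuousAt.rpow_const (by fun_prop) (Or.inl htr)
        · exact ContinuousAt.rpow_const (by fun_prop) (Or.inr hβ.le)
      have h2 := this.tendsto.mono_left (nhdsWithin_le_nhds (s := Ioi r))
      simpa [Real.zero_rpow hθ.ne', Real.zero_rpow hβ.ne'] using h2
    refine squeeze_zero' (Eventually.of_forall fun _ => norm_nonneg _) ?_ hlim
    filter_upwards [Ioo_mem_nhdsGT hr.2] with q hq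
    exact h.sub_le r q hr.1 hq.1 hq.2

/-- The constant in the estimate of the right-sided Weyl derivative. -/
def weylRightConst (α γ : ℝ) : ℝ := (Real.Gamma α)⁻¹ * (1 + (1 - α) * (α + γ - 1)⁻¹)

theorem weylRightConst_nonneg {α γ : ℝ} (hα : 0 < α) (hα1 : α < 1) (hγ : 1 < α + γ) :
    0 ≤ weylRightConst α γ := by
  have h0 : 0 < Real.Gamma α := Real.Gamma_pos_of_pos hα
  have h1 : 0 < 1 - α := by linarith
  have h2 : 0 < α + γ - 1 := by linarith
  unfold weylRightConst
  positivity

theorem HolderBound.norm_increment_le {α γ C a b : ℝ} {w : ℝ → E} (h : HolderBound γ C a b w)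
    {q r : ℝ} (h1 : a ≤ r) (h2 : r < q) (h3 : q ≤ b) :
    ‖((q - r) ^ (2 - α))⁻¹ • (w r - w q)‖ ≤ C * (q - r) ^ (γ - (2 - α)) := by
  have h0 : 0 < q - r := sub_pos.2 h2
  rw [norm_smul, norm_inv, Real.norm_of_nonneg (Real.rpow_nonneg h0.le _), norm_sub_rev]
  calc _ ≤ ((q - r) ^ (2 - α))⁻¹ * (C * (q - r) ^ γ) := by
        gcongr
        exact h r q h1 h2.le h3
    _ = _ := by rw [mul_left_comm, inv_rpow_mul_rpow h0]

theorem HolderBound.intervalIntegrable_increment {α γ C a b : ℝ} {w : ℝ → E}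
    (h : HolderBound γ C a b w) (hw : StronglyMeasurable w) (hγ : 1 < α + γ)
    {r : ℝ} (h1 : a ≤ r) (h2 : r ≤ b) :
    IntervalIntegrable (fun q => ((q - r) ^ (2 - α))⁻¹ • (w r - w q)) volume r b := by
  refine intervalIntegrable_of_Ioo h2 ?_
    (fun q hq => h.norm_increment_le h1 hq.1 hq.2.le)
    ((intervalIntegrable_sub_rpow_left h2 (by linarith)).const_mul C)
  refine AEStronglyMeasurable.smul (Measurable.aestronglyMeasurable (by fun_prop)) ?_
  exact aestronglyMeasurable_const.sub hw.aestronglyMeasurable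

theorem HolderBound.nonneg {γ C a b : ℝ} {w : ℝ → E} (h : HolderBound γ C a b w) (hab : a < b) :
    0 ≤ C :=
  nonneg_of_mul_nonneg_left ((norm_nonneg _).trans (h a b le_rfl hab.le le_rfl))
    (Real.rpow_pos_of_pos (sub_pos.2 hab) _)

/-- As γ > 1 - α, the increments integrate against (q-r)^{α-2}, and the derivative even vanishes at
b with the positive power α + γ - 1. This compensates the singularity of the left-sided derivative
there. -/
theorem HolderBound.norm_weylRight_le {α γ C a b : ℝ} {w : ℝ → E} (h : HolderBound γ C a b w)
    (hα : 0 < α) (hα1 : α < 1) (hγ : 1 < α + γ) {r : ℝ} (h1 : a ≤ r) (h2 : r < b) :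
    ‖weylRight α b w r‖ ≤ weylRightConst α γ * (C * (b - r) ^ (α + γ - 1)) := by
  have h0 : 0 < Real.Gamma α := Real.Gamma_pos_of_pos hα
  have hI := norm_integral_le_of_Ioo h2.le
    (fun q hq => h.norm_increment_le (α := α) h1 hq.1 hq.2.le)
    ((intervalIntegrable_sub_rpow_left h2.le (by linarith)).const_mul C)
  rw [intervalIntegral.integral_const_mul, integral_sub_rpow_left (by linarith),
    show γ - (2 - α) + 1 = α + γ - 1 by ring] at hI
  have hbr : 0 < b - r := sub_pos.2 h2
  unfold weylRight weylRightConst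
  rw [norm_smul, norm_inv, Real.norm_of_nonneg h0.le, mul_assoc]
  gcongr
  refine (norm_add_le _ _).trans ?_
  rw [norm_smul, norm_smul, norm_inv, Real.norm_of_nonneg (Real.rpow_nonneg hbr.le _),
    Real.norm_of_nonneg (sub_pos.2 hα1).le, norm_sub_rev]
  calc _ ≤ ((b - r) ^ (1 - α))⁻¹ * (C * (b - r) ^ γ) +
        (1 - α) * (C * ((b - r) ^ (α + γ - 1) / (α + γ - 1))) := by
        have : 0 ≤ 1 - α := by linarith
        gcongr
        exact h r b h1 h2.le le_rfl
    _ = _ := by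
        rw [mul_left_comm, inv_rpow_mul_rpow hbr, show γ - (1 - α) = α + γ - 1 by ring]
        ring

theorem stronglyMeasurable_weylRight_const {α b : ℝ} {w : ℝ → E} (hw : StronglyMeasurable w) :
    StronglyMeasurable (weylRight α b w) := by
  have h := stronglyMeasurable_weylRight (α := α) (X := Unit) (w := fun _ => w)
    (b := fun _ => b) (hw.comp_measurable measurable_snd) measurable_const
  exact h.comp_measurable (g := fun r : ℝ => ((), r)) (by fun_prop)

end WeylEstimates

/-! ### Estimates of the pathwise integral -/

section IntegralEstimates

variable {V : Type*} [NormedAddCommGroup V] [InnerProductSpace ℝ V] {e : HilbertBasis ℕ ℝ V}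

/-- This is e^{-y} ≤ y^{-κ} with y = ρx: for y ≤ 1 the right side is at least 1, otherwise e^{-y} ≤
1/y. The factor ρ^{-κ} is the source of all smallness in the fixed point argument. -/
theorem rpow_mul_exp_le {x ρ κ : ℝ} (hx : 0 < x) (hρ : 0 < ρ) (hκ : 0 ≤ κ) (hκ1 : κ ≤ 1) :
    Real.exp (-(ρ * x)) ≤ ρ ^ (-κ) * x ^ (-κ) := by
  have hy : 0 < ρ * x := by positivity
  rw [← Real.mul_rpow hρ.le hx.le]
  by_cases h : ρ * x ≤ 1
  · calc Real.exp (-(ρ * x)) ≤ 1 := Real.exp_le_one_iff.2 (by linarith)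
      _ ≤ _ := Real.one_le_rpow_of_pos_of_le_one_of_nonpos hy h (by linarith)
  · push Not at h
    calc Real.exp (-(ρ * x)) = (Real.exp (ρ * x))⁻¹ := Real.exp_neg _
      _ ≤ (ρ * x)⁻¹ := by
        gcongr
        linarith [Real.add_one_le_exp (ρ * x)]
      _ = (ρ * x) ^ (-1 : ℝ) := (Real.rpow_neg_one _).symm
      _ ≤ _ := Real.rpow_le_rpow_of_exponent_le h.le (by linarith)

/-- The weight `m e^{ρ r} (t - r)^{-b}`. -/
def expWeight (m ρ b t r : ℝ) : ℝ := m * Real.exp (ρ * r) * (t - r) ^ (-b)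

theorem continuousOn_expWeight (m ρ b t a : ℝ) : ContinuousOn (expWeight m ρ b t) (Ioo a t) := by
  refine ContinuousOn.mul (by fun_prop) (ContinuousOn.rpow_const (by fun_prop) fun r hr => ?_)
  exact Or.inl (sub_pos.2 hr.2).ne'

/-- The constant in the estimate of the pathwise integral. -/
def fracConst (α θ β γ κ b : ℝ) : ℝ :=
  weylLeftConst α θ β * weylRightConst α γ *
    (eulerIntegral (-α) (α + γ - κ - 1 - b) + eulerIntegral (θ - α) (α + γ - κ - 1 - b - θ))

theorem fracConst_nonneg {α θ β γ : ℝ} (κ b : ℝ) (hα : 0 < α) (hα1 : α < 1) (hθ : α < θ)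
    (hγ : 1 < α + γ) : 0 ≤ fracConst α θ β γ κ b := by
  have h1 := weylLeftConst_nonneg (β := β) hα hα1 hθ
  have h2 := weylRightConst_nonneg hα hα1 hγ
  have h3 := eulerIntegral_nonneg (-α) (α + γ - κ - 1 - b)
  have h4 := eulerIntegral_nonneg (θ - α) (α + γ - κ - 1 - b - θ)
  unfold fracConst
  positivity

/-- Multiply the bounds of the two Weyl derivatives and split e^{ρr} = e^{ρt} e^{-ρ(t-r)}, trading
the last factor for ρ^{-κ} (t-r)^{-κ}. Two Beta integrals remain, both scaling like (t-a)^{γ-κ-b}.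
The worse exponent at t, namely α+γ-κ-1-b-θ, exceeds -1 exactly when b + θ < α + γ - κ. -/
theorem KernelBound.fracIntegrable_and_norm_le {α θ β γ κ b m ρ a t C : ℝ} {K : ℝ → HS e}
    {w : ℝ → V}
    (h : KernelBound θ β (expWeight m ρ b t) a t K) (hw : HolderBound γ C a t w)
    (hwc : Continuous w) (hat : a < t)
    (hα : 0 < α) (hθ : α < θ) (hβ : α < β) (hβ1 : β < 1) (hγ : 1 < α + γ)
    (hκ : 0 ≤ κ) (hκ1 : κ ≤ 1) (hb : b + θ < α + γ - κ) (hρ : 0 < ρ) :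
    FracIntegrable α K w a t ∧
      ‖fracIntegral α K w a t‖ ≤ fracConst α θ β γ κ b * (C * m) * ρ ^ (-κ) *
        Real.exp (ρ * t) * (t - a) ^ (γ - κ - b) := by
  have hα1 : α < 1 := hβ.trans hβ1
  have hC := hw.nonneg hat
  have hKc := h.continuousOn (continuousOn_expWeight _ _ _ _ _) (by linarith) (by linarith)
  have hKm : AEStronglyMeasurable K (volume.restrict (Ioo a t)) :=
    hKc.aestronglyMeasurable measurableSet_Ioo
  have hwm : StronglyMeasurable w := hwc.stronglyMeasurable
  have hl := aestronglyMeasurable_weylLeft (α := α) hKm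
  have hr := (stronglyMeasurable_weylRight_const (α := α) (b := t) hwm).aestronglyMeasurable
    (μ := volume.restrict (Ioo a t))
  have hL0 := weylLeftConst_nonneg (β := β) hα hα1 hθ
  have hR0 := weylRightConst_nonneg hα hα1 hγ
  set G : ℝ → ℝ := fun r => weylLeftConst α θ β * weylRightConst α γ * (C * m) * ρ ^ (-κ) *
    Real.exp (ρ * t) * ((r - a) ^ (-α) * (t - r) ^ (α + γ - κ - 1 - b) +
      (r - a) ^ (θ - α) * (t - r) ^ (α + γ - κ - 1 - b - θ)) with hG
  have i1 := intervalIntegrable_rpow_mul_rpow (s := a) (t := t) (x := -α)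
    (y := α + γ - κ - 1 - b) hat.le (by linarith) (by linarith)
  have i2 := intervalIntegrable_rpow_mul_rpow (s := a) (t := t) (x := θ - α)
    (y := α + γ - κ - 1 - b - θ) hat.le (by linarith) (by linarith)
  have hGi : IntervalIntegrable G volume a t := (i1.add i2).const_mul _
  have hbound : ∀ r ∈ Ioo a t, ‖weylLeft α a K r‖ * ‖weylRight α t w r‖ ≤ G r := by
    intro r hr
    have hra : 0 < r - a := sub_pos.2 hr.1
    have htr : 0 < t - r := sub_pos.2 hr.2
    have hm : 0 ≤ expWeight m ρ b t r := h.nonneg hr.1 hr.2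
    have hm' : 0 ≤ m := by
      unfold expWeight at hm
      rw [mul_assoc] at hm
      exact nonneg_of_mul_nonneg_left hm (mul_pos (Real.exp_pos _) (Real.rpow_pos_of_pos htr _))
    have b1 := h.norm_weylLeft_le hα hθ hβ hβ1 hr.1 hr.2
    have b2 := hw.norm_weylRight_le hα hα1 hγ hr.1.le hr.2
    have b3 := rpow_mul_exp_le htr hρ hκ hκ1
    have p1 : 0 < (r - a) ^ (-α) := Real.rpow_pos_of_pos hra _
    have p2 : 0 < (r - a) ^ (θ - α) := Real.rpow_pos_of_pos hra _
    have p3 : 0 < (t - r) ^ (-θ) := Real.rpow_pos_of_pos htr _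
    have p4 : 0 < (t - r) ^ (-b) := Real.rpow_pos_of_pos htr _
    have p5 : 0 < (t - r) ^ (α + γ - 1) := Real.rpow_pos_of_pos htr _
    calc _ ≤ (weylLeftConst α θ β *
        (expWeight m ρ b t r * ((r - a) ^ (-α) + (r - a) ^ (θ - α) * (t - r) ^ (-θ)))) *
        (weylRightConst α γ * (C * (t - r) ^ (α + γ - 1))) := by gcongr
      _ = weylLeftConst α θ β * weylRightConst α γ * (C * m) * (t - r) ^ (-b) *
          ((r - a) ^ (-α) + (r - a) ^ (θ - α) * (t - r) ^ (-θ)) * (t - r) ^ (α + γ - 1) *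
          (Real.exp (ρ * t) * Real.exp (-(ρ * (t - r)))) := by
          rw [← Real.exp_add, show ρ * t + -(ρ * (t - r)) = ρ * r by ring, expWeight]
          ring
      _ ≤ weylLeftConst α θ β * weylRightConst α γ * (C * m) * (t - r) ^ (-b) *
          ((r - a) ^ (-α) + (r - a) ^ (θ - α) * (t - r) ^ (-θ)) * (t - r) ^ (α + γ - 1) *
          (Real.exp (ρ * t) * (ρ ^ (-κ) * (t - r) ^ (-κ))) := by gcongr
      _ = G r := by
          have e1 : (t - r) ^ (α + γ - κ - 1 - b) =
              (t - r) ^ (-b) * (t - r) ^ (α + γ - 1) * (t - r) ^ (-κ) := by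
            rw [← Real.rpow_add htr, ← Real.rpow_add htr]; ring_nf
          have e2 : (t - r) ^ (α + γ - κ - 1 - b - θ) =
              (t - r) ^ (-b) * (t - r) ^ (α + γ - 1) * (t - r) ^ (-κ) * (t - r) ^ (-θ) := by
            rw [← Real.rpow_add htr, ← Real.rpow_add htr, ← Real.rpow_add htr]; ring_nf
          simp only [hG]
          rw [e1, e2]
          ring
  have hbound' : ∀ r ∈ Ioo a t,
      ‖HS.toCLM (weylLeft α a K r) (weylRight α t w r)‖ ≤ G r := fun r hr =>
    (HS.norm_toCLM_apply_le _ _).trans (hbound r hr)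
  refine ⟨⟨?_, ?_, ?_⟩, ?_⟩
  · filter_upwards [ae_restrict_mem measurableSet_Ioo] with r hr
    exact ⟨h.intervalIntegrable_increment hKm hθ hβ hβ1 hr.1 hr.2,
      hw.intervalIntegrable_increment hwm hγ hr.1.le hr.2.le⟩
  · refine intervalIntegrable_of_Ioo hat.le ?_ hbound' hGi
    exact (HS.evalL e).aestronglyMeasurable_comp₂ hl hr
  · refine intervalIntegrable_of_Ioo hat.le (hl.norm.mul hr.norm) (fun r hr => ?_) hGi
    rw [Real.norm_of_nonneg (by positivity)]
    exact hbound r hr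
  · unfold fracIntegral
    rw [norm_neg]
    refine (norm_integral_le_of_Ioo hat.le hbound' hGi).trans (le_of_eq ?_)
    rw [hG, intervalIntegral.integral_const_mul, intervalIntegral.integral_add i1 i2,
      integral_rpow_mul_rpow hat, integral_rpow_mul_rpow hat, fracConst,
      show -α + (α + γ - κ - 1 - b) + 1 = γ - κ - b by ring,
      show θ - α + (α + γ - κ - 1 - b - θ) + 1 = γ - κ - b by ring]
    ring

end IntegralEstimates

/-! ### Weyl derivatives of functions with a bounded density -/

section Density

variable {E : Type*} [NormedAddCommGroup E] [NormedSpace ℝ E] [CompleteSpace E]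

/-- On `[a, b]` the function `f` is an indefinite integral of `v`, and `v` is bounded by `C`. -/
structure HasBoundedDensity (f v : ℝ → E) (C a b : ℝ) : Prop where
  meas : AEStronglyMeasurable v (volume.restrict (Ioo a b))
  bound : ∀ r ∈ Ioo a b, ‖v r‖ ≤ C
  eq : ∀ q r, a ≤ q → q ≤ r → r ≤ b → f r - f q = ∫ s in q..r, v s

theorem HasBoundedDensity.mono {f v : ℝ → E} {C a b c d : ℝ} (h : HasBoundedDensity f v C a b)
    (hc : a ≤ c) (hd : d ≤ b) : HasBoundedDensity f v C c d where
  meas := h.meas.mono_set (Ioo_subset_Ioo hc hd)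
  bound r hr := h.bound r ⟨hc.trans_lt hr.1, hr.2.trans_le hd⟩
  eq q r h1 h2 h3 := h.eq q r (hc.trans h1) h2 (h3.trans hd)

theorem HasBoundedDensity.intervalIntegrable_smul {f v : ℝ → E} {C a b : ℝ}
    (h : HasBoundedDensity f v C a b) (hab : a ≤ b) {g : ℝ → ℝ}
    (hg : IntervalIntegrable g volume a b) :
    IntervalIntegrable (fun r => g r • v r) volume a b := by
  refine intervalIntegrable_of_Ioo hab ?_ (g := fun r => ‖g r‖ * C) (fun r hr => ?_)
    (hg.norm.mul_const C)
  · rw [intervalIntegrable_iff_integrableOn_Ioo_of_le hab] at hg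
    exact hg.aestronglyMeasurable.smul h.meas
  · rw [norm_smul]
    gcongr
    exact h.bound r hr

theorem aestronglyMeasurable_openTriangle_fst {F : Type*} [NormedAddCommGroup F] {v : ℝ → F}
    {a b : ℝ} (h : AEStronglyMeasurable v (volume.restrict (Ioo a b))) :
    AEStronglyMeasurable (fun p : ℝ × ℝ => v p.1)
      ((volume.prod volume).restrict (openTriangle a b)) := by
  have h1 := h.comp_fst (ν := (volume.restrict (Ioo a b) : Measure ℝ))
  rw [Measure.prod_restrict] at h1
  refine h1.mono_set ?_
  rintro ⟨r, q⟩ ⟨h2, h3, h4⟩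
  exact ⟨⟨h2.trans h3, h4⟩, h2, h3.trans h4⟩

theorem aestronglyMeasurable_openTriangle_snd {F : Type*} [NormedAddCommGroup F] {v : ℝ → F}
    {a b : ℝ} (h : AEStronglyMeasurable v (volume.restrict (Ioo a b))) :
    AEStronglyMeasurable (fun p : ℝ × ℝ => v p.2)
      ((volume.prod volume).restrict (openTriangle a b)) := by
  have h1 := h.comp_snd (μ := (volume.restrict (Ioo a b) : Measure ℝ))
  rw [Measure.prod_restrict] at h1
  refine h1.mono_set ?_
  rintro ⟨r, q⟩ ⟨h2, h3, h4⟩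
  exact ⟨⟨h2.trans h3, h4⟩, h2, h3.trans h4⟩

/-- Passage from the Marchaud to the Caputo form. With increments written as integrals of k, Fubini
leaves an explicit q-integral; its boundary part combines with (r-a)^{-α} K(r) to leave (r-a)^{-α}
K(a). -/
theorem HasBoundedDensity.weylLeft_eq {K k : ℝ → E} {α C a r : ℝ}
    (h : HasBoundedDensity K k C a r) (hα : 0 < α) (hα1 : α < 1) (har : a < r) :
    weylLeft α a K r = (Real.Gamma (1 - α))⁻¹ •
      ((r - a) ^ (-α) • K a + ∫ c in a..r, (r - c) ^ (-α) • k c) := by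
  have hra : 0 < r - a := sub_pos.2 har
  have e1 : ∫ q in a..r, ((r - q) ^ (1 + α))⁻¹ • (K r - K q) =
      ∫ q in a..r, ∫ c in q..r, (r - q) ^ (-(1 + α)) • k c := by
    refine integral_congr_Ioo har.le fun q hq => ?_
    rw [intervalIntegral.integral_smul, ← h.eq q r hq.1.le hq.2.le le_rfl,
      Real.rpow_neg (sub_pos.2 hq.2).le]
  have hint : IntegrableOn (Function.uncurry fun c q : ℝ => (r - q) ^ (-(1 + α)) • k c)
      (openTriangle a r) (volume.prod volume) := by
    refine integrableOn_triangle_of_snd har.le (H := fun _ q => (r - q) ^ (-(1 + α)) * C)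
      (h := fun q => (r - q) ^ (-α) * C) ?_ ?_ ?_ ?_ ?_
    · exact AEStronglyMeasurable.smul (Measurable.aestronglyMeasurable (by fun_prop))
        (aestronglyMeasurable_openTriangle_fst h.meas)
    · intro q hq c hc
      rw [norm_smul, Real.norm_of_nonneg (Real.rpow_nonneg (sub_pos.2 hq.2).le _)]
      have := Real.rpow_nonneg (sub_pos.2 hq.2).le (-(1 + α))
      gcongr
      exact h.bound c ⟨hq.1.trans hc.1, hc.2⟩
    · intro q hq
      exact intervalIntegrable_const
    · intro q hq
      have h0 : 0 < r - q := sub_pos.2 hq.2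
      rw [intervalIntegral.integral_const, smul_eq_mul, ← mul_assoc, mul_comm (r - q),
        ← Real.rpow_add_one h0.ne']
      ring_nf
      rfl
    · exact (intervalIntegrable_sub_rpow_right har.le (by linarith)).mul_const C
  have e2 : ∀ c ∈ Ioo a r, ∫ q in a..c, (r - q) ^ (-(1 + α)) • k c =
      α⁻¹ • ((r - c) ^ (-α) • k c - (r - a) ^ (-α) • k c) := by
    intro c hc
    rw [← sub_smul, smul_smul, intervalIntegral.integral_smul_const,
      integral_sub_rpow_right_of_pos hc.1.le hc.2 (by linarith)]
    congr 1
    rw [show -(1 + α) + 1 = -α by ring]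
    field_simp
    ring
  have i1 := h.intervalIntegrable_smul har.le
    (intervalIntegrable_sub_rpow_right (s := a) (t := r) (y := -α) har.le (by linarith))
  have i2 := h.intervalIntegrable_smul har.le
    (intervalIntegrable_const (μ := volume) (c := (r - a) ^ (-α)))
  unfold weylLeft
  rw [e1, ← integral_triangle_swap har.le hint, integral_congr_Ioo har.le e2]
  rw [intervalIntegral.integral_smul, smul_smul, mul_inv_cancel₀ hα.ne', one_smul,
    intervalIntegral.integral_sub i1 i2, intervalIntegral.integral_smul,
    ← h.eq a r le_rfl har.le le_rfl, Real.rpow_neg hra.le]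
  module

/-- Mirror image of the left-sided formula. Since the path is taken relative to its value at b, no
boundary term survives and only the fractional integral of order α of the density remains. -/
theorem HasBoundedDensity.weylRight_eq {w v : ℝ → E} {α C r b : ℝ}
    (h : HasBoundedDensity w v C r b) (hα : 0 < α) (hα1 : α < 1) (hrb : r < b) :
    weylRight α b w r = -(Real.Gamma α)⁻¹ • ∫ q in r..b, (q - r) ^ (α - 1) • v q := by
  have hbr : 0 < b - r := sub_pos.2 hrb
  have e1 : ∫ q in r..b, ((q - r) ^ (2 - α))⁻¹ • (w r - w q) =
      -∫ q in r..b, ∫ c in r..q, (q - r) ^ (α - 2) • v c := by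
    rw [← intervalIntegral.integral_neg]
    refine integral_congr_Ioo hrb.le fun q hq => ?_
    rw [intervalIntegral.integral_smul, ← h.eq r q le_rfl hq.1.le hq.2.le,
      ← neg_sub 2 α, Real.rpow_neg (sub_pos.2 hq.1).le, ← smul_neg, neg_sub]
  have hint : IntegrableOn (Function.uncurry fun q c : ℝ => (q - r) ^ (α - 2) • v c)
      (openTriangle r b) (volume.prod volume) := by
    refine integrableOn_triangle_of_fst hrb.le (H := fun q _ => (q - r) ^ (α - 2) * C)
      (h := fun q => (q - r) ^ (α - 1) * C) ?_ ?_ ?_ ?_ ?_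
    · exact AEStronglyMeasurable.smul (Measurable.aestronglyMeasurable (by fun_prop))
        (aestronglyMeasurable_openTriangle_snd h.meas)
    · intro q hq c hc
      rw [norm_smul, Real.norm_of_nonneg (Real.rpow_nonneg (sub_pos.2 hq.1).le _)]
      have := Real.rpow_nonneg (sub_pos.2 hq.1).le (α - 2)
      gcongr
      exact h.bound c ⟨hc.1, hc.2.trans hq.2⟩
    · intro q hq
      exact intervalIntegrable_const
    · intro q hq
      have h0 : 0 < q - r := sub_pos.2 hq.1
      rw [intervalIntegral.integral_const, smul_eq_mul, ← mul_assoc, mul_comm (q - r),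
        ← Real.rpow_add_one h0.ne', show α - 2 + 1 = α - 1 by ring]
    · exact (intervalIntegrable_sub_rpow_left hrb.le (by linarith)).mul_const C
  have e2 : ∀ c ∈ Ioo r b, ∫ q in c..b, (q - r) ^ (α - 2) • v c =
      (1 - α)⁻¹ • ((c - r) ^ (α - 1) • v c - (b - r) ^ (α - 1) • v c) := by
    intro c hc
    rw [← sub_smul, smul_smul, intervalIntegral.integral_smul_const,
      integral_sub_rpow_left_of_pos hc.1 hc.2.le (by linarith)]
    congr 1
    rw [show α - 2 + 1 = α - 1 by ring]
    have h1 : (1 : ℝ) - α ≠ 0 := by linarith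
    have h2 : α - 1 ≠ 0 := by linarith
    field_simp
    ring
  have i1 := h.intervalIntegrable_smul hrb.le
    (intervalIntegrable_sub_rpow_left (s := r) (t := b) (x := α - 1) hrb.le (by linarith))
  have i2 := h.intervalIntegrable_smul hrb.le
    (intervalIntegrable_const (μ := volume) (c := (b - r) ^ (α - 1)))
  unfold weylRight
  rw [e1, integral_triangle_swap hrb.le hint, integral_congr_Ioo hrb.le e2]
  rw [intervalIntegral.integral_smul, smul_neg, smul_smul,
    mul_inv_cancel₀ (show (1 : ℝ) - α ≠ 0 by linarith), one_smul,
    intervalIntegral.integral_sub i1 i2, intervalIntegral.integral_smul,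
    ← h.eq r b le_rfl hrb.le le_rfl, ← neg_sub α 1, Real.rpow_neg hbr.le (α - 1), inv_inv]
  module

/-- The constant `Γ(1-α)⁻¹ ∫_0^1 u^{-α} (1-u)^{α-1} du`. -/
def abelConst (α : ℝ) : ℝ := (Real.Gamma (1 - α))⁻¹ * eulerIntegral (-α) (α - 1)

/-- Abel's inversion. After Fubini the inner integral of (x-r)^{α-1} (r-c)^{-α} over (c, x) does not
depend on c, because the exponents add up to -1. So K(a) and the integral of k receive the same
constant and add up to K(x). The constant equals Γ(α), a value that is never needed. -/
theorem HasBoundedDensity.integral_weylLeft {K k : ℝ → E} {α C a x : ℝ}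
    (h : HasBoundedDensity K k C a x) (hα : 0 < α) (hα1 : α < 1) (hax : a < x) :
    ∫ r in a..x, (x - r) ^ (α - 1) • weylLeft α a K r = abelConst α • K x := by
  have e1 : ∀ r ∈ Ioo a x, (x - r) ^ (α - 1) • weylLeft α a K r = (Real.Gamma (1 - α))⁻¹ •
      (((r - a) ^ (-α) * (x - r) ^ (α - 1)) • K a +
        ∫ c in a..r, ((x - r) ^ (α - 1) * (r - c) ^ (-α)) • k c) := by
    intro r hr
    rw [(h.mono le_rfl hr.2.le).weylLeft_eq hα hα1 hr.1]
    simp only [mul_smul]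
    rw [intervalIntegral.integral_smul]
    module
  have hint : IntegrableOn (Function.uncurry fun r c : ℝ =>
      ((x - r) ^ (α - 1) * (r - c) ^ (-α)) • k c)
      (openTriangle a x) (volume.prod volume) := by
    refine integrableOn_triangle_of_fst hax.le
      (H := fun r c => (x - r) ^ (α - 1) * (r - c) ^ (-α) * C)
      (h := fun r => (r - a) ^ (1 - α) * (x - r) ^ (α - 1) * ((1 - α)⁻¹ * C)) ?_ ?_ ?_ ?_ ?_
    · exact AEStronglyMeasurable.smul (Measurable.aestronglyMeasurable (by fun_prop))
        (aestronglyMeasurable_openTriangle_snd h.meas)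
    · intro r hr c hc
      have h1 := Real.rpow_nonneg (sub_pos.2 hr.2).le (α - 1)
      have h2 := Real.rpow_nonneg (sub_pos.2 hc.2).le (-α)
      rw [norm_smul, Real.norm_of_nonneg (by positivity)]
      gcongr
      exact h.bound c ⟨hc.1, hc.2.trans hr.2⟩
    · intro r hr
      exact ((intervalIntegrable_sub_rpow_right hr.1.le (by linarith)).const_mul _).mul_const C
    · intro r hr
      rw [intervalIntegral.integral_mul_const, intervalIntegral.integral_const_mul,
        integral_sub_rpow_right (by linarith), show -α + 1 = 1 - α by ring, div_eq_mul_inv]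
      exact le_of_eq (by ring)
    · exact (intervalIntegrable_rpow_mul_rpow hax.le (by linarith) (by linarith)).mul_const _
  have e2 : ∀ c ∈ Ioo a x, ∫ r in c..x, ((x - r) ^ (α - 1) * (r - c) ^ (-α)) • k c =
      eulerIntegral (-α) (α - 1) • k c := by
    intro c hc
    rw [intervalIntegral.integral_smul_const]
    simp only [mul_comm]
    rw [integral_rpow_mul_rpow hc.2, show -α + (α - 1) + 1 = 0 by ring, Real.rpow_zero, mul_one]
  have i1 := intervalIntegrable_rpow_mul_rpow (s := a) (t := x) (x := -α) (y := α - 1)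
    hax.le (by linarith) (by linarith)
  have i2 : IntervalIntegrable (fun r => ∫ c in a..r,
      ((x - r) ^ (α - 1) * (r - c) ^ (-α)) • k c) volume a x := by
    rw [intervalIntegrable_iff_integrableOn_Ioo_of_le hax.le,
      ← integrable_indicator_iff measurableSet_Ioo]
    rw [← integrable_indicator_iff (measurableSet_openTriangle a x)] at hint
    refine hint.integral_prod_left.congr (ae_of_all _ fun r => ?_)
    simp only [indicator_openTriangle_slice_fst]
    by_cases hr : r ∈ Ioo a x
    · rw [if_pos hr, indicator_of_mem hr, integral_indicator measurableSet_Ioo,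
        intervalIntegral.integral_of_le hr.1.le, integral_Ioc_eq_integral_Ioo]
    · rw [if_neg hr, indicator_of_notMem hr]
      simp
  rw [integral_congr_Ioo hax.le e1, intervalIntegral.integral_smul, intervalIntegral.integral_add
      ⟨i1.1.smul_const (K a), i1.2.smul_const (K a)⟩ i2,
    integral_triangle_swap hax.le hint, integral_congr_Ioo hax.le e2,
    intervalIntegral.integral_smul_const, integral_rpow_mul_rpow hax,
    show -α + (α - 1) + 1 = 0 by ring, Real.rpow_zero, mul_one, intervalIntegral.integral_smul,
    ← h.eq a x le_rfl hax.le le_rfl, abelConst]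
  module

end Density

/-! ### Steklov averages -/

section Steklov

variable {E : Type*} [NormedAddCommGroup E] [NormedSpace ℝ E] [CompleteSpace E]

/-- The Steklov average `h⁻¹ ∫_r^{r+h} f`. -/
def steklov (h : ℝ) (f : ℝ → E) (r : ℝ) : E := h⁻¹ • ∫ s in r..r + h, f s

theorem steklov_eq (h : ℝ) (f : ℝ → E) (r : ℝ) :
    steklov h f r = h⁻¹ • ∫ s in (0 : ℝ)..h, f (r + s) := by
  rw [intervalIntegral.integral_comp_add_left, add_zero, steklov]

theorem norm_steklov_le {h B r : ℝ} {f : ℝ → E} (hh : 0 < h)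
    (hB : ∀ s ∈ Ioo 0 h, ‖f (r + s)‖ ≤ B) : ‖steklov h f r‖ ≤ B := by
  rw [steklov_eq, norm_smul, norm_inv, Real.norm_of_nonneg hh.le]
  have h1 := norm_integral_le_of_Ioo hh.le hB intervalIntegrable_const
  rw [intervalIntegral.integral_const, sub_zero, smul_eq_mul] at h1
  rw [inv_mul_le_iff₀ hh]
  exact h1

theorem intervalIntegrable_comp_const_add {f : ℝ → E} {r h : ℝ}
    (hf : IntervalIntegrable f volume r (r + h)) :
    IntervalIntegrable (fun s => f (r + s)) volume 0 h := by
  simpa using hf.comp_add_left r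

theorem norm_steklov_sub_steklov_le {h B q r : ℝ} {f : ℝ → E} (hh : 0 < h)
    (hr : IntervalIntegrable f volume r (r + h)) (hq : IntervalIntegrable f volume q (q + h))
    (hB : ∀ s ∈ Ioo 0 h, ‖f (r + s) - f (q + s)‖ ≤ B) :
    ‖steklov h f r - steklov h f q‖ ≤ B := by
  have e : steklov h f r - steklov h f q = steklov h (fun s => f (r + s) - f (q + s)) 0 := by
    rw [steklov_eq, steklov_eq, steklov_eq, ← smul_sub, ← intervalIntegral.integral_sub
      (intervalIntegrable_comp_const_add hr) (intervalIntegrable_comp_const_add hq)]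
    simp
  rw [e]
  exact norm_steklov_le hh (by simpa using hB)

theorem norm_steklov_sub_le {h B r : ℝ} {f : ℝ → E} {c : E} (hh : 0 < h)
    (hr : IntervalIntegrable f volume r (r + h))
    (hB : ∀ s ∈ Ioo 0 h, ‖f (r + s) - c‖ ≤ B) :
    ‖steklov h f r - c‖ ≤ B := by
  have e : steklov h f r - c = steklov h (fun s => f (r + s) - c) 0 := by
    rw [steklov_eq, steklov_eq]
    simp only [zero_add]
    rw [intervalIntegral.integral_sub
      (intervalIntegrable_comp_const_add hr) intervalIntegrable_const, smul_sub,
      intervalIntegral.integral_const, sub_zero, smul_smul, inv_mul_cancel₀ hh.ne', one_smul]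
  rw [e]
  exact norm_steklov_le hh (by simpa using hB)

/-- The average has density (f(s+h) - f(s))/h. The integral identity is only additivity of integrals
over [q, r+h] split in two ways. -/
theorem hasBoundedDensity_steklov {h C a b : ℝ} {f : ℝ → E} (hh : 0 < h)
    (hf : ∀ c d, a ≤ c → c ≤ d → d ≤ b + h → IntervalIntegrable f volume c d)
    (hC : ∀ r ∈ Ioo a (b + h), ‖f r‖ ≤ C) :
    HasBoundedDensity (steklov h f) (fun s => h⁻¹ • (f (s + h) - f s)) (h⁻¹ * (C + C)) a b := by
  constructor
  · rcases lt_or_ge b a with hba | hab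
    · simp [Ioo_eq_empty_of_le hba.le]
    · refine AEStronglyMeasurable.const_smul (AEStronglyMeasurable.sub ?_ ?_) _
      · have h1 := (hf (a + h) (b + h) (by linarith) (by linarith) le_rfl).comp_add_right h
        simp only [add_sub_cancel_right] at h1
        rw [intervalIntegrable_iff_integrableOn_Ioo_of_le hab] at h1
        exact h1.aestronglyMeasurable
      · have h1 := hf a b le_rfl hab (by linarith)
        rw [intervalIntegrable_iff_integrableOn_Ioo_of_le hab] at h1
        exact h1.aestronglyMeasurable
  · intro r hr
    rw [norm_smul, norm_inv, Real.norm_of_nonneg hh.le]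
    gcongr
    refine (norm_sub_le _ _).trans (add_le_add (hC _ ⟨?_, ?_⟩) (hC _ ⟨hr.1, ?_⟩)) <;>
    linarith [hr.1, hr.2]
  · intro q r h1 h2 h3
    have i1 := hf q (q + h) h1 (by linarith) (by linarith)
    have i2 := hf q r h1 h2 (by linarith)
    have i3 := hf r (r + h) (by linarith) (by linarith) (by linarith)
    have i4 := hf (q + h) (r + h) (by linarith) (by linarith) (by linarith)
    have i5 : IntervalIntegrable (fun s => f (s + h)) volume q r := by
      simpa using i4.comp_add_right h
    rw [intervalIntegral.integral_smul, intervalIntegral.integral_sub i5 i2,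
      intervalIntegral.integral_comp_add_right, steklov, steklov, ← smul_sub]
    congr 1
    have e1 := intervalIntegral.integral_add_adjacent_intervals i1 i4
    have e2 := intervalIntegral.integral_add_adjacent_intervals i2 i3
    rw [sub_eq_sub_iff_add_eq_add, add_comm _ (∫ s in q..r, f s), e2, ← e1, add_comm]

end Steklov

/-! ### Inversion of the Weyl derivative -/

section Inversion

variable {E : Type*} [NormedAddCommGroup E] [NormedSpace ℝ E] [CompleteSpace E]

/-- A bound and a Hölder condition on `(a, ∞)` with a singularity at the left end. -/
structure LeftKernelBound (θ β M a : ℝ) (f : ℝ → E) : Prop where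
  norm_le : ∀ r, a < r → ‖f r‖ ≤ M
  sub_le : ∀ q r, a < q → q < r → ‖f r - f q‖ ≤ M * ((r - q) ^ θ + (r - q) ^ β * (q - a) ^ (-β))

variable {θ β M a : ℝ} {f : ℝ → E}

theorem LeftKernelBound.nonneg (h : LeftKernelBound θ β M a f) : 0 ≤ M :=
  (norm_nonneg _).trans (h.norm_le (a + 1) (by linarith))

/-- An artificial singularity at t is harmless: max(1, (t-a)^θ) (t-r)^{-θ} ≥ 1. This makes the Weyl
estimates for two-sided kernels available. -/
theorem LeftKernelBound.kernelBound (h : LeftKernelBound θ β M a f) (hθ : 0 ≤ θ) (t : ℝ) :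
    KernelBound θ β (fun _ => M * max 1 ((t - a) ^ θ)) a t f := by
  have hM := h.nonneg
  constructor
  · intro r h1 h2
    calc ‖f r‖ ≤ M * 1 := by simpa using h.norm_le r h1
      _ ≤ _ := by gcongr; exact le_max_left _ _
  · intro q r h1 h2 h3
    have hrq : 0 < r - q := by linarith
    have htr : 0 < t - r := by linarith
    have p1 := Real.rpow_pos_of_pos hrq θ
    have p2 := Real.rpow_pos_of_pos hrq β
    have p3 := Real.rpow_pos_of_pos htr (-θ)
    have p4 := Real.rpow_pos_of_pos (show 0 < q - a by linarith) (-β)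
    have p5 := Real.rpow_pos_of_pos htr θ
    have key : 1 ≤ max 1 ((t - a) ^ θ) * (t - r) ^ (-θ) := by
      rw [Real.rpow_neg htr.le, ← div_eq_mul_inv, one_le_div p5]
      refine le_max_of_le_right ?_
      gcongr
      linarith
    calc _ ≤ M * ((r - q) ^ θ * 1 + 1 * ((r - q) ^ β * (q - a) ^ (-β))) := by
          simpa using h.sub_le q r h1 h2
      _ ≤ M * ((r - q) ^ θ * (max 1 ((t - a) ^ θ) * (t - r) ^ (-θ)) +
          max 1 ((t - a) ^ θ) * ((r - q) ^ β * (q - a) ^ (-β))) := by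
          gcongr
          exact le_max_left _ _
      _ = _ := by ring

theorem LeftKernelBound.continuousOn (h : LeftKernelBound θ β M a f) (hθ : 0 < θ) (hβ : 0 < β) :
    ContinuousOn f (Ioi a) := by
  intro r hr
  have h1 := (h.kernelBound hθ.le (r + 1)).continuousOn continuousOn_const hθ hβ
  exact (h1.continuousAt (Ioo_mem_nhds hr (by linarith))).continuousWithinAt

theorem LeftKernelBound.intervalIntegrable (h : LeftKernelBound θ β M a f) (hθ : 0 < θ)
    (hβ : 0 < β) {c d : ℝ} (hc : a ≤ c) (hcd : c ≤ d) : IntervalIntegrable f volume c d := by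
  refine intervalIntegrable_of_Ioo hcd (g := fun _ => M) ?_
    (fun r hr => h.norm_le r (hc.trans_lt hr.1)) intervalIntegrable_const
  exact ((h.continuousOn hθ hβ).mono fun r hr => hc.trans_lt hr.1).aestronglyMeasurable
    measurableSet_Ioo

/-- Forward averaging moves points away from the singularity at a, so the bounds survive with the
same constant, uniformly in the averaging length. -/
theorem LeftKernelBound.steklov (h : LeftKernelBound θ β M a f) (hθ : 0 < θ) (hβ : 0 < β)
    {η : ℝ} (hη : 0 < η) : LeftKernelBound θ β M a (steklov η f) := by
  have hM := h.nonneg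
  constructor
  · intro r hr
    exact norm_steklov_le hη fun s hs => h.norm_le _ (by linarith [hs.1])
  · intro q r h1 h2
    refine norm_steklov_sub_steklov_le hη
      (h.intervalIntegrable hθ hβ (by linarith) (by linarith))
      (h.intervalIntegrable hθ hβ (by linarith) (by linarith)) fun s hs => ?_
    have hqa : 0 < q - a := by linarith
    have h3 := h.sub_le (q + s) (r + s) (by linarith [hs.1]) (by linarith)
    rw [add_sub_add_right_eq_sub] at h3
    refine h3.trans ?_
    have p2 := Real.rpow_nonneg (show 0 ≤ r - q by linarith) β
    have p4 : (q + s - a) ^ (-β) ≤ (q - a) ^ (-β) :=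
      Real.rpow_le_rpow_of_nonpos hqa (by linarith [hs.1]) (by linarith)
    gcongr

theorem LeftKernelBound.tendsto_steklov (h : LeftKernelBound θ β M a f) (hθ : 0 < θ) (hβ : 0 < β)
    {r : ℝ} (hr : a < r) {η : ℕ → ℝ} (hη : ∀ n, 0 < η n) (hη0 : Tendsto η atTop (𝓝 0)) :
    Tendsto (fun n => FBMEvolution.steklov (η n) f r) atTop (𝓝 (f r)) := by
  have hM := h.nonneg
  have hra : 0 < r - a := by linarith
  rw [tendsto_iff_norm_sub_tendsto_zero]
  have hlim : Tendsto (fun n => M * ((η n) ^ θ + (η n) ^ β * (r - a) ^ (-β))) atTop (𝓝 0) := by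
    have h1 := hη0.rpow_const (p := θ) (Or.inr hθ.le)
    have h2 := hη0.rpow_const (p := β) (Or.inr hβ.le)
    rw [Real.zero_rpow hθ.ne'] at h1
    rw [Real.zero_rpow hβ.ne'] at h2
    simpa using (h1.add (h2.mul_const ((r - a) ^ (-β)))).const_mul M
  refine squeeze_zero (fun _ => norm_nonneg _) (fun n => ?_) hlim
  refine norm_steklov_sub_le (hη n)
    (h.intervalIntegrable hθ hβ hr.le (by linarith [hη n])) fun s hs => ?_
  refine (h.sub_le r (r + s) hr (by linarith [hs.1])).trans ?_
  have p4 := Real.rpow_nonneg hra.le (-β)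
  rw [add_sub_cancel_left]
  have := hs.1.le
  have := hs.2.le
  gcongr

/-- Abel's inversion holds for Steklov averages, which have bounded densities. The uniform kernel
bounds allow dominated convergence twice, inside the Weyl derivative and in the outer integral. -/
theorem LeftKernelBound.integral_weylLeft (h : LeftKernelBound θ β M a f) {α x : ℝ} (hα : 0 < α)
    (hθ : α < θ) (hβ : α < β) (hβ1 : β < 1) (hax : a < x) :
    ∫ r in a..x, (x - r) ^ (α - 1) • weylLeft α a f r = abelConst α • f x := by
  have hθ0 : 0 < θ := by linarith
  have hβ0 : 0 < β := by linarith
  set η : ℕ → ℝ := fun n => 1 / ((n : ℝ) + 1) with hη_def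
  have hη : ∀ n, 0 < η n := fun n => Nat.one_div_pos_of_nat
  have hη0 : Tendsto η atTop (𝓝 0) := tendsto_one_div_add_atTop_nhds_zero_nat
  -- One unit beyond x, so that (t-r)^{-θ} ≤ 1 on (a, x) and the artificial singularity plays no
  -- role.
  set t := x + 1 with ht
  set m := M * max 1 ((t - a) ^ θ) with hm
  have hb : ∀ n, KernelBound θ β (fun _ => m) a t (FBMEvolution.steklov (η n) f) := fun n =>
    (h.steklov hθ0 hβ0 (hη n)).kernelBound hθ0.le t
  have hb0 : KernelBound θ β (fun _ => m) a t f := h.kernelBound hθ0.le t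
  have hmeas : ∀ n, AEStronglyMeasurable (FBMEvolution.steklov (η n) f)
      (volume.restrict (Ioo a t)) := fun n =>
    ((hb n).continuousOn continuousOn_const hθ0 hβ0).aestronglyMeasurable measurableSet_Ioo
  have hpt : ∀ r, a < r → r < t → Tendsto (fun n => weylLeft α a (FBMEvolution.steklov (η n) f) r)
      atTop (𝓝 (weylLeft α a f r)) := by
    intro r har hrt
    unfold weylLeft
    refine Tendsto.const_smul (Tendsto.add
      ((h.tendsto_steklov hθ0 hβ0 har hη hη0).const_smul _) (Tendsto.const_smul ?_ _)) _
    refine tendsto_integral_of_Ioo har.le (fun n =>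
      KernelBound.aestronglyMeasurable_increment (hmeas n) α hrt)
      (fun n q hq => (hb n).norm_increment_le α hq.1 hq.2 hrt)
      (intervalIntegrable_incrementBound _ _ har.le hθ hβ hβ1) fun q hq => ?_
    exact ((h.tendsto_steklov hθ0 hβ0 har hη hη0).sub
      (h.tendsto_steklov hθ0 hβ0 hq.1 hη hη0)).const_smul _
  have hlim : Tendsto (fun n => ∫ r in a..x, (x - r) ^ (α - 1) •
      weylLeft α a (FBMEvolution.steklov (η n) f) r) atTop
      (𝓝 (∫ r in a..x, (x - r) ^ (α - 1) • weylLeft α a f r)) := by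
    have hL := weylLeftConst_nonneg (β := β) hα (by linarith) hθ
    have hm0 : 0 ≤ m := hb0.nonneg (r := x) hax (by linarith)
    refine tendsto_integral_of_Ioo hax.le (g := fun r => weylLeftConst α θ β * m *
      ((r - a) ^ (-α) * (x - r) ^ (α - 1) + (r - a) ^ (θ - α) * (x - r) ^ (α - 1))) ?_ ?_ ?_ ?_
    · intro n
      exact AEStronglyMeasurable.smul (Measurable.aestronglyMeasurable (by fun_prop))
        (aestronglyMeasurable_weylLeft ((hmeas n).mono_set
          (Ioo_subset_Ioo_right (by linarith))))
    · intro n r hr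
      have hxr : 0 < x - r := sub_pos.2 hr.2
      have hra : 0 < r - a := sub_pos.2 hr.1
      have h1 := (hb n).norm_weylLeft_le hα hθ hβ hβ1 hr.1 (by linarith [hr.2])
      have h2 : (t - r) ^ (-θ) ≤ 1 :=
        Real.rpow_le_one_of_one_le_of_nonpos (by linarith) (by linarith)
      have p1 := Real.rpow_nonneg hra.le (-α)
      have p2 := Real.rpow_nonneg hra.le (θ - α)
      have p3 := Real.rpow_nonneg hxr.le (α - 1)
      rw [norm_smul, Real.norm_of_nonneg p3]
      calc _ ≤ (x - r) ^ (α - 1) * (weylLeftConst α θ β *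
            (m * ((r - a) ^ (-α) + (r - a) ^ (θ - α) * 1))) := by
            gcongr
            exact h1.trans (by gcongr)
        _ = _ := by ring
    · exact ((intervalIntegrable_rpow_mul_rpow hax.le (by linarith) (by linarith)).add
        (intervalIntegrable_rpow_mul_rpow hax.le (by linarith) (by linarith))).const_mul _
    · intro r hr
      exact (hpt r hr.1 (by linarith [hr.2])).const_smul _
  refine tendsto_nhds_unique hlim ?_
  have heq : ∀ n, ∫ r in a..x, (x - r) ^ (α - 1) • weylLeft α a (FBMEvolution.steklov (η n) f) r =
      abelConst α • FBMEvolution.steklov (η n) f x := fun n =>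
    (hasBoundedDensity_steklov (hη n)
      (fun c d h1 h2 _ => h.intervalIntegrable hθ0 hβ0 h1 h2)
      (fun r hr => h.norm_le r hr.1)).integral_weylLeft hα (by linarith) hax
  simp only [heq]
  exact (h.tendsto_steklov hθ0 hβ0 hax hη hη0).const_smul _

/-- Forward averages near x look beyond x, possibly beyond t. Freezing the kernel after x removes
the singularity at t without changing the Weyl derivative on (a, x). -/
theorem KernelBound.leftKernelBound_min {θ β m a t x : ℝ} {K : ℝ → E}
    (h : KernelBound θ β (fun _ => m) a t K) (hθ : 0 < θ) (hβ : 0 < β) (hax : a < x)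
    (hxt : x < t) :
    LeftKernelBound θ β (m * max 1 ((t - x) ^ (-θ))) a (fun s => K (min s x)) := by
  have hm : 0 ≤ m := h.nonneg hax hxt
  have htx : 0 < t - x := sub_pos.2 hxt
  constructor
  · intro r hr
    calc ‖K (min r x)‖ ≤ m * 1 := by
          simpa using h.norm_le (min r x) (lt_min hr hax) (min_lt_of_right_lt hxt)
      _ ≤ _ := by gcongr; exact le_max_left _ _
  · intro q r h1 h2
    have hrq : 0 < r - q := by linarith
    have hqa : 0 < q - a := by linarith
    have p1 := Real.rpow_nonneg hrq.le θ
    have p2 := Real.rpow_nonneg hrq.le β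
    have p4 := Real.rpow_nonneg hqa.le (-β)
    have hmax : 0 ≤ max 1 ((t - x) ^ (-θ)) := le_max_of_le_left zero_le_one
    rcases le_or_gt x q with hxq | hqx
    · rw [min_eq_right hxq, min_eq_right (hxq.trans h2.le)]
      simp only [sub_self, norm_zero]
      positivity
    · rw [min_eq_left hqx.le]
      set r' := min r x with hr'
      have h3 : q < r' := lt_min h2 hqx
      have h4 : r' ≤ x := min_le_right _ _
      have h5 : r' - q ≤ r - q := by linarith [min_le_left r x]
      have h6 : (t - r') ^ (-θ) ≤ (t - x) ^ (-θ) :=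
        Real.rpow_le_rpow_of_nonpos htx (by linarith) (by linarith)
      have h7 : 0 ≤ r' - q := by linarith
      have p5 := Real.rpow_nonneg h7 θ
      have p6 := Real.rpow_nonneg (show 0 ≤ t - r' by linarith) (-θ)
      calc _ ≤ m * ((r' - q) ^ θ * (t - r') ^ (-θ) + 1 * ((r' - q) ^ β * (q - a) ^ (-β))) := by
            simpa using h.sub_le q r' h1 h3 (by linarith)
        _ ≤ m * ((r - q) ^ θ * max 1 ((t - x) ^ (-θ)) +
            max 1 ((t - x) ^ (-θ)) * ((r - q) ^ β * (q - a) ^ (-β))) := by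
            gcongr
            · exact h6.trans (le_max_right _ _)
            · exact le_max_left _ _
        _ = _ := by ring

theorem KernelBound.integral_weylLeft {θ β m a t x α : ℝ} {K : ℝ → E}
    (h : KernelBound θ β (fun _ => m) a t K) (hα : 0 < α)
    (hθ : α < θ) (hβ : α < β) (hβ1 : β < 1) (hax : a < x) (hxt : x < t) :
    ∫ r in a..x, (x - r) ^ (α - 1) • weylLeft α a K r = abelConst α • K x := by
  have h1 := (h.leftKernelBound_min (by linarith) (by linarith) hax hxt).integral_weylLeft
    hα hθ hβ hβ1 hax
  rw [min_self] at h1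
  rw [← h1]
  refine integral_congr_Ioo hax.le fun r hr => ?_
  congr 1
  refine weylLeft_congr hr.1.le (by rw [min_eq_left hr.2.le]) ?_
  filter_upwards [ae_restrict_mem measurableSet_Ioo] with q hq
  rw [min_eq_left (hq.2.trans hr.2).le]

end Inversion

/-! ### Additivity of the pathwise integral -/

section Additivity

variable {V : Type*} [NormedAddCommGroup V] [InnerProductSpace ℝ V] [CompleteSpace V]
  {e : HilbertBasis ℕ ℝ V}

theorem KernelBound.intervalIntegrable_weylLeft_smul {θ β m a t q α : ℝ} {K : ℝ → HS e}
    (h : KernelBound θ β (fun _ => m) a t K) (hα : 0 < α)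
    (hθ : α < θ) (hβ : α < β) (hβ1 : β < 1) (haq : a < q) (hqt : q < t) :
    IntervalIntegrable (fun r => (q - r) ^ (α - 1) • weylLeft α a K r) volume a q := by
  have hK : AEStronglyMeasurable K (volume.restrict (Ioo a q)) :=
    ((h.continuousOn continuousOn_const (by linarith) (by linarith)).mono
      (Ioo_subset_Ioo_right hqt.le)).aestronglyMeasurable measurableSet_Ioo
  have hm : 0 ≤ m := h.nonneg haq hqt
  have hL := weylLeftConst_nonneg (β := β) hα (by linarith) hθ
  refine intervalIntegrable_of_Ioo haq.le (g := fun r => weylLeftConst α θ β * m *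
      ((r - a) ^ (-α) * (q - r) ^ (α - 1) +
        (t - q) ^ (-θ) * ((r - a) ^ (θ - α) * (q - r) ^ (α - 1)))) ?_ ?_ ?_
  · have hs : AEStronglyMeasurable (fun r : ℝ => (q - r) ^ (α - 1))
        (volume.restrict (Ioo a q)) := Measurable.aestronglyMeasurable (by fun_prop)
    exact hs.smul (aestronglyMeasurable_weylLeft hK)
  · intro r hr
    have hxr : 0 < q - r := sub_pos.2 hr.2
    have hra : 0 < r - a := sub_pos.2 hr.1
    have h1 := h.norm_weylLeft_le hα hθ hβ hβ1 hr.1 (hr.2.trans hqt)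
    have h2 : (t - r) ^ (-θ) ≤ (t - q) ^ (-θ) :=
      Real.rpow_le_rpow_of_nonpos (by linarith) (by linarith [hr.2]) (by linarith)
    have p1 := Real.rpow_nonneg hra.le (-α)
    have p2 := Real.rpow_nonneg hra.le (θ - α)
    have p3 := Real.rpow_nonneg hxr.le (α - 1)
    rw [norm_smul, Real.norm_of_nonneg p3]
    calc _ ≤ (q - r) ^ (α - 1) * (weylLeftConst α θ β *
          (m * ((r - a) ^ (-α) + (r - a) ^ (θ - α) * (t - q) ^ (-θ)))) := by
          gcongr
          exact h1.trans (by gcongr)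
      _ = _ := by ring
  · exact ((intervalIntegrable_rpow_mul_rpow haq.le (by linarith) (by linarith)).add
      ((intervalIntegrable_rpow_mul_rpow haq.le (by linarith) (by linarith)).const_mul _)).const_mul
        _

/-- The right-sided derivative is a fractional integral of v. After Fubini, the inner integral over
r is the one inverted by Abel's formula and returns K(q). The condition θ < 1 makes (t-r)^{α-θ}
integrable in the majorant. The constant does not depend on the interval, which is all that
additivity requires. -/
theorem KernelBound.fracIntegral_eq {θ β m a t α C : ℝ} {K : ℝ → HS e} {w v : ℝ → V}
    (h : KernelBound θ β (fun _ => m) a t K) (hw : HasBoundedDensity w v C a t) (hα : 0 < α)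
    (hθ : α < θ) (hθ1 : θ < 1) (hβ : α < β) (hβ1 : β < 1) (hat : a < t) :
    fracIntegral α K w a t =
      ((Real.Gamma α)⁻¹ * abelConst α) • ∫ q in a..t, HS.toCLM (K q) (v q) := by
  have hα1 : α < 1 := by linarith
  have hKm : AEStronglyMeasurable K (volume.restrict (Ioo a t)) :=
    (h.continuousOn continuousOn_const (by linarith) (by linarith)).aestronglyMeasurable
      measurableSet_Ioo
  have hD := aestronglyMeasurable_weylLeft (α := α) hKm
  have hm : 0 ≤ m := h.nonneg (r := (a + t) / 2) (by linarith) (by linarith)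
  have hL := weylLeftConst_nonneg (β := β) hα (by linarith) hθ
  have hC : 0 ≤ C := (norm_nonneg _).trans (hw.bound ((a + t) / 2) ⟨by linarith, by linarith⟩)
  have hint : IntegrableOn (Function.uncurry fun q r : ℝ =>
      (q - r) ^ (α - 1) • HS.evalL e (weylLeft α a K r) (v q))
      (openTriangle a t) (volume.prod volume) := by
    refine integrableOn_triangle_of_snd hat.le
      (H := fun q r => (q - r) ^ (α - 1) * (‖weylLeft α a K r‖ * C))
      (h := fun r => weylLeftConst α θ β * m * C * α⁻¹ *
        ((r - a) ^ (-α) * (t - r) ^ α + (r - a) ^ (θ - α) * (t - r) ^ (α - θ))) ?_ ?_ ?_ ?_ ?_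
    · have hs : AEStronglyMeasurable (fun p : ℝ × ℝ => (p.1 - p.2) ^ (α - 1))
          ((volume.prod volume).restrict (openTriangle a t)) :=
        Measurable.aestronglyMeasurable (by fun_prop)
      exact hs.smul ((HS.evalL e).aestronglyMeasurable_comp₂
        (aestronglyMeasurable_openTriangle_snd hD) (aestronglyMeasurable_openTriangle_fst hw.meas))
    · intro r hr q hq
      have p := Real.rpow_nonneg (sub_pos.2 hq.1).le (α - 1)
      rw [norm_smul, Real.norm_of_nonneg p]
      gcongr
      refine (HS.norm_toCLM_apply_le _ _).trans ?_
      gcongr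
      exact hw.bound q ⟨hr.1.trans hq.1, hq.2⟩
    · intro r hr
      exact (intervalIntegrable_sub_rpow_left hr.2.le (by linarith)).mul_const _
    · intro r hr
      have htr : 0 < t - r := sub_pos.2 hr.2
      have hra : 0 < r - a := sub_pos.2 hr.1
      have h1 := h.norm_weylLeft_le hα hθ hβ hβ1 hr.1 hr.2
      have p := Real.rpow_nonneg htr.le α
      rw [intervalIntegral.integral_mul_const, integral_sub_rpow_left (by linarith),
        sub_add_cancel]
      calc _ ≤ (t - r) ^ α / α * (weylLeftConst α θ β *
            (m * ((r - a) ^ (-α) + (r - a) ^ (θ - α) * (t - r) ^ (-θ))) * C) := by gcongr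
        _ = _ := by
          rw [sub_eq_add_neg α θ, Real.rpow_add htr]
          ring
    · exact ((intervalIntegrable_rpow_mul_rpow hat.le (by linarith) (by linarith)).add
        (intervalIntegrable_rpow_mul_rpow hat.le (by linarith) (by linarith))).const_mul _
  have e1 : ∀ r ∈ Ioo a t, HS.toCLM (weylLeft α a K r) (weylRight α t w r) =
      -(Real.Gamma α)⁻¹ • ∫ q in r..t,
        (q - r) ^ (α - 1) • HS.evalL e (weylLeft α a K r) (v q) := by
    intro r hr
    have i1 := (hw.mono hr.1.le le_rfl).intervalIntegrable_smul hr.2.le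
      (intervalIntegrable_sub_rpow_left (x := α - 1) hr.2.le (by linarith))
    rw [(hw.mono hr.1.le le_rfl).weylRight_eq hα hα1 hr.2, map_smul,
      ← ContinuousLinearMap.intervalIntegral_comp_comm _ i1]
    simp
  have e2 : ∀ q ∈ Ioo a t, ∫ r in a..q,
      (q - r) ^ (α - 1) • HS.evalL e (weylLeft α a K r) (v q) =
      abelConst α • HS.toCLM (K q) (v q) := by
    intro q hq
    have h2 := ((HS.evalL e).flip (v q)).intervalIntegral_comp_comm
      (h.intervalIntegrable_weylLeft_smul hα hθ hβ hβ1 hq.1 hq.2)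
    rw [h.integral_weylLeft hα hθ hβ hβ1 hq.1 hq.2] at h2
    simpa using h2
  unfold fracIntegral
  rw [integral_congr_Ioo hat.le e1, intervalIntegral.integral_smul,
    ← integral_triangle_swap hat.le hint, integral_congr_Ioo hat.le e2,
    intervalIntegral.integral_smul]
  module

theorem HolderBound.steklov {γ C a b η : ℝ} {w : ℝ → V} (h : HolderBound γ C a (b + η) w)
    (hw : Continuous w) (hη : 0 < η) : HolderBound γ C a b (steklov η w) := by
  intro s t h1 h2 h3
  refine norm_steklov_sub_steklov_le hη (hw.intervalIntegrable _ _) (hw.intervalIntegrable _ _)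
    fun x hx => ?_
  have := h (s + x) (t + x) (by linarith [hx.1]) (by linarith) (by linarith [hx.2])
  rwa [add_sub_add_right_eq_sub] at this

theorem HolderBound.tendsto_steklov {γ C a b : ℝ} {w : ℝ → V} (h : HolderBound γ C a (b + 1) w)
    (hC : 0 ≤ C)
    (hγ : 0 < γ) (hw : Continuous w) {r : ℝ} (h1 : a ≤ r) (h2 : r ≤ b)
    {η : ℕ → ℝ} (hη : ∀ n, 0 < η n) (hη1 : ∀ n, η n ≤ 1) (hη0 : Tendsto η atTop (𝓝 0)) :
    Tendsto (fun n => FBMEvolution.steklov (η n) w r) atTop (𝓝 (w r)) := by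
  rw [tendsto_iff_norm_sub_tendsto_zero]
  have hlim : Tendsto (fun n => C * (η n) ^ γ) atTop (𝓝 0) := by
    have h1 := hη0.rpow_const (p := γ) (Or.inr hγ.le)
    rw [Real.zero_rpow hγ.ne'] at h1
    simpa using h1.const_mul C
  refine squeeze_zero (fun _ => norm_nonneg _) (fun n => ?_) hlim
  refine norm_steklov_sub_le (hη n) (hw.intervalIntegrable _ _) fun s hs => ?_
  have h3 := h r (r + s) h1 (by linarith [hs.1]) (by linarith [hs.2, hη1 n])
  rw [add_sub_cancel_left] at h3
  refine h3.trans ?_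
  have := hs.1.le
  have := hs.2.le
  gcongr

theorem continuous_steklov {η : ℝ} {w : ℝ → V} (hw : Continuous w) :
    Continuous (steklov η w) := by
  unfold steklov
  have e : (fun r => ∫ s in r..r + η, w s) = fun r => (∫ s in (0 : ℝ)..r + η, w s) -
      ∫ s in (0 : ℝ)..r, w s := by
    ext r
    rw [intervalIntegral.integral_interval_sub_left (hw.intervalIntegrable _ _)
      (hw.intervalIntegrable _ _)]
  have h1 : Continuous fun r => ∫ s in (0 : ℝ)..r, w s :=
    intervalIntegral.continuous_primitive (fun _ _ => hw.intervalIntegrable _ _) 0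
  change Continuous fun r => η⁻¹ • ∫ s in r..r + η, w s
  have h2 : Continuous fun r => ∫ s in r..r + η, w s := by
    rw [e]
    exact (h1.comp (by fun_prop)).sub h1
  exact h2.const_smul _

/-- Averages of the integrator inherit its Hölder constant, so their right-sided derivatives
converge pointwise under a common majorant. Averaging lengths up to one explain the interval [a,
t+1]. -/
theorem KernelBound.tendsto_fracIntegral_steklov {θ β m a t α γ C : ℝ} {K : ℝ → HS e} {w : ℝ → V}
    (h : KernelBound θ β (fun _ => m) a t K) (hw : HolderBound γ C a (t + 1) w)
    (hwc : Continuous w) (hα : 0 < α) (hθ : α < θ) (hθ1 : θ < 1) (hβ : α < β) (hβ1 : β < 1)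
    (hγ : 1 < α + γ) (hat : a < t) {η : ℕ → ℝ} (hη : ∀ n, 0 < η n) (hη1 : ∀ n, η n ≤ 1)
    (hη0 : Tendsto η atTop (𝓝 0)) :
    Tendsto (fun n => fracIntegral α K (steklov (η n) w) a t) atTop
      (𝓝 (fracIntegral α K w a t)) := by
  have hα1 : α < 1 := by linarith
  have hγ0 : 0 < γ := by linarith
  have hC : 0 ≤ C := hw.nonneg (by linarith)
  have hKm : AEStronglyMeasurable K (volume.restrict (Ioo a t)) :=
    (h.continuousOn continuousOn_const (by linarith) (by linarith)).aestronglyMeasurable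
      measurableSet_Ioo
  have hD := aestronglyMeasurable_weylLeft (α := α) hKm
  have hm : 0 ≤ m := h.nonneg (r := (a + t) / 2) (by linarith) (by linarith)
  have hL := weylLeftConst_nonneg (β := β) hα (by linarith) hθ
  have hR := weylRightConst_nonneg hα hα1 hγ
  have hb : ∀ n, HolderBound γ C a t (steklov (η n) w) := fun n =>
    (hw.mono le_rfl (by linarith [hη1 n])).steklov hwc (hη n)
  have hpt : ∀ r, a ≤ r → r < t → Tendsto (fun n => weylRight α t (steklov (η n) w) r)
      atTop (𝓝 (weylRight α t w r)) := by
    intro r har hrt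
    unfold weylRight
    have hr := hw.tendsto_steklov hC hγ0 hwc har hrt.le hη hη1 hη0
    refine Tendsto.const_smul (Tendsto.add
      ((hr.sub (hw.tendsto_steklov hC hγ0 hwc hat.le le_rfl hη hη1 hη0)).const_smul _)
      (Tendsto.const_smul ?_ _)) _
    refine tendsto_integral_of_Ioo hrt.le (fun n => ?_)
      (fun n q hq => (hb n).norm_increment_le har hq.1 hq.2.le)
      ((intervalIntegrable_sub_rpow_left hrt.le (by linarith)).const_mul C) fun q hq => ?_
    · refine AEStronglyMeasurable.smul (Measurable.aestronglyMeasurable (by fun_prop)) ?_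
      exact aestronglyMeasurable_const.sub
        (continuous_steklov hwc).stronglyMeasurable.aestronglyMeasurable
    · exact (hr.sub (hw.tendsto_steklov hC hγ0 hwc (har.trans hq.1.le) hq.2.le
        hη hη1 hη0)).const_smul _
  unfold fracIntegral
  refine Tendsto.neg ?_
  refine tendsto_integral_of_Ioo hat.le (g := fun r => weylLeftConst α θ β * m *
    (weylRightConst α γ * C) * ((r - a) ^ (-α) * (t - r) ^ (α + γ - 1) +
      (r - a) ^ (θ - α) * (t - r) ^ (α + γ - 1 - θ))) ?_ ?_ ?_ ?_
  · intro n
    exact (HS.evalL e).aestronglyMeasurable_comp₂ hD (stronglyMeasurable_weylRight_const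
      (continuous_steklov hwc).stronglyMeasurable).aestronglyMeasurable
  · intro n r hr
    have htr : 0 < t - r := sub_pos.2 hr.2
    have hra : 0 < r - a := sub_pos.2 hr.1
    have h1 := h.norm_weylLeft_le hα hθ hβ hβ1 hr.1 hr.2
    have h2 := (hb n).norm_weylRight_le hα hα1 hγ hr.1.le hr.2
    have p1 := Real.rpow_nonneg hra.le (-α)
    have p2 := Real.rpow_nonneg hra.le (θ - α)
    have p3 := Real.rpow_nonneg htr.le (-θ)
    refine (HS.norm_toCLM_apply_le _ _).trans ?_
    calc _ ≤ (weylLeftConst α θ β * (m * ((r - a) ^ (-α) + (r - a) ^ (θ - α) * (t - r) ^ (-θ)))) *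
          (weylRightConst α γ * (C * (t - r) ^ (α + γ - 1))) := by gcongr
      _ = _ := by
        rw [sub_eq_add_neg _ θ, Real.rpow_add htr]
        ring
  · exact ((intervalIntegrable_rpow_mul_rpow hat.le (by linarith) (by linarith)).add
      (intervalIntegrable_rpow_mul_rpow hat.le (by linarith) (by linarith))).const_mul _
  · intro r hr
    exact ((HS.toCLM (weylLeft α a K r)).continuous.tendsto _).comp (hpt r hr.1.le hr.2)

theorem KernelBound.mono_right {θ β m a t s : ℝ} {K : ℝ → HS e}
    (h : KernelBound θ β (fun _ => m) a t K) (hθ : 0 ≤ θ) (hst : s ≤ t) :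
    KernelBound θ β (fun _ => m) a s K where
  norm_le r h1 h2 := h.norm_le r h1 (h2.trans_le hst)
  sub_le q r h1 h2 h3 := by
    refine (h.sub_le q r h1 h2 (h3.trans_le hst)).trans ?_
    have hm := h.nonneg (h1.trans h2) (h3.trans_le hst)
    have p1 := Real.rpow_nonneg (sub_pos.2 h2).le θ
    have p2 : (t - r) ^ (-θ) ≤ (s - r) ^ (-θ) :=
      Real.rpow_le_rpow_of_nonpos (sub_pos.2 h3) (by linarith) (by linarith)
    gcongr

theorem KernelBound.mono_left {θ β m a t s : ℝ} {K : ℝ → HS e}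
    (h : KernelBound θ β (fun _ => m) a t K) (hβ : 0 ≤ β) (has : a ≤ s) :
    KernelBound θ β (fun _ => m) s t K where
  norm_le r h1 h2 := h.norm_le r (has.trans_lt h1) h2
  sub_le q r h1 h2 h3 := by
    refine (h.sub_le q r (has.trans_lt h1) h2 h3).trans ?_
    have hm := h.nonneg (has.trans_lt (h1.trans h2)) h3
    have p1 := Real.rpow_nonneg (sub_pos.2 h2).le β
    have p2 : (q - a) ^ (-β) ≤ (q - s) ^ (-β) :=
      Real.rpow_le_rpow_of_nonpos (sub_pos.2 h1) (by linarith) (by linarith)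
    gcongr

theorem KernelBound.intervalIntegrable_eval {θ β m a t C : ℝ} {K : ℝ → HS e} {w v : ℝ → V}
    (h : KernelBound θ β (fun _ => m) a t K) (hθ : 0 < θ) (hβ : 0 < β)
    (hw : HasBoundedDensity w v C a t) (hat : a < t) :
    IntervalIntegrable (fun q => HS.toCLM (K q) (v q)) volume a t := by
  have hKm : AEStronglyMeasurable K (volume.restrict (Ioo a t)) :=
    (h.continuousOn continuousOn_const hθ hβ).aestronglyMeasurable measurableSet_Ioo
  refine intervalIntegrable_of_Ioo hat.le ((HS.evalL e).aestronglyMeasurable_comp₂ hKm hw.meas)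
    (g := fun _ => m * C) (fun r hr => ?_) intervalIntegrable_const
  refine (HS.norm_toCLM_apply_le _ _).trans ?_
  have := h.nonneg hr.1 hr.2
  gcongr
  · exact h.norm_le r hr.1 hr.2
  · exact hw.bound r hr

/-- For the averaged integrators all three integrals are the same multiple of an ordinary integral
of K against the density, so additivity is evident; then let the averaging length tend to zero.
Cutting the interval only strengthens the singularities allowed in the kernel bound. -/
theorem KernelBound.fracIntegral_add {θ β m a s t α γ C : ℝ} {K : ℝ → HS e} {w : ℝ → V}
    (h : KernelBound θ β (fun _ => m) a t K) (hw : HolderBound γ C a (t + 1) w)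
    (hwc : Continuous w) (hα : 0 < α) (hθ : α < θ) (hθ1 : θ < 1) (hβ : α < β) (hβ1 : β < 1)
    (hγ : 1 < α + γ) (has : a < s) (hst : s < t) :
    fracIntegral α K w a t = fracIntegral α K w a s + fracIntegral α K w s t := by
  have hθ0 : 0 < θ := by linarith
  have hβ0 : 0 < β := by linarith
  set η : ℕ → ℝ := fun n => 1 / ((n : ℝ) + 1) with hη_def
  have hη : ∀ n, 0 < η n := fun n => Nat.one_div_pos_of_nat
  have hη1 : ∀ n, η n ≤ 1 := fun n => by
    rw [hη_def]
    exact (div_le_one (by positivity)).2 (by linarith [Nat.cast_nonneg (α := ℝ) n])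
  have hη0 : Tendsto η atTop (𝓝 0) := tendsto_one_div_add_atTop_nhds_zero_nat
  have h1 := h.mono_right hθ0.le hst.le
  have h2 := h.mono_left hβ0.le has.le
  have l0 := h.tendsto_fracIntegral_steklov hw hwc hα hθ hθ1 hβ hβ1 hγ (has.trans hst) hη hη1 hη0
  have l1 := h1.tendsto_fracIntegral_steklov (hw.mono le_rfl (by linarith)) hwc hα hθ hθ1 hβ hβ1 hγ
    has hη hη1 hη0
  have l2 := h2.tendsto_fracIntegral_steklov (hw.mono has.le le_rfl) hwc hα hθ hθ1 hβ hβ1 hγ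
    hst hη hη1 hη0
  refine tendsto_nhds_unique l0 ((l1.add l2).congr fun n => ?_)
  obtain ⟨B, hB⟩ := (isCompact_Icc (a := a) (b := t + 1)).exists_bound_of_continuousOn
    hwc.continuousOn
  have hd : HasBoundedDensity (steklov (η n) w) (fun x => (η n)⁻¹ • (w (x + η n) - w x))
      ((η n)⁻¹ * (B + B)) a t :=
    hasBoundedDensity_steklov (hη n) (fun c d _ _ _ => hwc.intervalIntegrable _ _)
      fun r hr => hB r ⟨hr.1.le, by linarith [hr.2, hη1 n]⟩
  have hd1 := hd.mono le_rfl hst.le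
  have hd2 := hd.mono has.le le_rfl
  rw [h.fracIntegral_eq hd hα hθ hθ1 hβ hβ1 (has.trans hst),
    h1.fracIntegral_eq hd1 hα hθ hθ1 hβ hβ1 has, h2.fracIntegral_eq hd2 hα hθ hθ1 hβ hβ1 hst,
    ← smul_add, intervalIntegral.integral_add_adjacent_intervals
      (h1.intervalIntegrable_eval hθ0 hβ0 hd1 has) (h2.intervalIntegrable_eval hθ0 hβ0 hd2 hst)]

end Additivity

/-! ### The semigroup -/

section Semigroup

variable {V : Type*} [NormedAddCommGroup V] [InnerProductSpace ℝ V] [CompleteSpace V]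
  {A : V →ₗ.[ℝ] V} {S : ℝ → V →L[ℝ] V}

/-! ### Boundedness, continuity and differentiability of the orbits. -/

theorem IsSemigroupGeneratedBy.tendsto_zero (hS : IsSemigroupGeneratedBy A S) (x : V) :
    Tendsto (fun t => S t x) (𝓝[≥] 0) (𝓝 x) := by
  rw [← Ioi_insert, nhdsWithin_insert, tendsto_sup]
  refine ⟨?_, hS.strongly_continuous x⟩
  have : S 0 x = x := by rw [hS.zero]; rfl
  rw [tendsto_pure_left]
  intro s hs
  rw [this]
  exact mem_of_mem_nhds hs

theorem IsSemigroupGeneratedBy.apply_add (hS : IsSemigroupGeneratedBy A S) {s t : ℝ} (hs : 0 ≤ s)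
    (ht : 0 ≤ t) (x : V) : S (s + t) x = S s (S t x) := by
  rw [hS.add s t hs ht]; rfl

/-- Otherwise there are times tending to zero with unbounded norms, against the uniform boundedness
principle, since every orbit converges along them. -/
theorem IsSemigroupGeneratedBy.exists_bound_near_zero (hS : IsSemigroupGeneratedBy A S) :
    ∃ δ > 0, ∃ M : ℝ, ∀ t ∈ Icc 0 δ, ‖S t‖ ≤ M := by
  by_contra! hcon
  choose t ht hMt using fun n : ℕ => hcon (1 / ((n : ℝ) + 1)) Nat.one_div_pos_of_nat n
  have hlim : Tendsto t atTop (𝓝[≥] 0) := by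
    refine tendsto_nhdsWithin_iff.2 ⟨?_, Eventually.of_forall fun n => (ht n).1⟩
    exact squeeze_zero (fun n => (ht n).1) (fun n => (ht n).2)
      tendsto_one_div_add_atTop_nhds_zero_nat
  obtain ⟨C, hC⟩ := banach_steinhaus (g := fun n => S (t n)) fun x => by
    obtain ⟨C, hC⟩ := (((hS.tendsto_zero x).comp hlim).norm).bddAbove_range
    exact ⟨C, fun n => hC ⟨n, rfl⟩⟩
  obtain ⟨n, hn⟩ := exists_nat_gt C
  exact absurd (hMt n) (not_lt.2 ((hC n).trans hn.le))

theorem IsSemigroupGeneratedBy.exists_bound (hS : IsSemigroupGeneratedBy A S) (T : ℝ) :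
    ∃ M : ℝ, ∀ t ∈ Icc 0 T, ‖S t‖ ≤ M := by
  obtain ⟨δ, hδ, M, hM⟩ := hS.exists_bound_near_zero
  have key : ∀ n : ℕ, ∃ M : ℝ, ∀ t ∈ Icc 0 (n * δ), ‖S t‖ ≤ M := by
    intro n
    induction n with
    | zero =>
      refine ⟨M, fun t ht => hM t ⟨ht.1, ?_⟩⟩
      have := ht.2
      simp only [Nat.cast_zero, zero_mul] at this
      linarith
    | succ n ih =>
      obtain ⟨N, hN⟩ := ih
      refine ⟨max N (N * M), fun t ht => ?_⟩
      rcases le_total t (n * δ) with h | h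
      · exact le_max_of_le_left (hN t ⟨ht.1, h⟩)
      · have h0 : (0 : ℝ) ≤ n * δ := by positivity
        have h1 := ht.2
        push_cast at h1
        have e : t = n * δ + (t - n * δ) := by ring
        rw [e, hS.add _ _ h0 (by linarith)]
        refine le_max_of_le_right ((ContinuousLinearMap.opNorm_comp_le _ _).trans ?_)
        have h2 := hN (n * δ) ⟨h0, le_rfl⟩
        have h3 := hM (t - n * δ) ⟨by linarith, by linarith⟩
        have := (norm_nonneg _).trans h2
        gcongr
  obtain ⟨n, hn⟩ := exists_nat_ge (T / δ)
  obtain ⟨M, hM⟩ := key n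
  exact ⟨M, fun t ht => hM t ⟨ht.1, ht.2.trans ((div_le_iff₀ hδ).1 hn)⟩⟩

theorem IsSemigroupGeneratedBy.continuousOn (hS : IsSemigroupGeneratedBy A S) (x : V) :
    ContinuousOn (fun t => S t x) (Ici 0) := by
  intro t ht
  obtain ⟨M, hM⟩ := hS.exists_bound (t + 1)
  have hM0 : 0 ≤ M := (norm_nonneg _).trans (hM t ⟨ht, by linarith⟩)
  have ht' : 0 ≤ t := ht
  rw [ContinuousWithinAt, tendsto_iff_norm_sub_tendsto_zero]
  have h1 : Tendsto (fun s => M * ‖S |s - t| x - x‖) (𝓝[≥] t ⊔ 𝓝[Ici 0] t) (𝓝 0) := by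
    have h2 : Tendsto (fun s : ℝ => |s - t|) (𝓝[≥] t ⊔ 𝓝[Ici 0] t) (𝓝[≥] 0) := by
      refine tendsto_nhdsWithin_iff.2 ⟨?_, Eventually.of_forall fun s => mem_Ici.2 (abs_nonneg _)⟩
      have h3 : ContinuousAt (fun s : ℝ => |s - t|) t := by fun_prop
      have h4 := h3.tendsto
      simp only [sub_self, abs_zero] at h4
      exact h4.mono_left (sup_le nhdsWithin_le_nhds nhdsWithin_le_nhds)
    have h5 := ((tendsto_iff_norm_sub_tendsto_zero.1 (hS.tendsto_zero x)).comp h2).const_mul M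
    simpa using h5
  refine squeeze_zero' (Eventually.of_forall fun _ => norm_nonneg _) ?_
    (h1.mono_left le_sup_right)
  filter_upwards [self_mem_nhdsWithin, nhdsWithin_le_nhds (Iio_mem_nhds (lt_add_one t))]
    with s hs hs1
  have hs' : 0 ≤ s := hs
  rcases le_total s t with h | h
  · have e : S t x = S s (S (t - s) x) := by
      rw [← hS.apply_add hs' (by linarith)]; congr 2; ring
    rw [e, ← map_sub, abs_of_nonpos (by linarith), neg_sub, ← norm_neg, ← map_neg, neg_sub]
    exact (S s).le_of_opNorm_le (hM s ⟨hs', by linarith⟩) _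
  · have e : S s x = S t (S (s - t) x) := by
      rw [← hS.apply_add ht' (by linarith)]; congr 2; ring
    rw [e, ← map_sub, abs_of_nonneg (by linarith)]
    exact (S t).le_of_opNorm_le (hM t ⟨ht', by linarith⟩) _

theorem IsSemigroupGeneratedBy.tendsto_generator (hS : IsSemigroupGeneratedBy A S)
    (x : A.domain) : Tendsto (fun h : ℝ => h⁻¹ • (S h x - x)) (𝓝[>] 0) (𝓝 (A x)) :=
  (hS.generator x (A x)).1 (A.mem_graph x)

theorem IsSemigroupGeneratedBy.mem_graph (hS : IsSemigroupGeneratedBy A S) {t : ℝ} (ht : 0 ≤ t)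
    (x : A.domain) : (S t x, S t (A x)) ∈ A.graph := by
  rw [hS.generator]
  refine (((S t).continuous.tendsto _).comp (hS.tendsto_generator x)).congr' ?_
  filter_upwards [self_mem_nhdsWithin] with h hh
  have hh' : 0 ≤ h := le_of_lt hh
  simp only [Function.comp_apply, map_smul, map_sub]
  rw [← hS.apply_add ht hh', ← hS.apply_add hh' ht, add_comm]

theorem IsSemigroupGeneratedBy.exists_domain (hS : IsSemigroupGeneratedBy A S) {t : ℝ}
    (ht : 0 ≤ t) (x : A.domain) : ∃ y : A.domain, (y : V) = S t x ∧ A y = S t (A x) := by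
  have := hS.mem_graph ht x
  rw [LinearPMap.mem_graph_iff] at this
  obtain ⟨y, h1, h2⟩ := this
  exact ⟨y, h1, h2⟩

theorem IsSemigroupGeneratedBy.hasDerivWithinAt (hS : IsSemigroupGeneratedBy A S) {t : ℝ}
    (ht : 0 ≤ t) (x : A.domain) :
    HasDerivWithinAt (fun t => S t x) (S t (A x)) (Ioi t) t := by
  rw [hasDerivWithinAt_iff_tendsto_slope' (by simp)]
  have h1 : Tendsto (fun s => s - t) (𝓝[>] t) (𝓝[>] 0) := by
    refine tendsto_nhdsWithin_iff.2 ⟨?_, ?_⟩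
    · have h3 : ContinuousAt (fun s : ℝ => s - t) t := by fun_prop
      have h4 := h3.tendsto
      simp only [sub_self] at h4
      exact h4.mono_left nhdsWithin_le_nhds
    · filter_upwards [self_mem_nhdsWithin] with s hs
      exact sub_pos.2 (mem_Ioi.1 hs)
  refine (((S t).continuous.tendsto _).comp ((hS.tendsto_generator x).comp h1)).congr' ?_
  filter_upwards [self_mem_nhdsWithin] with s hs
  have hs' : 0 ≤ s - t := (sub_pos.2 (mem_Ioi.1 hs)).le
  simp only [Function.comp_apply, map_smul, map_sub, slope_def_module]
  rw [← hS.apply_add ht hs', add_sub_cancel]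

/-- The right derivative S(t)Ax is continuous, so the orbit is its primitive and hence
differentiable on both sides. The argument `max r 0` extends the integrand continuously to negative
times, where S is arbitrary. -/
theorem IsSemigroupGeneratedBy.hasDerivAt (hS : IsSemigroupGeneratedBy A S) {t : ℝ}
    (ht : 0 < t) (x : A.domain) : HasDerivAt (fun t => S t x) (S t (A x)) t := by
  have hc : Continuous fun r : ℝ => S (max r 0) (A x) :=
    (hS.continuousOn (A x)).comp_continuous (by fun_prop) fun r => mem_Ici.2 (le_max_right _ _)
  have h1 : ∀ s, 0 ≤ s → S s x = x + ∫ r in (0 : ℝ)..s, S (max r 0) (A x) := by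
    intro s hs
    have := intervalIntegral.integral_eq_sub_of_hasDeriv_right_of_le
      (f := fun t => S t (x : V)) (f' := fun r => S (max r 0) (A x)) hs
      ((hS.continuousOn (x : V)).mono Icc_subset_Ici_self)
      (fun r hr => by
        simp only [max_eq_left hr.1.le]
        exact hS.hasDerivWithinAt hr.1.le x)
      (hc.intervalIntegrable _ _)
    rw [this, hS.zero]
    simp
  have h2 := (intervalIntegral.integral_hasDerivAt_right (hc.intervalIntegrable 0 t)
    (hc.stronglyMeasurableAtFilter _ _) hc.continuousAt).const_add (x : V)
  simp only [max_eq_left ht.le] at h2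
  refine h2.congr_of_eventuallyEq ?_
  filter_upwards [Ioi_mem_nhds ht] with s hs
  exact h1 s (le_of_lt hs)

/-- If z is orthogonal to the domain, then ⟨Rz, y⟩ = ⟨z, Ry⟩ = 0 for all y by symmetry, so Rz = 0
and z = -A(Rz) = 0. -/
theorem IsNegativeWithCompactInverse.dense_domain (hA : IsNegativeWithCompactInverse A) :
    Dense (A.domain : Set V) := by
  obtain ⟨R, -, -, hR⟩ := hA.compact_inverse
  rw [Submodule.dense_iff_topologicalClosure_eq_top, Submodule.topologicalClosure_eq_top_iff,
    Submodule.eq_bot_iff]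
  intro z hz
  obtain ⟨hzR, hz1⟩ := hR z
  have h0 : R z = 0 := by
    refine ext_inner_right ℝ fun y => ?_
    obtain ⟨hyR, hy1⟩ := hR y
    have h2 : inner ℝ (R y) z = 0 := (Submodule.mem_orthogonal _ _).1 hz _ hyR
    have h3 := hA.symmetric ⟨R z, hzR⟩ ⟨R y, hyR⟩
    have e1 : A ⟨R z, hzR⟩ = -z := by rw [eq_neg_iff_add_eq_zero, ← neg_eq_iff_add_eq_zero]; exact hz1
    have e2 : A ⟨R y, hyR⟩ = -y := by rw [eq_neg_iff_add_eq_zero, ← neg_eq_iff_add_eq_zero]; exact hy1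
    rw [e1, e2, inner_neg_left, inner_neg_right, neg_inj, real_inner_comm] at h3
    rw [inner_zero_left, ← h3]
    exact h2
  have e3 : (⟨R z, hzR⟩ : A.domain) = 0 := Subtype.ext h0
  rw [← hz1]
  rw [e3, LinearPMap.map_zero, neg_zero]

/-- On the domain ‖S(s)x‖² has right derivative 2⟨A S(s)x, S(s)x⟩ ≤ 0; density does the rest. -/
theorem norm_apply_le_of_generator (hA : IsNegativeWithCompactInverse A)
    (hS : IsSemigroupGeneratedBy A S) {t : ℝ} (ht : 0 ≤ t) (x : V) : ‖S t x‖ ≤ ‖x‖ := by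
  have key : ∀ x : A.domain, ‖S t x‖ ≤ ‖(x : V)‖ := by
    intro x
    have hderiv : ∀ s ∈ Ico 0 t, HasDerivWithinAt (fun s => ‖S s x‖ ^ 2)
        (2 * inner ℝ (S s x) (S s (A x))) (Ici s) s := fun s hs =>
      ((hS.hasDerivWithinAt hs.1 x).Ici_of_Ioi).norm_sq
    have h := image_le_of_deriv_right_le_deriv_boundary (f := fun s => ‖S s (x : V)‖ ^ 2)
      (B := fun _ => ‖(x : V)‖ ^ 2) (B' := fun _ => 0) (a := 0) (b := t)
      (((hS.continuousOn (x : V)).mono Icc_subset_Ici_self).norm.pow 2) hderiv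
      (by rw [hS.zero]; simp) continuousOn_const (fun s _ => hasDerivWithinAt_const _ _ _)
      (fun s hs => by
        obtain ⟨y, h1, h2⟩ := hS.exists_domain hs.1 x
        rw [← h1, ← h2]
        by_cases hy : (y : V) = 0
        · rw [hy, inner_zero_left, mul_zero]
        · have := hA.strictly_positive y hy
          rw [inner_neg_left, real_inner_comm] at this
          linarith)
      (x := t) ⟨ht, le_rfl⟩
    exact (sq_le_sq₀ (norm_nonneg _) (norm_nonneg _)).1 h
  have hcl : IsClosed {x : V | ‖S t x‖ ≤ ‖x‖} :=
    isClosed_le (by fun_prop) (by fun_prop)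
  have := hcl.closure_subset_iff.2 (fun x hx => key ⟨x, hx⟩ : (A.domain : Set V) ⊆ _)
  rw [hA.dense_domain.closure_eq] at this
  exact this (mem_univ x)

/-- For x and y in the domain, s ↦ ⟨S(t-s)x, S(s)y⟩ has zero derivative on (0, t) by symmetry of A,
so its values at 0 and t agree. Density extends this in each argument. -/
theorem inner_apply_left_of_generator (hA : IsNegativeWithCompactInverse A)
    (hS : IsSemigroupGeneratedBy A S) {t : ℝ} (ht : 0 ≤ t) (x y : V) :
    inner ℝ (S t x) y = inner ℝ x (S t y) := by
  rcases ht.eq_or_lt with rfl | ht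
  · rw [hS.zero]; rfl
  have key : ∀ x y : A.domain, inner ℝ (S t x) (y : V) = inner ℝ (x : V) (S t y) := by
    intro x y
    have hc : ContinuousOn (fun s => inner ℝ (S (t - s) (x : V)) (S s (y : V))) (Icc 0 t) := by
      refine ContinuousOn.inner ?_ ((hS.continuousOn (y : V)).mono Icc_subset_Ici_self)
      exact (hS.continuousOn (x : V)).comp (by fun_prop) fun s hs => sub_nonneg.2 hs.2
    obtain ⟨c, hc1, hc2⟩ := exists_hasDerivAt_eq_slope
      (fun s => inner ℝ (S (t - s) (x : V)) (S s (y : V)))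
      (fun s => inner ℝ (S (t - s) (x : V)) (S s (A y)) +
        inner ℝ (-S (t - s) (A x)) (S s (y : V))) ht hc
      (fun s hs => by
        have h1 := (hS.hasDerivAt (sub_pos.2 hs.2) x).scomp s ((hasDerivAt_id s).const_sub t)
        have h2 := h1.inner ℝ (hS.hasDerivAt hs.1 y)
        simpa using h2)
    obtain ⟨p, hp1, hp2⟩ := hS.exists_domain (sub_pos.2 hc1.2).le x
    obtain ⟨q, hq1, hq2⟩ := hS.exists_domain hc1.1.le y
    have h0 := hA.symmetric p q
    rw [← hp1, ← hp2, ← hq1, ← hq2, inner_neg_left, h0, add_neg_cancel, eq_comm,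
      div_eq_zero_iff] at hc2
    have h3 := hc2.resolve_right (by linarith)
    simp only [sub_self, sub_zero, hS.zero, ContinuousLinearMap.id_apply] at h3
    linarith
  have h1 : ∀ (x : A.domain) (y : V), inner ℝ (S t x) y = inner ℝ (x : V) (S t y) := by
    intro x y
    have hcl : IsClosed {y : V | inner ℝ (S t x) y = inner ℝ (x : V) (S t y)} :=
      isClosed_eq (by fun_prop) (by fun_prop)
    have := hcl.closure_subset_iff.2 (fun y hy => key x ⟨y, hy⟩ : (A.domain : Set V) ⊆ _)
    rw [hA.dense_domain.closure_eq] at this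
    exact this (mem_univ y)
  have hcl : IsClosed {x : V | inner ℝ (S t x) y = inner ℝ (x : V) (S t y)} :=
    isClosed_eq (by fun_prop) (by fun_prop)
  have := hcl.closure_subset_iff.2 (fun x hx => h1 ⟨x, hx⟩ y : (A.domain : Set V) ⊆ _)
  rw [hA.dense_domain.closure_eq] at this
  exact this (mem_univ x)

/-- First and second differences, taken with decreasing sign, are nonnegative and decreasing.
Summing e over n, …, 2n gives (n+1) e(2n) ≤ d(n), and summing d over 0, …, n gives (n+1) d(n) ≤
c(0). -/
theorem sq_mul_second_difference_le {c : ℕ → ℝ} (hc : ∀ k, 0 ≤ c k)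
    (hd : ∀ k, 0 ≤ c k - c (k + 1))
    (he : ∀ k, 0 ≤ c k - c (k + 1) - (c (k + 1) - c (k + 2)))
    (hanti : Antitone fun k => c k - c (k + 1) - (c (k + 1) - c (k + 2))) (n : ℕ) :
    ((n : ℝ) + 1) ^ 2 * (c (2 * n) - c (2 * n + 1) - (c (2 * n + 1) - c (2 * n + 2))) ≤ c 0 := by
  set d : ℕ → ℝ := fun k => c k - c (k + 1) with hd_def
  set e : ℕ → ℝ := fun k => d k - d (k + 1) with he_def
  have hdanti : Antitone d := antitone_nat_of_succ_le fun k => sub_nonneg.1 (he k)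
  have h1 : ((n : ℝ) + 1) * e (2 * n) ≤ d n := by
    have h := Finset.card_nsmul_le_sum (Finset.range (n + 1)) (fun k => e (n + k)) (e (2 * n))
      fun k hk => hanti (by have := Finset.mem_range.1 hk; omega)
    have h' := Finset.sum_range_sub' (fun k => d (n + k)) (n + 1)
    have h'' : ∑ k ∈ Finset.range (n + 1), e (n + k) = d n - d (n + (n + 1)) := h'
    rw [h'', Finset.card_range, nsmul_eq_mul] at h
    push_cast at h
    have := hd (n + (n + 1))
    linarith
  have h2 : ((n : ℝ) + 1) * d n ≤ c 0 := by
    have h := Finset.card_nsmul_le_sum (Finset.range (n + 1)) d (d n)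
      fun k hk => hdanti (by have := Finset.mem_range.1 hk; omega)
    rw [Finset.sum_range_sub', Finset.card_range, nsmul_eq_mul] at h
    push_cast at h
    linarith [hc (n + 1)]
  have h0 : (0 : ℝ) < (n : ℝ) + 1 := by positivity
  calc _ = ((n : ℝ) + 1) * (((n : ℝ) + 1) * e (2 * n)) := by rw [he_def, hd_def]; ring
    _ ≤ ((n : ℝ) + 1) * d n := by gcongr
    _ ≤ c 0 := h2

/-- Smoothing without spectral calculus. For c(k) = ⟨S(kh+τ)x, x⟩ self-adjointness turns second
differences into squared norms ‖S(p+h)x - S(p)x‖² with p = (kh+τ)/2, and contractivity makes them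
decrease in k. The preceding lemma bounds the one at k = 2n by ‖x‖²/(n+1)², where n+1 > t/h. -/
theorem norm_sub_apply_le_of_generator (hA : IsNegativeWithCompactInverse A)
    (hS : IsSemigroupGeneratedBy A S) {t h : ℝ} (ht : 0 < t) (hh : 0 < h) (x : V) :
    ‖S (t + h) x - S t x‖ ≤ h / t * ‖x‖ := by
  have hsym {s : ℝ} (hs : 0 ≤ s) (u v : V) := inner_apply_left_of_generator hA hS hs u v
  have hnorm {s : ℝ} (hs : 0 ≤ s) (u : V) := norm_apply_le_of_generator hA hS hs u
  set n := ⌊t / h⌋₊ with hn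
  have hnh : n * h ≤ t := (le_div_iff₀ hh).1 (Nat.floor_le (by positivity))
  have hnh' : t / h < n + 1 := Nat.lt_floor_add_one _
  -- Chosen so that (2nh + τ)/2 = t; it is nonnegative because nh ≤ t.
  set τ := 2 * (t - n * h) with hτ
  have hτ0 : 0 ≤ τ := by linarith
  have hpos : ∀ k : ℕ, 0 ≤ ((k : ℝ) * h + τ) / 2 := fun k => by positivity
  set c : ℕ → ℝ := fun k => inner ℝ (S (k * h + τ) x) x with hc
  have hck : ∀ k, c k = ‖S ((k * h + τ) / 2) x‖ ^ 2 := fun k => by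
    rw [← real_inner_self_eq_norm_sq, ← hsym (hpos k), ← hS.apply_add (hpos k) (hpos k), add_halves]
  have hek : ∀ k, c k - c (k + 1) - (c (k + 1) - c (k + 2)) =
      ‖S ((k * h + τ) / 2 + h) x - S ((k * h + τ) / 2) x‖ ^ 2 := fun k => by
    have i1 : ∀ a b : ℝ, 0 ≤ a → 0 ≤ b → inner ℝ (S a x) (S b x) = inner ℝ (S (a + b) x) x := by
      intro a b ha hb
      rw [← hsym hb, ← hS.apply_add hb ha, add_comm]
    have hp := hpos k
    rw [norm_sub_sq_real, ← real_inner_self_eq_norm_sq, ← real_inner_self_eq_norm_sq,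
      i1 _ _ (by positivity) (by positivity), i1 _ _ (by positivity) (by positivity),
      i1 _ _ (by positivity) (by positivity)]
    have e1 : ((k : ℝ) * h + τ) / 2 + h + (((k : ℝ) * h + τ) / 2 + h) =
        ((k + 2 : ℕ) : ℝ) * h + τ := by push_cast; ring
    have e2 : ((k : ℝ) * h + τ) / 2 + h + ((k : ℝ) * h + τ) / 2 =
        ((k + 1 : ℕ) : ℝ) * h + τ := by push_cast; ring
    rw [e1, e2, add_halves]
    ring
  have main := sq_mul_second_difference_le (c := c) (fun k => by rw [hck]; positivity)
    (fun k => by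
      rw [hck, hck, sub_nonneg]
      have e1 : (((k + 1 : ℕ) : ℝ) * h + τ) / 2 = h / 2 + ((k : ℝ) * h + τ) / 2 := by
        push_cast; ring
      rw [e1, hS.apply_add (by positivity) (hpos k)]
      gcongr
      exact hnorm (by positivity) _)
    (fun k => by rw [hek]; positivity)
    (antitone_nat_of_succ_le fun k => by
      rw [hek, hek]
      have e1 : (((k + 1 : ℕ) : ℝ) * h + τ) / 2 = h / 2 + ((k : ℝ) * h + τ) / 2 := by
        push_cast; ring
      have hp := hpos k
      rw [e1, add_assoc, hS.apply_add (by positivity) (by positivity),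
        hS.apply_add (by positivity) (hpos k), ← map_sub]
      gcongr
      exact hnorm (by positivity) _) n
  have e2 : (((2 * n : ℕ) : ℝ) * h + τ) / 2 = t := by rw [hτ]; push_cast; ring
  rw [hek, e2, ← mul_pow] at main
  have hc0 : c 0 ≤ ‖x‖ ^ 2 := by
    rw [hck]
    gcongr
    exact hnorm (hpos 0) x
  have h3 := (sq_le_sq₀ (by positivity) (norm_nonneg _)).1 (main.trans hc0)
  have h4 : t / h * ‖S (t + h) x - S t x‖ ≤ ‖x‖ := le_trans (by gcongr) h3
  calc _ = h / t * (t / h * ‖S (t + h) x - S t x‖) := by field_simp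
    _ ≤ _ := by gcongr

/-- The properties of the semigroup that are used in the estimates of the mild equation. -/
structure IsRegularSemigroup (S : ℝ → V →L[ℝ] V) : Prop where
  zero : S 0 = ContinuousLinearMap.id ℝ V
  add : ∀ s t : ℝ, 0 ≤ s → 0 ≤ t → S (s + t) = (S s).comp (S t)
  norm_le : ∀ t, 0 ≤ t → ‖S t‖ ≤ 1
  norm_sub_le : ∀ {θ t h : ℝ}, 0 ≤ θ → θ ≤ 1 → 0 < t → 0 ≤ h →
    ‖S (t + h) - S t‖ ≤ 2 * (h ^ θ * t ^ (-θ))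
  continuousOn : ∀ x, ContinuousOn (fun t => S t x) (Ici 0)

theorem isRegularSemigroup_of_generator (hA : IsNegativeWithCompactInverse A)
    (hS : IsSemigroupGeneratedBy A S) : IsRegularSemigroup S where
  zero := hS.zero
  add := hS.add
  norm_le t ht := ContinuousLinearMap.opNorm_le_bound _ zero_le_one fun x => by
    simpa using norm_apply_le_of_generator hA hS ht x
  norm_sub_le := by
    intro θ t h hθ hθ1 ht hh
    have e : h ^ θ * t ^ (-θ) = (h / t) ^ θ := by
      rw [Real.div_rpow hh ht.le, Real.rpow_neg ht.le, div_eq_mul_inv]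
    rw [e]
    have h0 : 0 ≤ h / t := by positivity
    refine ContinuousLinearMap.opNorm_le_bound _ (by positivity) fun x => ?_
    rw [_root_.sub_apply]
    rcases hh.eq_or_lt with rfl | hh'
    · simp only [add_zero, sub_self, norm_zero]
      positivity
    -- Interpolation: the linear bound h/t serves when h ≤ t, the trivial bound 2 when h ≥ t.
    rcases le_total (h / t) 1 with h1 | h1
    · refine (norm_sub_apply_le_of_generator hA hS ht hh' x).trans ?_
      gcongr
      calc h / t = (h / t) ^ (1 : ℝ) := (Real.rpow_one _).symm
        _ ≤ (h / t) ^ θ := Real.rpow_le_rpow_of_exponent_ge (by positivity) h1 hθ1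
        _ ≤ 2 * (h / t) ^ θ := by linarith [Real.rpow_nonneg h0 θ]
    · have h2 := norm_apply_le_of_generator hA hS (show 0 ≤ t + h by linarith) x
      have h3 := norm_apply_le_of_generator hA hS ht.le x
      have h4 := Real.one_le_rpow h1 hθ
      calc _ ≤ ‖x‖ + ‖x‖ := (norm_sub_le _ _).trans (by linarith)
        _ = 2 * 1 * ‖x‖ := by ring
        _ ≤ _ := by gcongr
  continuousOn := hS.continuousOn

theorem IsRegularSemigroup.apply_add (hS : IsRegularSemigroup S) {s t : ℝ} (hs : 0 ≤ s)
    (ht : 0 ≤ t) (x : V) : S (s + t) x = S s (S t x) := by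
  rw [hS.add s t hs ht]; rfl

/-- Splitting time t in halves writes the operator as a product of two differences at t/2. The
constant 16 collects a factor 2 from each difference bound and a factor 2 from each power of t/2. -/
theorem IsRegularSemigroup.norm_second_difference_le (hS : IsRegularSemigroup S) {β θ t h k : ℝ}
    (hβ : 0 ≤ β) (hβ1 : β ≤ 1) (hθ : 0 ≤ θ) (hθ1 : θ ≤ 1) (ht : 0 < t) (hh : 0 ≤ h) (hk : 0 ≤ k) :
    ‖(S h - ContinuousLinearMap.id ℝ V).comp (S (t + k) - S t)‖ ≤
      16 * h ^ β * (k ^ θ * t ^ (-β - θ)) := by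
  have ht2 : 0 < t / 2 := by positivity
  have e : (S h - ContinuousLinearMap.id ℝ V).comp (S (t + k) - S t) =
      (S (t / 2 + h) - S (t / 2)).comp (S (t / 2 + k) - S (t / 2)) := by
    ext x
    have e1 : ∀ a b, 0 ≤ a → 0 ≤ b → S a (S b x) = S (a + b) x := fun a b ha hb =>
      (hS.apply_add ha hb x).symm
    simp only [ContinuousLinearMap.comp_apply, _root_.sub_apply,
      ContinuousLinearMap.id_apply, map_sub]
    rw [e1 _ _ (by positivity) (by positivity), e1 _ _ (by positivity) (by positivity),
      e1 _ _ (by positivity) (by positivity), e1 _ _ (by positivity) (by positivity),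
      e1 _ _ (by positivity) (by positivity), e1 _ _ (by positivity) (by positivity)]
    ring_nf
  have hp : ∀ x : ℝ, 0 ≤ x → x ≤ 1 → (t / 2) ^ (-x) ≤ 2 * t ^ (-x) := by
    intro x hx hx1
    rw [Real.div_rpow ht.le (by norm_num), Real.rpow_neg (by norm_num : (0 : ℝ) ≤ 2), div_inv_eq_mul,
      mul_comm]
    gcongr
    calc (2 : ℝ) ^ x ≤ 2 ^ (1 : ℝ) := Real.rpow_le_rpow_of_exponent_le (by norm_num) hx1
      _ = 2 := Real.rpow_one _
  rw [e]
  have p1 := Real.rpow_nonneg hh β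
  have p2 := Real.rpow_nonneg hk θ
  have p3 := Real.rpow_nonneg ht2.le (-β)
  have p4 := Real.rpow_nonneg ht2.le (-θ)
  have p5 := Real.rpow_nonneg ht.le (-β)
  calc _ ≤ (2 * (h ^ β * (t / 2) ^ (-β))) * (2 * (k ^ θ * (t / 2) ^ (-θ))) := by
        refine (ContinuousLinearMap.opNorm_comp_le _ _).trans ?_
        gcongr
        · exact hS.norm_sub_le hβ hβ1 ht2 hh
        · exact hS.norm_sub_le hθ hθ1 ht2 hk
    _ ≤ (2 * (h ^ β * (2 * t ^ (-β)))) * (2 * (k ^ θ * (2 * t ^ (-θ)))) := by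
        gcongr
        · exact hp β hβ hβ1
        · exact hp θ hθ hθ1
    _ = _ := by
        rw [sub_eq_add_neg (-β), Real.rpow_add ht]
        ring

end Semigroup

/-! ### Linearity of the pathwise integral -/

section Linearity

variable {V : Type*} [NormedAddCommGroup V] [InnerProductSpace ℝ V] [CompleteSpace V]
  {e : HilbertBasis ℕ ℝ V}

theorem integral_congr_ae_Ioo {a b : ℝ} (hab : a ≤ b) {f g : ℝ → V}
    (h : ∀ᵐ r ∂(volume.restrict (Ioo a b)), f r = g r) :
    ∫ r in a..b, f r = ∫ r in a..b, g r := by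
  rw [intervalIntegral.integral_of_le hab, intervalIntegral.integral_of_le hab,
    integral_Ioc_eq_integral_Ioo, integral_Ioc_eq_integral_Ioo]
  exact integral_congr_ae h

theorem fracIntegral_congr {α a t : ℝ} (hat : a ≤ t) {K K' : ℝ → HS e} {w : ℝ → V}
    (h : ∀ r ∈ Ioo a t, K r = K' r) : fracIntegral α K w a t = fracIntegral α K' w a t := by
  unfold fracIntegral
  congr 1
  refine integral_congr_Ioo hat fun r hr => ?_
  rw [weylLeft_congr hr.1.le (h r hr)]
  filter_upwards [ae_restrict_mem measurableSet_Ioo] with q hq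
  exact h q ⟨hq.1, hq.2.trans hr.2⟩

theorem weylLeft_lcomp {α a r : ℝ} (B : V →L[ℝ] V) {K : ℝ → HS e}
    (hK : IntervalIntegrable (fun q => ((r - q) ^ (1 + α))⁻¹ • (K r - K q)) volume a r) :
    weylLeft α a (fun r => HS.lcomp B (K r)) r = HS.lcomp B (weylLeft α a K r) := by
  have h := (HS.lcompL e B).intervalIntegral_comp_comm hK
  simp only [map_smul, map_sub, HS.lcompL_apply] at h
  rw [← HS.lcompL_apply B (weylLeft α a K r)]
  simp only [weylLeft, map_smul, map_add, HS.lcompL_apply, h]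

theorem fracIntegral_lcomp {α a t : ℝ} (hat : a ≤ t) (B : V →L[ℝ] V) {K : ℝ → HS e} {w : ℝ → V}
    (h : FracIntegrable α K w a t) :
    fracIntegral α (fun r => HS.lcomp B (K r)) w a t = B (fracIntegral α K w a t) := by
  unfold fracIntegral
  rw [map_neg, ← B.intervalIntegral_comp_comm h.2.1]
  congr 1
  refine integral_congr_ae_Ioo hat ?_
  filter_upwards [h.1] with r hr
  rw [weylLeft_lcomp B hr.1]
  rfl

theorem fracIntegral_sub {α a t : ℝ} (hat : a ≤ t) {K K' : ℝ → HS e} {w : ℝ → V}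
    (h : FracIntegrable α K w a t) (h' : FracIntegrable α K' w a t) :
    fracIntegral α (fun r => K r - K' r) w a t =
      fracIntegral α K w a t - fracIntegral α K' w a t := by
  unfold fracIntegral
  rw [neg_sub_neg, ← neg_sub, ← intervalIntegral.integral_sub h.2.1 h'.2.1]
  congr 1
  refine integral_congr_ae_Ioo hat ?_
  filter_upwards [h.1, h'.1] with r hr hr'
  have e1 : weylLeft α a (fun r => K r - K' r) r = weylLeft α a K r - weylLeft α a K' r := by
    unfold weylLeft
    have e2 : ∀ q, ((r - q) ^ (1 + α))⁻¹ • (K r - K' r - (K q - K' q)) =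
        ((r - q) ^ (1 + α))⁻¹ • (K r - K q) - ((r - q) ^ (1 + α))⁻¹ • (K' r - K' q) := by
      intro q
      module
    simp only [e2]
    rw [intervalIntegral.integral_sub hr.1 hr'.1]
    module
  rw [e1, map_sub, _root_.sub_apply]

end Linearity

/-! ### Weighted Hölder bounds and the convolution with the semigroup -/

section Convolution

/-- Exponential bound and Hölder condition on `(0, T]` with a singularity at zero. -/
structure WeightedHolder {E : Type*} [NormedAddCommGroup E] (β ρ N T : ℝ) (u : ℝ → E) : Prop where
  norm_le : ∀ t, 0 < t → t ≤ T → ‖u t‖ ≤ N * Real.exp (ρ * t)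
  sub_le : ∀ s t, 0 < s → s < t → t ≤ T →
    ‖u t - u s‖ ≤ N * Real.exp (ρ * t) * ((t - s) ^ β * s ^ (-β))

variable {V : Type*} [NormedAddCommGroup V] [InnerProductSpace ℝ V] [CompleteSpace V]
  {e : HilbertBasis ℕ ℝ V}

theorem WeightedHolder.nonneg {E : Type*} [NormedAddCommGroup E] {β ρ N T : ℝ} {u : ℝ → E}
    (h : WeightedHolder β ρ N T u) (hT : 0 < T) : 0 ≤ N :=
  nonneg_of_mul_nonneg_left ((norm_nonneg _).trans (h.norm_le T hT le_rfl)) (Real.exp_pos _)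

theorem WeightedHolder.mono {E : Type*} [NormedAddCommGroup E] {β ρ ρ' N N' T : ℝ} {u : ℝ → E}
    (h : WeightedHolder β ρ N T u) (hT : 0 < T) (hρ : ρ ≤ ρ') (hN : N ≤ N') :
    WeightedHolder β ρ' N' T u := by
  have hN0 := h.nonneg hT
  have hN0' := hN0.trans hN
  constructor
  · intro t h1 h2
    refine (h.norm_le t h1 h2).trans ?_
    gcongr
  · intro s t h1 h2 h3
    refine (h.sub_le s t h1 h2 h3).trans ?_
    have := Real.rpow_nonneg (sub_pos.2 h2).le β
    have := Real.rpow_nonneg h1.le (-β)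
    have : 0 < t := h1.trans h2
    gcongr

theorem WeightedHolder.unweighted {E : Type*} [NormedAddCommGroup E] {β ρ N T : ℝ} {u : ℝ → E}
    (h : WeightedHolder β ρ N T u) (hT : 0 < T) (hρ : 0 ≤ ρ) :
    WeightedHolder β 0 (N * Real.exp (ρ * T)) T u := by
  have hN0 := h.nonneg hT
  constructor
  · intro t h1 h2
    refine (h.norm_le t h1 h2).trans ?_
    rw [zero_mul, Real.exp_zero, mul_one]
    gcongr
  · intro s t h1 h2 h3
    refine (h.sub_le s t h1 h2 h3).trans ?_
    have := Real.rpow_nonneg (sub_pos.2 h2).le β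
    have := Real.rpow_nonneg h1.le (-β)
    rw [zero_mul, Real.exp_zero, mul_one]
    gcongr

/-- The increment splits as U(t-q)(g(r) - g(q)) - (U(t-q) - U(t-r)) g(r); the first term has the
β-singularity at a, the second the θ-singularity at t. A general family U covers both S, with b = 0,
and (S(h) - 1)S, with b = β. -/
theorem WeightedHolder.kernelBound {β ρ N T θ b κ a t : ℝ} {g : ℝ → HS e} {U : ℝ → V →L[ℝ] V}
    (hg : WeightedHolder β ρ N T g) (hκ : 0 ≤ κ) (hb : 0 ≤ b) (hβ : 0 ≤ β)
    (hU : ∀ τ, 0 < τ → ‖U τ‖ ≤ κ * τ ^ (-b))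
    (hU' : ∀ τ k, 0 < τ → 0 ≤ k → ‖U (τ + k) - U τ‖ ≤ κ * (k ^ θ * τ ^ (-b - θ)))
    (ha : 0 ≤ a) (hat : a < t) (htT : t ≤ T) :
    KernelBound θ β (expWeight (κ * N) ρ b t) a t (fun r => HS.lcomp (U (t - r)) (g r)) := by
  have hN := hg.nonneg (by linarith)
  constructor
  · intro r h1 h2
    have h3 : 0 < t - r := sub_pos.2 h2
    have p1 := Real.rpow_nonneg h3.le (-b)
    calc _ ≤ ‖U (t - r)‖ * ‖g r‖ := HS.norm_lcomp_le _ _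
      _ ≤ (κ * (t - r) ^ (-b)) * (N * Real.exp (ρ * r)) := by
        gcongr
        · exact hU _ h3
        · exact hg.norm_le r (by linarith) (by linarith)
      _ = _ := by rw [expWeight]; ring
  · intro q r h1 h2 h3
    have htr : 0 < t - r := sub_pos.2 h3
    have htq : 0 < t - q := by linarith
    have hrq : 0 < r - q := sub_pos.2 h2
    have hqa : 0 < q - a := sub_pos.2 h1
    have e1 : HS.lcomp (U (t - r)) (g r) - HS.lcomp (U (t - q)) (g q) =
        HS.lcomp (U (t - q)) (g r - g q) - HS.lcomp (U (t - r + (r - q)) - U (t - r)) (g r) := by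
      simp only [← HS.lcompL_apply, map_sub, _root_.sub_apply, sub_add_sub_cancel]
      abel
    have p1 := Real.rpow_nonneg htr.le (-b)
    have p2 := Real.rpow_nonneg hrq.le θ
    have p3 := Real.rpow_nonneg htr.le (-b - θ)
    have p4 := Real.rpow_nonneg hrq.le β
    have p5 := Real.rpow_nonneg htq.le (-b)
    have p6 := Real.rpow_nonneg (show 0 ≤ q by linarith) (-β)
    have i1 : (t - q) ^ (-b) ≤ (t - r) ^ (-b) :=
      Real.rpow_le_rpow_of_nonpos htr (by linarith) (by linarith)
    have i2 : q ^ (-β) ≤ (q - a) ^ (-β) :=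
      Real.rpow_le_rpow_of_nonpos hqa (by linarith) (by linarith)
    rw [e1]
    calc _ ≤ ‖U (t - q)‖ * ‖g r - g q‖ + ‖U (t - r + (r - q)) - U (t - r)‖ * ‖g r‖ :=
          (norm_sub_le _ _).trans (add_le_add (HS.norm_lcomp_le _ _) (HS.norm_lcomp_le _ _))
      _ ≤ (κ * (t - q) ^ (-b)) * (N * Real.exp (ρ * r) * ((r - q) ^ β * q ^ (-β))) +
          (κ * ((r - q) ^ θ * (t - r) ^ (-b - θ))) * (N * Real.exp (ρ * r)) := by
        gcongr
        · exact hU _ htq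
        · exact hg.sub_le q r (by linarith) h2 (by linarith)
        · exact hU' _ _ htr hrq.le
        · exact hg.norm_le r (by linarith) (by linarith)
      _ ≤ (κ * (t - r) ^ (-b)) * (N * Real.exp (ρ * r) * ((r - q) ^ β * (q - a) ^ (-β))) +
          (κ * ((r - q) ^ θ * (t - r) ^ (-b - θ))) * (N * Real.exp (ρ * r)) := by
        gcongr
      _ = _ := by
        rw [expWeight, sub_eq_add_neg (-b), Real.rpow_add htr]
        ring

/-- The relations between the exponents: `α` is the order of the Weyl derivative, `β` and `θ` are
the Hölder exponents of the integrand, `γ` that of the integrator, and `κ` is the loss of regularity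
in the estimates. -/
structure AdmissibleExponents (α β γ κ θ : ℝ) : Prop where
  α_pos : 0 < α
  α_lt_θ : α < θ
  θ_lt_one : θ < 1
  α_lt_β : α < β
  β_lt_one : β < 1
  κ_pos : 0 < κ
  κ_le_one : κ ≤ 1
  one_lt : 1 < α + γ
  sum_lt : β + θ < α + γ - κ

/-- The convolution `∫_0^t S(t-r) g(r) dw(r)`. -/
def convolution (S : ℝ → V →L[ℝ] V) (α : ℝ) (w : ℝ → V) (g : ℝ → HS e) (t : ℝ) : V :=
  fracIntegral α (fun r => HS.lcomp (S (t - r)) (g r)) w 0 t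

variable {S : ℝ → V →L[ℝ] V} {α β γ κ θ : ℝ}

theorem IsRegularSemigroup.kernelBound (hS : IsRegularSemigroup S)
    (he : AdmissibleExponents α β γ κ θ) {ρ N T a t : ℝ} {g : ℝ → HS e}
    (hg : WeightedHolder β ρ N T g) (ha : 0 ≤ a) (hat : a < t) (htT : t ≤ T) :
    KernelBound θ β (expWeight (2 * N) ρ 0 t) a t (fun r => HS.lcomp (S (t - r)) (g r)) := by
  have h1 := he.α_pos
  have h2 := he.α_lt_θ
  have h3 := he.α_lt_β
  refine hg.kernelBound (by norm_num) le_rfl (by linarith) (fun τ hτ => ?_)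
    (fun τ k hτ hk => ?_) ha hat htT
  · simpa using (hS.norm_le τ hτ.le).trans (by norm_num)
  · simpa using hS.norm_sub_le (by linarith) he.θ_lt_one.le hτ hk

theorem IsRegularSemigroup.fracIntegrable_and_norm_le (hS : IsRegularSemigroup S)
    (he : AdmissibleExponents α β γ κ θ) {ρ N T a t C : ℝ} {g : ℝ → HS e} {w : ℝ → V}
    (hg : WeightedHolder β ρ N T g) (hρ : 0 < ρ) (hw : HolderBound γ C 0 (T + 1) w)
    (hwc : Continuous w) (ha : 0 ≤ a) (hat : a < t) (htT : t ≤ T) :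
    FracIntegrable α (fun r => HS.lcomp (S (t - r)) (g r)) w a t ∧
      ‖fracIntegral α (fun r => HS.lcomp (S (t - r)) (g r)) w a t‖ ≤
        fracConst α θ β γ κ 0 * (C * (2 * N)) * ρ ^ (-κ) * Real.exp (ρ * t) *
          (t - a) ^ (γ - κ) := by
  have h1 := he.sum_lt
  have h2 := he.α_lt_β
  have h3 := he.α_pos
  have := (hS.kernelBound he hg ha hat htT).fracIntegrable_and_norm_le
    (hw.mono ha (by linarith)) hwc hat h3 he.α_lt_θ h2 he.β_lt_one he.one_lt he.κ_pos.le
    he.κ_le_one (by linarith) hρ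
  simpa using this

/-- Additivity at s, combined with S(t-r) = S(t-s) S(s-r) for r < s; the bounded operator S(t-s)
then leaves the integral. -/
theorem IsRegularSemigroup.convolution_eq_add (hS : IsRegularSemigroup S)
    (he : AdmissibleExponents α β γ κ θ) {ρ N T s t C : ℝ} {g : ℝ → HS e} {w : ℝ → V}
    (hg : WeightedHolder β ρ N T g) (hρ : 0 < ρ) (hw : HolderBound γ C 0 (T + 1) w)
    (hwc : Continuous w) (hs : 0 < s) (hst : s < t) (htT : t ≤ T) :
    convolution S α w g t = S (t - s) (convolution S α w g s) +
      fracIntegral α (fun r => HS.lcomp (S (t - r)) (g r)) w s t := by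
  have hN := hg.nonneg (by linarith)
  have h3 := he.α_pos
  have h4 := he.α_lt_θ
  have hk := hS.kernelBound he hg le_rfl (hs.trans hst) htT
  -- Additivity is available for constant weights; with b = 0 the weight is bounded by its value at
  -- T.
  have hk' : KernelBound θ β (fun _ => 2 * N * Real.exp (ρ * T)) 0 t
      (fun r => HS.lcomp (S (t - r)) (g r)) := by
    have hle : ∀ r, r < t → expWeight (2 * N) ρ 0 t r ≤ 2 * N * Real.exp (ρ * T) := by
      intro r hr
      rw [expWeight, neg_zero, Real.rpow_zero, mul_one]
      gcongr
      linarith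
    constructor
    · intro r h1 h2
      exact (hk.norm_le r h1 h2).trans (hle r h2)
    · intro q r h1 h2 h3
      refine (hk.sub_le q r h1 h2 h3).trans ?_
      have := Real.rpow_nonneg (sub_pos.2 h2).le θ
      have := Real.rpow_nonneg (sub_pos.2 h2).le β
      have := Real.rpow_nonneg (sub_pos.2 h3).le (-θ)
      have := Real.rpow_nonneg (sub_pos.2 h1).le (-β)
      gcongr
      exact hle r h3
  have hadd := hk'.fracIntegral_add (hw.mono le_rfl (by linarith)) hwc h3 h4 he.θ_lt_one
    he.α_lt_β he.β_lt_one he.one_lt hs hst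
  have hf := (hS.fracIntegrable_and_norm_le he hg hρ hw hwc le_rfl hs (hst.le.trans htT)).1
  rw [convolution, hadd, convolution, ← fracIntegral_lcomp hs.le _ hf]
  congr 1
  refine fracIntegral_congr hs.le fun r hr => ?_
  rw [show t - r = (t - s) + (s - r) by ring,
    hS.add _ _ (sub_pos.2 hst).le (sub_pos.2 hr.2).le]
  rfl

/-- Moving S(h) - 1 under the integral gives the kernel (S(h) - 1)S(s-r), of size h^β (s-r)^{-β}.
Here b = β, and the full condition β + θ < α + γ - κ is used. -/
theorem IsRegularSemigroup.norm_sub_convolution_le (hS : IsRegularSemigroup S)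
    (he : AdmissibleExponents α β γ κ θ) {ρ N T s h C : ℝ} {g : ℝ → HS e} {w : ℝ → V}
    (hg : WeightedHolder β ρ N T g) (hρ : 0 < ρ) (hw : HolderBound γ C 0 (T + 1) w)
    (hwc : Continuous w) (hs : 0 < s) (hsT : s ≤ T) (hh : 0 ≤ h) :
    ‖S h (convolution S α w g s) - convolution S α w g s‖ ≤
      fracConst α θ β γ κ β * (C * (16 * h ^ β * N)) * ρ ^ (-κ) * Real.exp (ρ * s) *
        s ^ (γ - κ - β) := by
  have h1 := he.sum_lt
  have h2 := he.α_lt_β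
  have h3 := he.α_pos
  have h4 := he.α_lt_θ
  have hβ1 := he.β_lt_one
  set B := S h - ContinuousLinearMap.id ℝ V with hB
  have hf := (hS.fracIntegrable_and_norm_le he hg hρ hw hwc le_rfl hs hsT).1
  have e1 : S h (convolution S α w g s) - convolution S α w g s =
      fracIntegral α (fun r => HS.lcomp (B.comp (S (s - r))) (g r)) w 0 s := by
    have := fracIntegral_lcomp hs.le B hf
    rw [hB, _root_.sub_apply, ContinuousLinearMap.id_apply] at this
    exact this.symm
  rw [e1]
  have hk := hg.kernelBound (θ := θ) (b := β) (κ := 16 * h ^ β) (U := fun τ => B.comp (S τ))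
    (a := 0) (t := s) (by positivity) (by linarith) (by linarith)
    (fun τ hτ => by
      have e2 : B.comp (S τ) = S (τ + h) - S τ := by
        rw [add_comm, hS.add _ _ hh hτ.le, hB, ContinuousLinearMap.sub_comp,
          ContinuousLinearMap.id_comp]
      rw [e2]
      refine (hS.norm_sub_le (θ := β) (by linarith) hβ1.le hτ hh).trans ?_
      have p1 := Real.rpow_nonneg hh β
      have p2 := Real.rpow_nonneg hτ.le (-β)
      have : 0 ≤ h ^ β * τ ^ (-β) := by positivity
      nlinarith)
    (fun τ k hτ hk => by
      rw [← ContinuousLinearMap.comp_sub]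
      exact hS.norm_second_difference_le (by linarith) hβ1.le (by linarith) he.θ_lt_one.le hτ hh hk)
    le_rfl hs hsT
  have := (hk.fracIntegrable_and_norm_le (hw.mono le_rfl (by linarith)) hwc hs h3 h4 h2 hβ1
    he.one_lt he.κ_pos.le he.κ_le_one h1 hρ).2
  rwa [sub_zero] at this

/-- The constant in the estimate of the convolution. -/
def convConst (α β γ κ θ C T : ℝ) : ℝ :=
  C * (2 * fracConst α θ β γ κ 0 + 16 * fracConst α θ β γ κ β) * T ^ (γ - κ)

theorem AdmissibleExponents.convConst_nonneg (he : AdmissibleExponents α β γ κ θ) {C T : ℝ}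
    (hC : 0 ≤ C) (hT : 0 ≤ T) : 0 ≤ convConst α β γ κ θ C T := by
  have h1 := fracConst_nonneg (β := β) κ 0 he.α_pos (he.α_lt_β.trans he.β_lt_one) he.α_lt_θ
    he.one_lt
  have h2 := fracConst_nonneg (β := β) κ β he.α_pos (he.α_lt_β.trans he.β_lt_one) he.α_lt_θ
    he.one_lt
  unfold convConst
  positivity

/-- An increment equals (S(t-s) - 1) applied to the convolution at s, plus the integral over [s, t].
The former is of order (t-s)^β s^{γ-κ-β}, the latter of order (t-s)^{γ-κ}; both carry ρ^{-κ}, so the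
operator is small for large ρ. -/
theorem IsRegularSemigroup.weightedHolder_convolution (hS : IsRegularSemigroup S)
    (he : AdmissibleExponents α β γ κ θ) {ρ N T C : ℝ} {g : ℝ → HS e} {w : ℝ → V}
    (hg : WeightedHolder β ρ N T g) (hρ : 0 < ρ) (hT : 0 < T) (hw : HolderBound γ C 0 (T + 1) w)
    (hwc : Continuous w) :
    WeightedHolder β ρ (convConst α β γ κ θ C T * ρ ^ (-κ) * N) T (convolution S α w g) := by
  have hN := hg.nonneg hT
  have hC := hw.nonneg (by linarith)
  have h1 := he.sum_lt
  have h2 := he.α_lt_β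
  have h3 := he.α_pos
  have h4 := he.α_lt_θ
  have c0 := fracConst_nonneg (β := β) κ 0 he.α_pos (he.α_lt_β.trans he.β_lt_one) he.α_lt_θ
    he.one_lt
  have c1 := fracConst_nonneg (β := β) κ β he.α_pos (he.α_lt_β.trans he.β_lt_one) he.α_lt_θ
    he.one_lt
  have pρ := Real.rpow_nonneg hρ.le (-κ)
  set c := fracConst α θ β γ κ 0 with hc
  set d := fracConst α θ β γ κ β with hd
  have hγκ : 0 ≤ γ - κ := by linarith
  have hγκβ : 0 ≤ γ - κ - β := by linarith
  constructor
  · intro t ht htT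
    have hb := (hS.fracIntegrable_and_norm_le he hg hρ hw hwc le_rfl ht htT).2
    rw [sub_zero] at hb
    refine hb.trans ?_
    rw [convConst, ← hc, ← hd]
    calc _ ≤ c * (C * (2 * N)) * ρ ^ (-κ) * Real.exp (ρ * t) * T ^ (γ - κ) := by gcongr
      _ = C * (2 * c + 16 * 0) * T ^ (γ - κ) * ρ ^ (-κ) * N * Real.exp (ρ * t) := by ring
      _ ≤ _ := by gcongr
  · intro s t hs hst htT
    have hts : 0 < t - s := sub_pos.2 hst
    have b1 := (hS.fracIntegrable_and_norm_le he hg hρ hw hwc hs.le hst htT).2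
    have b2 := hS.norm_sub_convolution_le he hg hρ hw hwc hs (hst.le.trans htT) hts.le
    rw [← hc] at b1
    rw [← hd] at b2
    rw [hS.convolution_eq_add he hg hρ hw hwc hs hst htT, add_sub_right_comm]
    refine (norm_add_le _ _).trans ((add_le_add b2 b1).trans ?_)
    have q1 := Real.rpow_nonneg hts.le β
    have q2 := Real.rpow_nonneg hs.le (-β)
    -- Split off (t-s)^β, bound the remaining positive power of t-s by that of T, and insert (T/s)^β
    -- ≥ 1.
    have i1 : (t - s) ^ (γ - κ) ≤ T ^ (γ - κ) * ((t - s) ^ β * s ^ (-β)) := by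
      have j1 : (t - s) ^ (γ - κ - β) ≤ T ^ (γ - κ - β) := by
        gcongr
        linarith
      have j2 : 1 ≤ T ^ β * s ^ (-β) := by
        rw [Real.rpow_neg hs.le, ← div_eq_mul_inv, one_le_div (Real.rpow_pos_of_pos hs _)]
        have : s ≤ T := by linarith
        have : 0 ≤ β := by linarith
        gcongr
      calc (t - s) ^ (γ - κ) = (t - s) ^ (γ - κ - β) * (t - s) ^ β * 1 := by
            rw [← Real.rpow_add hts, mul_one]; congr 1; ring
        _ ≤ T ^ (γ - κ - β) * (t - s) ^ β * (T ^ β * s ^ (-β)) := by gcongr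
        _ = (T ^ (γ - κ - β) * T ^ β) * ((t - s) ^ β * s ^ (-β)) := by ring
        _ = _ := by rw [← Real.rpow_add hT, sub_add_cancel]
    have i2 : s ^ (γ - κ - β) ≤ T ^ (γ - κ) * s ^ (-β) := by
      have : s ≤ T := by linarith
      rw [sub_eq_add_neg, Real.rpow_add hs]
      gcongr
    have i3 : Real.exp (ρ * s) ≤ Real.exp (ρ * t) := by gcongr
    rw [convConst, ← hc, ← hd]
    calc _ ≤ d * (C * (16 * (t - s) ^ β * N)) * ρ ^ (-κ) * Real.exp (ρ * t) *
          (T ^ (γ - κ) * s ^ (-β)) +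
          c * (C * (2 * N)) * ρ ^ (-κ) * Real.exp (ρ * t) *
            (T ^ (γ - κ) * ((t - s) ^ β * s ^ (-β))) := by gcongr
      _ = _ := by ring

theorem IsRegularSemigroup.convolution_sub (hS : IsRegularSemigroup S)
    (he : AdmissibleExponents α β γ κ θ) {ρ N N' T t C : ℝ} {g g' : ℝ → HS e} {w : ℝ → V}
    (hg : WeightedHolder β ρ N T g) (hg' : WeightedHolder β ρ N' T g') (hρ : 0 < ρ)
    (hw : HolderBound γ C 0 (T + 1) w) (hwc : Continuous w) (ht : 0 < t) (htT : t ≤ T) :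
    convolution S α w (fun r => g r - g' r) t =
      convolution S α w g t - convolution S α w g' t := by
  unfold convolution
  rw [← fracIntegral_sub ht.le
    (hS.fracIntegrable_and_norm_le he hg hρ hw hwc le_rfl ht htT).1
    (hS.fracIntegrable_and_norm_le he hg' hρ hw hwc le_rfl ht htT).1]
  congr 1
  ext1 r
  simp only [← HS.lcompL_apply, map_sub]

/-- For general x the orbit is only continuous at zero. Smoothing gives order β afterwards at the
price of s^{-β}, which is why the solution space carries this weight. -/
theorem IsRegularSemigroup.weightedHolder_apply (hS : IsRegularSemigroup S) (hβ : 0 ≤ β)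
    (hβ1 : β ≤ 1) {ρ T : ℝ} (hρ : 0 ≤ ρ) (x : V) :
    WeightedHolder β ρ (2 * ‖x‖) T (fun t => S t x) := by
  have hexp : ∀ t, 0 < t → 1 ≤ Real.exp (ρ * t) := fun t ht =>
    Real.one_le_exp (by positivity)
  constructor
  · intro t ht _
    calc _ ≤ 1 * ‖x‖ := (S t).le_of_opNorm_le (hS.norm_le t ht.le) x
      _ ≤ 2 * ‖x‖ * 1 := by nlinarith [norm_nonneg x]
      _ ≤ _ := by gcongr; exact hexp t ht
  · intro s t hs hst _
    have h1 := hS.norm_sub_le hβ hβ1 hs (sub_pos.2 hst).le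
    rw [add_sub_cancel] at h1
    have h2 := (S t - S s).le_of_opNorm_le h1 x
    have := Real.rpow_nonneg (sub_pos.2 hst).le β
    have := Real.rpow_nonneg hs.le (-β)
    calc _ ≤ 2 * ((t - s) ^ β * s ^ (-β)) * ‖x‖ := h2
      _ = 2 * ‖x‖ * 1 * ((t - s) ^ β * s ^ (-β)) := by ring
      _ ≤ _ := by gcongr; exact hexp t (hs.trans hst)

end Convolution

/-! ### The nonlinearity -/

section Nonlinearity

variable {V E : Type*} [NormedAddCommGroup V] [NormedSpace ℝ V] [NormedAddCommGroup E]
  [NormedSpace ℝ E]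

/-- Differentiability with `L`-bounded and `L'`-Lipschitz derivative. -/
structure SmoothBounds (G : V → E) (L L' : ℝ) : Prop where
  differentiable : Differentiable ℝ G
  norm_fderiv_le : ∀ x, ‖fderiv ℝ G x‖ ≤ L
  norm_fderiv_sub_le : ∀ x y, ‖fderiv ℝ G x - fderiv ℝ G y‖ ≤ L' * ‖x - y‖

theorem smoothBounds_of_contDiff {G : V → E} (hG : ContDiff ℝ 2 G) {L L' : ℝ}
    (h1 : ∀ u, ‖fderiv ℝ G u‖ ≤ L) (h2 : ∀ u, ‖fderiv ℝ (fderiv ℝ G) u‖ ≤ L') :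
    SmoothBounds G L L' where
  differentiable := hG.differentiable (by norm_num)
  norm_fderiv_le := h1
  norm_fderiv_sub_le x y := by
    have hd : Differentiable ℝ (fderiv ℝ G) :=
      (hG.fderiv_right (m := 1) (by norm_num)).differentiable (by norm_num)
    exact convex_univ.norm_image_sub_le_of_norm_fderiv_le (fun z _ => hd z) (fun z _ => h2 z)
      (mem_univ y) (mem_univ x)

variable {G : V → E} {L L' : ℝ}

theorem SmoothBounds.nonneg (h : SmoothBounds G L L') : 0 ≤ L :=
  (norm_nonneg _).trans (h.norm_fderiv_le 0)

theorem SmoothBounds.norm_sub_le (h : SmoothBounds G L L') (x y : V) :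
    ‖G x - G y‖ ≤ L * ‖x - y‖ :=
  convex_univ.norm_image_sub_le_of_norm_fderiv_le (fun z _ => h.differentiable z)
    (fun z _ => h.norm_fderiv_le z) (mem_univ y) (mem_univ x)

/-- Differentiate along the segments from y to x and from y' to x'. Comparing the two derivatives
uses the Lipschitz bound of DG; a Lipschitz bound on G alone would not control differences of
compositions in a Hölder norm. -/
theorem SmoothBounds.norm_second_difference_le (h : SmoothBounds G L L') (hL' : 0 ≤ L')
    (x y x' y' : V) :
    ‖(G x - G y) - (G x' - G y')‖ ≤
      L * ‖(x - y) - (x' - y')‖ + L' * (‖x - x'‖ + ‖y - y'‖) * ‖x' - y'‖ := by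
  have hd : ∀ (a b : V) (s : ℝ), HasDerivAt (fun s : ℝ => G (b + s • (a - b)))
      (fderiv ℝ G (b + s • (a - b)) (a - b)) s := by
    intro a b s
    have h1 : HasDerivAt (fun s : ℝ => b + s • (a - b)) (a - b) s := by
      simpa using ((hasDerivAt_id s).smul_const (a - b)).const_add b
    exact (h.differentiable _).hasFDerivAt.comp_hasDerivAt s h1
  have key := norm_image_sub_le_of_norm_deriv_le_segment_01'
    (f := fun s : ℝ => G (y + s • (x - y)) - G (y' + s • (x' - y')))
    (C := L * ‖(x - y) - (x' - y')‖ + L' * (‖x - x'‖ + ‖y - y'‖) * ‖x' - y'‖)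
    (fun s _ => ((hd x y s).sub (hd x' y' s)).hasDerivWithinAt) (fun s hs => ?_)
  · simpa [sub_sub_sub_comm] using key
  · set p := y + s • (x - y)
    set p' := y' + s • (x' - y')
    have e1 : fderiv ℝ G p (x - y) - fderiv ℝ G p' (x' - y') =
        fderiv ℝ G p ((x - y) - (x' - y')) + (fderiv ℝ G p - fderiv ℝ G p') (x' - y') := by
      simp only [map_sub, _root_.sub_apply]
      abel
    have e2 : ‖p - p'‖ ≤ ‖x - x'‖ + ‖y - y'‖ := by
      have : p - p' = s • (x - x') + (1 - s) • (y - y') := by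
        simp only [p, p']
        module
      rw [this]
      refine (norm_add_le _ _).trans ?_
      rw [norm_smul, norm_smul, Real.norm_of_nonneg hs.1, Real.norm_of_nonneg (by linarith [hs.2])]
      nlinarith [norm_nonneg (x - x'), norm_nonneg (y - y'), hs.1, hs.2]
    rw [e1]
    refine (norm_add_le _ _).trans (add_le_add ?_ ?_)
    · exact (fderiv ℝ G p).le_of_opNorm_le (h.norm_fderiv_le p) _
    · refine ((fderiv ℝ G p - fderiv ℝ G p').le_opNorm _).trans ?_
      gcongr
      exact (h.norm_fderiv_sub_le p p').trans (by gcongr)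

theorem SmoothBounds.weightedHolder_comp (h : SmoothBounds G L L') {β ρ N T : ℝ} {u : ℝ → V}
    (hρ : 0 ≤ ρ) (hu : WeightedHolder β ρ N T u) :
    WeightedHolder β ρ (‖G 0‖ + L * N) T (fun t => G (u t)) := by
  have hL := h.nonneg
  constructor
  · intro t ht htT
    have h1 := h.norm_sub_le (u t) 0
    rw [sub_zero] at h1
    have h2 := hu.norm_le t ht htT
    have h3 : 1 ≤ Real.exp (ρ * t) := Real.one_le_exp (by positivity)
    calc ‖G (u t)‖ = ‖G 0 + (G (u t) - G 0)‖ := by rw [add_sub_cancel]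
      _ ≤ ‖G 0‖ * 1 + L * (N * Real.exp (ρ * t)) := by
        refine (norm_add_le _ _).trans ?_
        rw [mul_one]
        gcongr
        exact h1.trans (by gcongr)
      _ ≤ ‖G 0‖ * Real.exp (ρ * t) + L * (N * Real.exp (ρ * t)) := by gcongr
      _ = _ := by ring
  · intro s t hs hst htT
    have h1 := h.norm_sub_le (u t) (u s)
    have h2 := hu.sub_le s t hs hst htT
    have := Real.rpow_nonneg (sub_pos.2 hst).le β
    have := Real.rpow_nonneg hs.le (-β)
    calc _ ≤ L * (N * Real.exp (ρ * t) * ((t - s) ^ β * s ^ (-β))) := h1.trans (by gcongr)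
      _ = (0 + L * N) * Real.exp (ρ * t) * ((t - s) ^ β * s ^ (-β)) := by ring
      _ ≤ _ := by gcongr; positivity

/-- Only the difference u - v carries the exponential weight; u and v lie in an unweighted ball of
radius R. The resulting factor is free of ρ, so ρ can be chosen after R. -/
theorem SmoothBounds.weightedHolder_comp_sub (h : SmoothBounds G L L') (hL' : 0 ≤ L')
    {β ρ R N T : ℝ} {u v : ℝ → V} (hT : 0 < T) (hρ : 0 ≤ ρ)
    (hu : WeightedHolder β 0 R T u) (hv : WeightedHolder β 0 R T v)
    (huv : WeightedHolder β ρ N T (fun t => u t - v t)) :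
    WeightedHolder β ρ ((L + 2 * L' * R) * N) T (fun t => G (u t) - G (v t)) := by
  have hL := h.nonneg
  have hR := hu.nonneg hT
  have hN := huv.nonneg hT
  constructor
  · intro t ht htT
    have h1 := h.norm_sub_le (u t) (v t)
    have h2 := huv.norm_le t ht htT
    calc _ ≤ L * (N * Real.exp (ρ * t)) := h1.trans (by gcongr)
      _ = (L + 0) * N * Real.exp (ρ * t) := by ring
      _ ≤ _ := by gcongr; positivity
  · intro s t hs hst htT
    have h1 := h.norm_second_difference_le hL' (u t) (v t) (u s) (v s)
    have h2 := huv.sub_le s t hs hst htT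
    have h3 := hu.sub_le s t hs hst htT
    have h4 := hv.sub_le s t hs hst htT
    have h5 := huv.norm_le s hs (hst.le.trans htT)
    rw [zero_mul, Real.exp_zero, mul_one] at h3 h4
    have p1 := Real.rpow_nonneg (sub_pos.2 hst).le β
    have p2 := Real.rpow_nonneg hs.le (-β)
    have h6 : Real.exp (ρ * s) ≤ Real.exp (ρ * t) := by gcongr
    calc _ ≤ L * (N * Real.exp (ρ * t) * ((t - s) ^ β * s ^ (-β))) +
          L' * (R * ((t - s) ^ β * s ^ (-β)) + R * ((t - s) ^ β * s ^ (-β))) *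
            (N * Real.exp (ρ * t)) := by
          refine h1.trans ?_
          gcongr
          exact h5.trans (by gcongr)
      _ = _ := by ring

end Nonlinearity

/-! ### Limits and sums of weighted Hölder functions -/

section WeightedHolder

variable {E : Type*} [NormedAddCommGroup E] {β ρ N N' T : ℝ} {u v : ℝ → E}

theorem WeightedHolder.congr (h : WeightedHolder β ρ N T u) (huv : ∀ t, 0 < t → t ≤ T → v t = u t) :
    WeightedHolder β ρ N T v where
  norm_le t h1 h2 := by
    rw [huv t h1 h2]
    exact h.norm_le t h1 h2
  sub_le s t h1 h2 h3 := by
    rw [huv t (h1.trans h2) h3, huv s h1 (h2.le.trans h3)]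
    exact h.sub_le s t h1 h2 h3

theorem WeightedHolder.add (h : WeightedHolder β ρ N T u) (h' : WeightedHolder β ρ N' T v) :
    WeightedHolder β ρ (N + N') T (fun t => u t + v t) where
  norm_le t h1 h2 := by
    refine (norm_add_le _ _).trans ((add_le_add (h.norm_le t h1 h2) (h'.norm_le t h1 h2)).trans ?_)
    exact le_of_eq (by ring)
  sub_le s t h1 h2 h3 := by
    rw [add_sub_add_comm]
    refine (norm_add_le _ _).trans
      ((add_le_add (h.sub_le s t h1 h2 h3) (h'.sub_le s t h1 h2 h3)).trans ?_)
    exact le_of_eq (by ring)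

theorem WeightedHolder.neg (h : WeightedHolder β ρ N T u) :
    WeightedHolder β ρ N T (fun t => -u t) where
  norm_le t h1 h2 := by
    rw [norm_neg]
    exact h.norm_le t h1 h2
  sub_le s t h1 h2 h3 := by
    rw [← neg_add', norm_neg, ← sub_eq_add_neg]
    exact h.sub_le s t h1 h2 h3

theorem WeightedHolder.sub (h : WeightedHolder β ρ N T u) (h' : WeightedHolder β ρ N' T v) :
    WeightedHolder β ρ (N + N') T (fun t => u t - v t) := by
  simpa only [sub_eq_add_neg] using h.add h'.neg

theorem weightedHolder_zero (hN : 0 ≤ N) : WeightedHolder β ρ N T (fun _ => (0 : E)) where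
  norm_le t h1 h2 := by
    rw [norm_zero]
    positivity
  sub_le s t h1 h2 h3 := by
    have := Real.rpow_nonneg (sub_pos.2 h2).le β
    have := Real.rpow_nonneg h1.le (-β)
    rw [sub_zero, norm_zero]
    positivity

theorem WeightedHolder.of_tendsto {f : ℕ → ℝ → E}
    (h : ∀ᶠ n in atTop, WeightedHolder β ρ N T (f n))
    (hlim : ∀ t, 0 < t → t ≤ T → Tendsto (fun n => f n t) atTop (𝓝 (u t))) :
    WeightedHolder β ρ N T u where
  norm_le t h1 h2 := le_of_tendsto (hlim t h1 h2).norm (h.mono fun _ hn => hn.norm_le t h1 h2)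
  sub_le s t h1 h2 h3 := le_of_tendsto
    ((hlim t (h1.trans h2) h3).sub (hlim s h1 (h2.le.trans h3))).norm
    (h.mono fun _ hn => hn.sub_le s t h1 h2 h3)

theorem WeightedHolder.continuousOn (h : WeightedHolder β ρ N T u) (hβ : 0 < β) (hρ : 0 ≤ ρ) :
    ContinuousOn u (Ioc 0 T) := by
  intro t ht
  have hN := h.nonneg (ht.1.trans_le ht.2)
  have hbd : ∀ s, t / 2 < s → s ≤ T →
      ‖u s - u t‖ ≤ N * Real.exp (ρ * T) * (|s - t| ^ β * (t / 2) ^ (-β)) := by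
    have key : ∀ p q, t / 2 ≤ p → p < q → q ≤ T →
        ‖u q - u p‖ ≤ N * Real.exp (ρ * T) * ((q - p) ^ β * (t / 2) ^ (-β)) := by
      intro p q h1 h2 h3
      have ht2 : 0 < t / 2 := half_pos ht.1
      refine (h.sub_le p q (ht2.trans_le h1) h2 h3).trans ?_
      have p1 := Real.rpow_nonneg (sub_pos.2 h2).le β
      have p2 : p ^ (-β) ≤ (t / 2) ^ (-β) := Real.rpow_le_rpow_of_nonpos ht2 h1 (by linarith)
      have p3 := Real.rpow_nonneg (ht2.trans_le h1).le (-β)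
      gcongr
    intro s hs hsT
    rcases lt_trichotomy s t with h1 | h1 | h1
    · rw [norm_sub_rev, abs_sub_comm, abs_of_pos (sub_pos.2 h1)]
      exact key s t hs.le h1 ht.2
    · rw [h1, sub_self, sub_self, norm_zero, abs_zero]
      have := Real.rpow_nonneg (half_pos ht.1).le (-β)
      positivity
    · rw [abs_of_pos (sub_pos.2 h1)]
      exact key t s (by linarith [ht.1]) h1 hsT
  rw [ContinuousWithinAt, tendsto_iff_norm_sub_tendsto_zero]
  have hlim : Tendsto (fun s => N * Real.exp (ρ * T) * (|s - t| ^ β * (t / 2) ^ (-β)))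
      (𝓝[Ioc 0 T] t) (𝓝 0) := by
    have h1 : ContinuousAt (fun s => N * Real.exp (ρ * T) * (|s - t| ^ β * (t / 2) ^ (-β))) t := by
      refine continuousAt_const.mul (ContinuousAt.mul ?_ continuousAt_const)
      exact ContinuousAt.rpow_const (by fun_prop) (Or.inr hβ.le)
    have h2 := h1.tendsto.mono_left (nhdsWithin_le_nhds (s := Ioc 0 T))
    simpa [Real.zero_rpow hβ.ne'] using h2
  refine squeeze_zero' (Eventually.of_forall fun _ => norm_nonneg _) ?_ hlim
  filter_upwards [self_mem_nhdsWithin,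
    nhdsWithin_le_nhds (Ioi_mem_nhds (show t / 2 < t by linarith [ht.1]))] with s hs hs2
  exact hbd s hs2 hs.2

end WeightedHolder

/-! ### Existence and uniqueness of mild solutions -/

section MildSolutions

variable {V : Type*} [NormedAddCommGroup V] [InnerProductSpace ℝ V] [CompleteSpace V]
  {e : HilbertBasis ℕ ℝ V} {S : ℝ → V →L[ℝ] V} {G : V → HS e} {α β γ κ θ L L' : ℝ} {w : ℝ → V}
  {u₀ : V}

theorem fracIntegrable_self (K : ℝ → HS e) (w : ℝ → V) (a : ℝ) : FracIntegrable α K w a a := by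
  refine ⟨?_, IntervalIntegrable.refl, IntervalIntegrable.refl⟩
  simp

theorem convolution_zero (g : ℝ → HS e) : convolution S α w g 0 = 0 := by
  simp [convolution, fracIntegral]

theorem exists_pos_mul_rpow_neg_le (c : ℝ) {κ : ℝ} (hκ : 0 < κ) :
    ∃ ρ : ℝ, 0 < ρ ∧ c * ρ ^ (-κ) ≤ 1 / 2 := by
  have h1 : Tendsto (fun ρ : ℝ => c * ρ ^ (-κ)) atTop (𝓝 0) := by
    simpa using (tendsto_rpow_neg_atTop hκ).const_mul c
  have h2 := (h1.eventually (gt_mem_nhds (show (0 : ℝ) < 1 / 2 by norm_num))).and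
    (eventually_gt_atTop 0)
  obtain ⟨ρ, h3, h4⟩ := h2.exists
  exact ⟨ρ, h4, h3.le⟩

/-- Away from zero the Hölder bound gives continuity. At zero S(t)u₀ → u₀ and the convolution is of
order t^{γ-κ}. -/
theorem isMildSolution_of_weightedHolder (hS : IsRegularSemigroup S)
    (he : AdmissibleExponents α β γ κ θ) (hG : SmoothBounds G L L') {T R C : ℝ}
    (hT : 0 < T) (hw : HolderBound γ C 0 (T + 1) w) (hwc : Continuous w) {u : ℝ → V}
    (hu : WeightedHolder β 0 R T u) (hu0 : u 0 = u₀)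
    (heq : ∀ t, 0 < t → t ≤ T → u t = S t u₀ + convolution S α w (fun r => G (u r)) t) :
    IsMildSolution S G α β w u₀ T u := by
  have hβ0 : 0 < β := he.α_pos.trans he.α_lt_β
  have hγκ : 0 < γ - κ := by linarith [he.sum_lt, he.α_lt_θ]
  -- The integral estimate asks for a positive exponential rate; any value serves here.
  have hg : WeightedHolder β 1 (‖G 0‖ + L * R) T (fun t => G (u t)) :=
    (hG.weightedHolder_comp le_rfl hu).mono hT zero_le_one le_rfl
  have hS0 : S 0 u₀ = u₀ := by rw [hS.zero]; rfl
  refine ⟨⟨?_, R, ?_⟩, ?_, ?_⟩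
  · intro t ht
    rcases ht.1.eq_or_lt with h0 | h0
    · subst h0
      rw [ContinuousWithinAt, tendsto_iff_norm_sub_tendsto_zero]
      have hlim : Tendsto (fun t => ‖S t u₀ - u₀‖ + fracConst α θ β γ κ 0 *
          (C * (2 * (‖G 0‖ + L * R))) * 1 ^ (-κ) * Real.exp (1 * t) * t ^ (γ - κ))
          (𝓝[Icc 0 T] 0) (𝓝 0) := by
        have h1 : Tendsto (fun t => ‖S t u₀ - u₀‖) (𝓝[Icc 0 T] 0) (𝓝 0) := by
          have h2 := (hS.continuousOn u₀) 0 self_mem_Ici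
          have h3 := (h2.mono fun x (hx : x ∈ Icc 0 T) => hx.1).tendsto
          rw [hS0] at h3
          exact tendsto_iff_norm_sub_tendsto_zero.1 h3
        have h2 : ContinuousAt (fun t => fracConst α θ β γ κ 0 *
            (C * (2 * (‖G 0‖ + L * R))) * 1 ^ (-κ) * Real.exp (1 * t) * t ^ (γ - κ)) 0 :=
          ContinuousAt.mul (by fun_prop)
            (ContinuousAt.rpow_const (by fun_prop) (Or.inr hγκ.le))
        have h3 := h2.tendsto.mono_left (nhdsWithin_le_nhds (s := Icc 0 T))
        simp only [Real.zero_rpow hγκ.ne', mul_zero] at h3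
        simpa using h1.add h3
      refine squeeze_zero' (Eventually.of_forall fun _ => norm_nonneg _) ?_ hlim
      filter_upwards [self_mem_nhdsWithin] with t ht
      rcases ht.1.eq_or_lt with h0 | h0
      · subst h0
        simp [hS0, Real.zero_rpow hγκ.ne']
      · rw [hu0, heq t h0 ht.2, add_sub_right_comm]
        refine (norm_add_le _ _).trans (add_le_add le_rfl ?_)
        have := (hS.fracIntegrable_and_norm_le he hg one_pos hw hwc le_rfl h0 ht.2).2
        rwa [sub_zero] at this
    · have h1 := hu.continuousOn hβ0 le_rfl t ⟨h0, ht.2⟩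
      refine h1.mono_of_mem_nhdsWithin ?_
      filter_upwards [self_mem_nhdsWithin, nhdsWithin_le_nhds (Ioi_mem_nhds h0)] with s hs hs0
      exact ⟨hs0, hs.2⟩
  · intro s t hs hst htT
    have h1 := hu.sub_le s t hs hst htT
    rw [zero_mul, Real.exp_zero, mul_one] at h1
    have p1 : 0 < (t - s) ^ β := Real.rpow_pos_of_pos (sub_pos.2 hst) _
    have p2 : 0 < s ^ β := Real.rpow_pos_of_pos hs _
    rw [sub_zero]
    calc _ ≤ s ^ β * (R * ((t - s) ^ β * s ^ (-β)) / (t - s) ^ β) := by gcongr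
      _ = R := by
        rw [Real.rpow_neg hs.le]
        field_simp
  · intro t ht
    rcases ht.1.eq_or_lt with h0 | h0
    · subst h0
      exact fracIntegrable_self _ _ _
    · exact (hS.fracIntegrable_and_norm_le he hg one_pos hw hwc le_rfl h0 ht.2).1
  · intro t ht
    rcases ht.1.eq_or_lt with h0 | h0
    · subst h0
      rw [hS0, hu0]
      simp [fracIntegral]
    · exact heq t h0 ht.2

theorem IsMildSolution.exists_weightedHolder {T : ℝ} {u : ℝ → V}
    (hu : IsMildSolution S G α β w u₀ T u) : ∃ R, WeightedHolder β 0 R T u := by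
  obtain ⟨B, hB⟩ := isCompact_Icc.exists_bound_of_continuousOn hu.mem.1
  obtain ⟨C, hC⟩ := hu.mem.2
  refine ⟨max B C, ?_, ?_⟩
  · intro t h1 h2
    rw [zero_mul, Real.exp_zero, mul_one]
    exact (hB t ⟨h1.le, h2⟩).trans (le_max_left _ _)
  · intro s t h1 h2 h3
    have p1 : 0 < (t - s) ^ β := Real.rpow_pos_of_pos (sub_pos.2 h2) _
    have p2 : 0 < s ^ β := Real.rpow_pos_of_pos h1 _
    have h4 := hC s t h1 h2 h3
    rw [sub_zero] at h4
    rw [zero_mul, Real.exp_zero, mul_one, Real.rpow_neg h1.le]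
    calc ‖u t - u s‖ = s ^ β * (‖u t - u s‖ / (t - s) ^ β) * ((t - s) ^ β * (s ^ β)⁻¹) := by
          field_simp
      _ ≤ C * ((t - s) ^ β * (s ^ β)⁻¹) := by gcongr
      _ ≤ _ := by gcongr; exact le_max_right _ _

theorem IsMildSolution.eq_convolution {T : ℝ} {u : ℝ → V}
    (hu : IsMildSolution S G α β w u₀ T u) {t : ℝ} (h1 : 0 ≤ t) (h2 : t ≤ T) :
    u t = S t u₀ + convolution S α w (fun r => G (u r)) t :=
  hu.eq t ⟨h1, h2⟩

theorem weightedHolder_convolution_sub (hS : IsRegularSemigroup S)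
    (he : AdmissibleExponents α β γ κ θ) (hG : SmoothBounds G L L') (hL' : 0 ≤ L')
    {T C R ρ N : ℝ} (hT : 0 < T) (hw : HolderBound γ C 0 (T + 1) w) (hwc : Continuous w)
    (hρ : 0 < ρ) (hsmall : convConst α β γ κ θ C T * (L + 2 * L' * R) * ρ ^ (-κ) ≤ 1 / 2)
    {u v : ℝ → V} (hu : WeightedHolder β 0 R T u) (hv : WeightedHolder β 0 R T v)
    (huv : WeightedHolder β ρ N T (fun t => u t - v t)) :
    WeightedHolder β ρ (N / 2) T (fun t => convolution S α w (fun r => G (u r)) t -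
      convolution S α w (fun r => G (v r)) t) := by
  have hN := huv.nonneg hT
  have h1 := hG.weightedHolder_comp_sub hL' hT hρ.le hu hv huv
  have h2 := (hS.weightedHolder_convolution he h1 hρ hT hw hwc).mono hT le_rfl (N' := N / 2) (by
    calc _ = convConst α β γ κ θ C T * (L + 2 * L' * R) * ρ ^ (-κ) * N := by ring
      _ ≤ 1 / 2 * N := by gcongr
      _ = N / 2 := by ring)
  refine h2.congr fun t ht htT => ?_
  exact (hS.convolution_sub he ((hG.weightedHolder_comp le_rfl hu).mono hT hρ.le le_rfl)
    ((hG.weightedHolder_comp le_rfl hv).mono hT hρ.le le_rfl) hρ hw hwc ht htT).symm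

/-- Two solutions lie in a common unweighted ball. With ρ adapted to its radius, each use of the
equation halves the bound of their difference, which therefore vanishes. -/
theorem IsMildSolution.unique (hS : IsRegularSemigroup S)
    (he : AdmissibleExponents α β γ κ θ) (hG : SmoothBounds G L L') (hL' : 0 ≤ L')
    {T C : ℝ} (hT : 0 < T) (hw : HolderBound γ C 0 (T + 1) w) (hwc : Continuous w) {u v : ℝ → V}
    (hu : IsMildSolution S G α β w u₀ T u) (hv : IsMildSolution S G α β w u₀ T v) :
    ∀ t ∈ Icc 0 T, u t = v t := by
  obtain ⟨R₁, hR₁⟩ := hu.exists_weightedHolder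
  obtain ⟨R₂, hR₂⟩ := hv.exists_weightedHolder
  set R := max R₁ R₂ with hR
  have hu' : WeightedHolder β 0 R T u := hR₁.mono hT le_rfl (le_max_left _ _)
  have hv' : WeightedHolder β 0 R T v := hR₂.mono hT le_rfl (le_max_right _ _)
  obtain ⟨ρ, hρ, hsmall⟩ := exists_pos_mul_rpow_neg_le
    (convConst α β γ κ θ C T * (L + 2 * L' * R)) he.κ_pos
  have key : ∀ n : ℕ, WeightedHolder β ρ ((R + R) * (1 / 2) ^ n) T (fun t => u t - v t) := by
    intro n
    induction n with
    | zero => simpa using (hu'.sub hv').mono hT hρ.le le_rfl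
    | succ n ih =>
      have h := weightedHolder_convolution_sub hS he hG hL' hT hw hwc hρ hsmall hu' hv' ih
      have e1 : (R + R) * (1 / 2) ^ n / 2 = (R + R) * (1 / 2) ^ (n + 1) := by ring
      rw [e1] at h
      refine h.congr fun t h1 h2 => ?_
      rw [hu.eq_convolution h1.le h2, hv.eq_convolution h1.le h2, add_sub_add_left_eq_sub]
  intro t ht
  rcases ht.1.eq_or_lt with h0 | h0
  · subst h0
    rw [hu.eq_convolution le_rfl hT.le, hv.eq_convolution le_rfl hT.le, convolution_zero,
      convolution_zero]
  · rw [← sub_eq_zero, ← norm_le_zero_iff]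
    have hlim : Tendsto (fun n : ℕ => (R + R) * (1 / 2) ^ n * Real.exp (ρ * t)) atTop (𝓝 0) := by
      have := ((tendsto_pow_atTop_nhds_zero_of_lt_one (r := (1 / 2 : ℝ)) (by norm_num)
        (by norm_num)).const_mul (R + R)).mul_const (Real.exp (ρ * t))
      simpa using this
    exact ge_of_tendsto' hlim fun n => (key n).norm_le t h0 ht.2

/-- The Picard iterates of the mild equation, starting from zero. -/
def picard (S : ℝ → V →L[ℝ] V) (G : V → HS e) (α : ℝ) (w : ℝ → V) (u₀ : V) : ℕ → ℝ → V
  | 0 => fun _ => 0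
  | n + 1 => fun t => S t u₀ + convolution S α w (fun r => G (picard S G α w u₀ n r)) t

/-- G grows at most linearly, so a ρ that depends only on the first derivative bound keeps all
iterates in one weighted ball, hence in one unweighted ball. -/
theorem exists_weightedHolder_picard (hS : IsRegularSemigroup S)
    (he : AdmissibleExponents α β γ κ θ) (hG : SmoothBounds G L L')
    {T C : ℝ} (hT : 0 < T) (hw : HolderBound γ C 0 (T + 1) w) (hwc : Continuous w) (u₀ : V) :
    ∃ R, 0 ≤ R ∧ ∀ n, WeightedHolder β 0 R T (picard S G α w u₀ n) := by
  have hβ0 : 0 < β := he.α_pos.trans he.α_lt_β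
  have hL := hG.nonneg
  have hc := he.convConst_nonneg (hw.nonneg (by linarith)) hT.le
  obtain ⟨ρ, hρ, hsmall⟩ := exists_pos_mul_rpow_neg_le (convConst α β γ κ θ C T * L) he.κ_pos
  have pρ := Real.rpow_nonneg hρ.le (-κ)
  set Λ := convConst α β γ κ θ C T * ρ ^ (-κ) with hΛ
  -- With ΛL ≤ 1/2 this N satisfies 2‖u₀‖ + Λ(‖G 0‖ + LN) ≤ N, so the ball is invariant.
  set N := 2 * (2 * ‖u₀‖ + Λ * ‖G 0‖) with hN
  have hΛ0 : 0 ≤ Λ := by positivity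
  have hN0 : 0 ≤ N := by positivity
  have key : ∀ n, WeightedHolder β ρ N T (picard S G α w u₀ n) := by
    intro n
    induction n with
    | zero => exact weightedHolder_zero hN0
    | succ n ih =>
      have h1 := hS.weightedHolder_convolution he (hG.weightedHolder_comp hρ.le ih) hρ hT hw hwc
      have h2 := (hS.weightedHolder_apply hβ0.le he.β_lt_one.le hρ.le (T := T) u₀).add h1
      refine h2.mono hT le_rfl ?_
      rw [← hΛ]
      have h3 : Λ * L ≤ 1 / 2 := by
        calc _ = convConst α β γ κ θ C T * L * ρ ^ (-κ) := by rw [hΛ]; ring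
          _ ≤ _ := hsmall
      nlinarith
  exact ⟨N * Real.exp (ρ * T), by positivity, fun n => (key n).unweighted hT hρ.le⟩

/-- Two rates are used on each [0,T]: one confines the iterates to an unweighted ball of radius R,
the second, chosen after R, makes consecutive differences decay like 2^{-n}. The limit is pointwise
and does not depend on T, so one function solves the equation on every interval. -/
theorem exists_mildSolution_tendsto_picard (hS : IsRegularSemigroup S)
    (he : AdmissibleExponents α β γ κ θ) (hG : SmoothBounds G L L') (hL' : 0 ≤ L')
    (hw : ∀ T, 0 < T → ∃ C, HolderBound γ C 0 (T + 1) w) (hwc : Continuous w) (u₀ : V) :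
    ∃ u : ℝ → V, (∀ t, 0 ≤ t → Tendsto (fun n => picard S G α w u₀ n t) atTop (𝓝 (u t))) ∧
      ∀ T, 0 < T → IsMildSolution S G α β w u₀ T u := by
  set p := picard S G α w u₀ with hp
  have hcauchy : ∀ T, 0 < T → ∃ R ρ, 0 ≤ R ∧ 0 < ρ ∧ (∀ n, WeightedHolder β 0 R T (p n)) ∧
      (∀ n, WeightedHolder β ρ (R * (1 / 2) ^ n) T (fun t => p (n + 1) t - p n t)) ∧
      ∀ N (u v : ℝ → V), WeightedHolder β 0 R T u → WeightedHolder β 0 R T v →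
        WeightedHolder β ρ N T (fun t => u t - v t) →
        WeightedHolder β ρ (N / 2) T (fun t => convolution S α w (fun r => G (u r)) t -
          convolution S α w (fun r => G (v r)) t) := by
    intro T hT
    obtain ⟨C, hC⟩ := hw T hT
    obtain ⟨R, hR0, hR⟩ := exists_weightedHolder_picard hS he hG hT hC hwc u₀
    obtain ⟨ρ, hρ, hsmall⟩ := exists_pos_mul_rpow_neg_le
      (convConst α β γ κ θ C T * (L + 2 * L' * R)) he.κ_pos
    have hcontr : ∀ N (u v : ℝ → V), WeightedHolder β 0 R T u → WeightedHolder β 0 R T v →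
        WeightedHolder β ρ N T (fun t => u t - v t) →
        WeightedHolder β ρ (N / 2) T (fun t => convolution S α w (fun r => G (u r)) t -
          convolution S α w (fun r => G (v r)) t) := fun N u v hu hv huv =>
      weightedHolder_convolution_sub hS he hG hL' hT hC hwc hρ hsmall hu hv huv
    refine ⟨R, ρ, hR0, hρ, hR, fun n => ?_, hcontr⟩
    induction n with
    | zero =>
      have h1 := (hR 1).mono hT hρ.le le_rfl
      rw [pow_zero, mul_one]
      refine h1.congr fun t _ _ => ?_
      rw [zero_add]
      exact sub_zero _
    | succ n ih =>
      have h1 := hcontr _ _ _ (hR (n + 1)) (hR n) ih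
      have e1 : R * (1 / 2) ^ n / 2 = R * (1 / 2) ^ (n + 1) := by ring
      rw [e1] at h1
      refine h1.congr fun t _ _ => ?_
      exact add_sub_add_left_eq_sub _ _ _
  have hex : ∀ t, 0 ≤ t → ∃ x, Tendsto (fun n => p n t) atTop (𝓝 x) := by
    intro t ht
    rcases ht.eq_or_lt with h0 | h0
    · subst h0
      -- The zeroth iterate is zero; from the first one on, the value at time zero is u₀.
      refine ⟨u₀, tendsto_atTop_of_eventually_const (i₀ := 1) fun n hn => ?_⟩
      obtain ⟨m, rfl⟩ := Nat.exists_eq_add_of_le' hn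
      change S 0 u₀ + convolution S α w _ 0 = u₀
      rw [convolution_zero, hS.zero, add_zero]
      rfl
    · obtain ⟨R, ρ, -, -, -, hd, -⟩ := hcauchy t h0
      refine cauchySeq_tendsto_of_complete (cauchySeq_of_le_geometric (1 / 2)
        (R * Real.exp (ρ * t)) (by norm_num) fun n => ?_)
      rw [dist_comm, dist_eq_norm]
      refine ((hd n).norm_le t h0 le_rfl).trans (le_of_eq (by ring))
  choose! u hu using hex
  refine ⟨u, hu, fun T hT => ?_⟩
  obtain ⟨R, ρ, hR0, hρ, hR, hd, hcontr⟩ := hcauchy T hT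
  obtain ⟨C, hC⟩ := hw T hT
  have hlim : ∀ t, 0 < t → t ≤ T → Tendsto (fun n => p n t) atTop (𝓝 (u t)) :=
    fun t ht _ => hu t ht.le
  have huR : WeightedHolder β 0 R T u :=
    WeightedHolder.of_tendsto (Eventually.of_forall hR) hlim
  -- The constant is the geometric sum of R 2^{-k} over n ≤ k < n+m; letting m grow bounds u minus
  -- the n-th iterate by 2R 2^{-n}.
  have hdiff : ∀ n m, WeightedHolder β ρ (2 * R * ((1 / 2) ^ n - (1 / 2) ^ (n + m))) T
      (fun t => p (n + m) t - p n t) := by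
    intro n m
    induction m with
    | zero =>
      simp only [add_zero, sub_self, mul_zero]
      exact weightedHolder_zero le_rfl
    | succ m ih =>
      have h1 := ih.add (hd (n + m))
      have e1 : 2 * R * ((1 / 2) ^ n - (1 / 2) ^ (n + m)) + R * (1 / 2) ^ (n + m) =
          2 * R * ((1 / 2) ^ n - (1 / 2) ^ (n + (m + 1))) := by ring
      rw [e1] at h1
      refine h1.congr fun t _ _ => ?_
      rw [← add_assoc]
      abel
  have hun : ∀ n, WeightedHolder β ρ (2 * R * (1 / 2) ^ n) T (fun t => u t - p n t) := by
    intro n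
    refine WeightedHolder.of_tendsto (f := fun m t => p (n + m) t - p n t)
      (Eventually.of_forall fun m => (hdiff n m).mono hT le_rfl ?_) fun t ht htT => ?_
    · have : (0 : ℝ) < (1 / 2) ^ (n + m) := by positivity
      gcongr
      linarith
    · refine Tendsto.sub_const ?_ _
      simp only [add_comm n]
      exact (hlim t ht htT).comp (tendsto_add_atTop_nat n)
  refine isMildSolution_of_weightedHolder hS he hG hT hC hwc huR ?_ fun t ht htT => ?_
  · refine tendsto_nhds_unique (hu 0 le_rfl)
      (tendsto_atTop_of_eventually_const (i₀ := 1) fun n hn => ?_)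
    obtain ⟨m, rfl⟩ := Nat.exists_eq_add_of_le' hn
    change S 0 u₀ + convolution S α w _ 0 = u₀
    rw [convolution_zero, hS.zero, add_zero]
    rfl
  · have h1 : Tendsto (fun n => p (n + 1) t) atTop (𝓝 (u t)) :=
      (hlim t ht htT).comp (tendsto_add_atTop_nat 1)
    refine tendsto_nhds_unique h1 ?_
    change Tendsto (fun n => S t u₀ + convolution S α w (fun r => G (p n r)) t) _ _
    refine Tendsto.const_add _ ?_
    rw [tendsto_iff_norm_sub_tendsto_zero]
    have hz : Tendsto (fun n : ℕ => 2 * R * (1 / 2) ^ n / 2 * Real.exp (ρ * t)) atTop (𝓝 0) := by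
      have := (((tendsto_pow_atTop_nhds_zero_of_lt_one (r := (1 / 2 : ℝ)) (by norm_num)
        (by norm_num)).const_mul (2 * R)).div_const 2).mul_const (Real.exp (ρ * t))
      simpa using this
    refine squeeze_zero (fun _ => norm_nonneg _) (fun n => ?_) hz
    rw [norm_sub_rev]
    exact (hcontr _ _ _ huR (hR n) (hun n)).norm_le t ht htT

end MildSolutions

/-! ### Measurability of the Picard iterates -/

section Measurability

variable {V : Type*} [NormedAddCommGroup V] [InnerProductSpace ℝ V] [CompleteSpace V]
  {e : HilbertBasis ℕ ℝ V} {S : ℝ → V →L[ℝ] V} {G : V → HS e} {α : ℝ}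
  {X : Type*} [MeasurableSpace X]

theorem stronglyMeasurable_fracIntegral {K : X → ℝ → HS e} {w : X → ℝ → V} {a b : X → ℝ}
    (hK : StronglyMeasurable (Function.uncurry K)) (hw : StronglyMeasurable (Function.uncurry w))
    (ha : Measurable a) (hb : Measurable b) :
    StronglyMeasurable fun x => fracIntegral α (K x) (w x) (a x) (b x) := by
  refine (stronglyMeasurable_intervalIntegral
    (f := fun x r => HS.toCLM (weylLeft α (a x) (K x) r) (weylRight α (b x) (w x) r))
    ?_ ha hb).neg
  exact (HS.evalL e).continuous₂.comp_stronglyMeasurable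
    ((stronglyMeasurable_weylLeft hK ha).prodMk (stronglyMeasurable_weylRight hw hb))

theorem IsRegularSemigroup.continuous_max (hS : IsRegularSemigroup S) {δ : ℝ} (hδ : 0 < δ) :
    Continuous fun t => S (max t δ) := by
  have key : ∀ s t, δ ≤ s → s ≤ t → ‖S t - S s‖ ≤ 2 / δ * (t - s) := by
    intro s t hs hst
    have h0 : 0 < s := hδ.trans_le hs
    have h1 := hS.norm_sub_le zero_le_one le_rfl h0 (sub_nonneg.2 hst)
    rw [add_sub_cancel, Real.rpow_one, Real.rpow_neg_one] at h1
    calc _ ≤ 2 * ((t - s) * s⁻¹) := h1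
      _ ≤ 2 * ((t - s) * δ⁻¹) := by
        have := sub_nonneg.2 hst
        gcongr
      _ = _ := by ring
  have hlip : LipschitzOnWith (Real.toNNReal (2 / δ)) S (Ici δ) := by
    refine LipschitzOnWith.of_dist_le_mul fun s hs t ht => ?_
    rw [Real.coe_toNNReal _ (by positivity)]
    rcases le_total s t with h | h
    · rw [dist_comm, dist_comm s, dist_eq_norm, Real.dist_eq, abs_of_nonneg (sub_nonneg.2 h)]
      exact key s t hs h
    · rw [dist_eq_norm, Real.dist_eq, abs_of_nonneg (sub_nonneg.2 h)]
      exact key t s ht h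
  exact hlip.continuousOn.comp_continuous (by fun_prop) fun t => mem_Ici.2 (le_max_right _ _)

/-- Norm continuity is available only on (0, ∞), where S is Lipschitz on each [δ, ∞). Cutting off at
δ and letting δ → 0 gives strong measurability for the operator norm. -/
theorem IsRegularSemigroup.stronglyMeasurable_indicator (hS : IsRegularSemigroup S) :
    StronglyMeasurable ((Ioi 0).indicator S) := by
  set δ : ℕ → ℝ := fun n => 1 / ((n : ℝ) + 1) with hδ_def
  have hδ : ∀ n, 0 < δ n := fun n => Nat.one_div_pos_of_nat
  have hδ0 : Tendsto δ atTop (𝓝 0) := tendsto_one_div_add_atTop_nhds_zero_nat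
  refine stronglyMeasurable_of_tendsto atTop
    (f := fun n => (Ioi (0 : ℝ)).indicator fun t => S (max t (δ n)))
    (fun n => (hS.continuous_max (hδ n)).stronglyMeasurable.indicator measurableSet_Ioi) ?_
  rw [tendsto_pi_nhds]
  intro t
  by_cases ht : t ∈ Ioi (0 : ℝ)
  · simp only [indicator_of_mem ht]
    refine tendsto_nhds_of_eventually_eq ?_
    filter_upwards [hδ0.eventually (gt_mem_nhds (mem_Ioi.1 ht))] with n hn
    rw [max_eq_left hn.le]
  · simp only [indicator_of_notMem ht]
    exact tendsto_const_nhds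

/-- Each iterate is a parametric integral of the previous one. The indicators discard nonpositive
times, where S and the iterates need not be measurable; inside the integral both t-r and r are
positive, so nothing changes. -/
theorem stronglyMeasurable_picard (hS : IsRegularSemigroup S) (hG : Continuous G)
    {w : X → ℝ → V} {x₀ : X → V} (hw : StronglyMeasurable (Function.uncurry w))
    (hx₀ : StronglyMeasurable x₀) (n : ℕ) :
    StronglyMeasurable fun p : X × ℝ =>
      (Ioi (0 : ℝ)).indicator (picard S G α (w p.1) (x₀ p.1) n) p.2 := by
  have hSm := hS.stronglyMeasurable_indicator
  induction n with
  | zero =>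
    simp only [picard, indicator_zero]
    exact stronglyMeasurable_const
  | succ n ih =>
    set K : X × ℝ → ℝ → HS e := fun p r => HS.lcompL e ((Ioi (0 : ℝ)).indicator S (p.2 - r))
      (G ((Ioi (0 : ℝ)).indicator (picard S G α (w p.1) (x₀ p.1) n) r)) with hK
    have hKm : StronglyMeasurable (Function.uncurry K) := by
      refine (HS.lcompL e).continuous₂.comp_stronglyMeasurable (StronglyMeasurable.prodMk ?_ ?_)
      · exact hSm.comp_measurable (g := fun p : (X × ℝ) × ℝ => p.1.2 - p.2) (by fun_prop)
      · exact hG.comp_stronglyMeasurable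
          (ih.comp_measurable (g := fun p : (X × ℝ) × ℝ => (p.1.1, p.2)) (by fun_prop))
    have h1 : StronglyMeasurable fun p : X × ℝ =>
        (Ioi (0 : ℝ)).indicator S p.2 (x₀ p.1) + fracIntegral α (K p) (w p.1) 0 p.2 := by
      refine StronglyMeasurable.add ?_ ?_
      · exact (ContinuousLinearMap.id ℝ (V →L[ℝ] V)).continuous₂.comp_stronglyMeasurable
          ((hSm.comp_measurable measurable_snd).prodMk (hx₀.comp_measurable measurable_fst))
      · exact stronglyMeasurable_fracIntegral (X := X × ℝ) (w := fun p => w p.1) hKm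
          (hw.comp_measurable (g := fun p : (X × ℝ) × ℝ => (p.1.1, p.2)) (by fun_prop))
          measurable_const measurable_snd
    have h2 := h1.indicator (s := {p : X × ℝ | 0 < p.2})
      (measurableSet_lt measurable_const measurable_snd)
    convert h2 using 1
    ext p
    by_cases hp : 0 < p.2
    · have hp1 : p.2 ∈ Ioi (0 : ℝ) := hp
      have hp2 : p ∈ {p : X × ℝ | 0 < p.2} := hp
      rw [indicator_of_mem hp1, indicator_of_mem hp2, indicator_of_mem hp1]
      change _ + fracIntegral α _ (w p.1) 0 p.2 = _
      congr 1
      refine fracIntegral_congr hp.le fun r hr => ?_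
      rw [hK]
      simp only [HS.lcompL_apply]
      rw [indicator_of_mem (mem_Ioi.2 (sub_pos.2 hr.2)), indicator_of_mem (mem_Ioi.2 hr.1)]
    · have hp1 : p.2 ∉ Ioi (0 : ℝ) := hp
      have hp2 : p ∉ {p : X × ℝ | 0 < p.2} := hp
      rw [indicator_of_notMem hp1, indicator_of_notMem hp2]

end Measurability

/-! ### Shifted equations -/

section Shift

variable {V : Type*} [NormedAddCommGroup V] [InnerProductSpace ℝ V] [CompleteSpace V]
  {e : HilbertBasis ℕ ℝ V} {S : ℝ → V →L[ℝ] V} {G : V → HS e} {α β γ κ θ L L' : ℝ}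

theorem weylLeft_shift {E : Type*} [NormedAddCommGroup E] [NormedSpace ℝ E] (K : ℝ → E)
    (τ r : ℝ) : weylLeft α τ K (r + τ) = weylLeft α 0 (fun r => K (r + τ)) r := by
  have h := intervalIntegral.integral_comp_add_right (a := 0) (b := r)
    (fun q => ((r + τ - q) ^ (1 + α))⁻¹ • (K (r + τ) - K q)) τ
  simp only [add_sub_add_right_eq_sub, zero_add] at h
  unfold weylLeft
  rw [h, add_sub_cancel_right, sub_zero]

theorem weylRight_shift (w : ℝ → V) (τ t r : ℝ) :
    weylRight α (t + τ) w (r + τ) = weylRight α t (fun r => w (τ + r) - w τ) r := by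
  have h := intervalIntegral.integral_comp_add_right (a := r) (b := t)
    (fun q => ((q - (r + τ)) ^ (2 - α))⁻¹ • (w (r + τ) - w q)) τ
  simp only [add_sub_add_right_eq_sub] at h
  unfold weylRight
  rw [← h, add_sub_add_right_eq_sub]
  simp only [sub_sub_sub_cancel_right, add_comm τ]

/-- Translation of variables in all integrals; the integrator enters only through increments, so
subtracting w(τ) does no harm. -/
theorem fracIntegral_shift (K : ℝ → HS e) (w : ℝ → V) (τ t : ℝ) :
    fracIntegral α K w τ (t + τ) =
      fracIntegral α (fun r => K (r + τ)) (fun r => w (τ + r) - w τ) 0 t := by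
  have h := intervalIntegral.integral_comp_add_right (a := 0) (b := t)
    (fun r => HS.toCLM (weylLeft α τ K r) (weylRight α (t + τ) w r)) τ
  rw [zero_add] at h
  unfold fracIntegral
  rw [← h]
  simp only [weylLeft_shift, weylRight_shift]

theorem HolderBound.shift {C T τ : ℝ} {w : ℝ → V} (hw : HolderBound γ C 0 (T + τ) w)
    (hτ : 0 ≤ τ) : HolderBound γ C 0 T (fun r => w (τ + r) - w τ) := by
  intro s t h1 h2 h3
  have := hw (τ + s) (τ + t) (by linarith) (by linarith) (by linarith)
  rwa [add_sub_add_left_eq_sub, ← sub_sub_sub_cancel_right (w (τ + t)) _ (w τ)] at this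

/-- Splitting the convolution at τ gives u(t+τ) = S(t)u(τ) + ∫_τ^{t+τ} S(t+τ-r)G(u(r)) dw(r), and
translation turns this into the shifted equation. The weight survives since (s+τ)^{-β} ≤ s^{-β}. -/
theorem isMildSolution_shift (hS : IsRegularSemigroup S)
    (he : AdmissibleExponents α β γ κ θ) (hG : SmoothBounds G L L') {T τ C : ℝ} {w : ℝ → V}
    {u₀ : V} (hT : 0 < T) (hτ : 0 < τ) (hw : HolderBound γ C 0 (T + τ + 1) w)
    (hwc : Continuous w) {u : ℝ → V} (hu : IsMildSolution S G α β w u₀ (T + τ) u) :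
    IsMildSolution S G α β (fun r => w (τ + r) - w τ) (u τ) T (fun t => u (t + τ)) := by
  obtain ⟨R, hR⟩ := hu.exists_weightedHolder
  have hβ0 : 0 < β := he.α_pos.trans he.α_lt_β
  have hR' : WeightedHolder β 0 R T (fun t => u (t + τ)) := by
    have hR0 := hR.nonneg (by linarith)
    constructor
    · intro t h1 h2
      simpa using hR.norm_le (t + τ) (by linarith) (by linarith)
    · intro s t h1 h2 h3
      have h4 := hR.sub_le (s + τ) (t + τ) (by linarith) (by linarith) (by linarith)
      rw [zero_mul, Real.exp_zero, mul_one, add_sub_add_right_eq_sub] at h4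
      rw [zero_mul, Real.exp_zero, mul_one]
      refine h4.trans ?_
      have p1 := Real.rpow_nonneg (sub_pos.2 h2).le β
      have p2 : (s + τ) ^ (-β) ≤ s ^ (-β) :=
        Real.rpow_le_rpow_of_nonpos h1 (by linarith) (by linarith)
      gcongr
  refine isMildSolution_of_weightedHolder hS he hG (C := C) hT
    (HolderBound.shift (by rwa [add_right_comm]) hτ.le) (by fun_prop) hR' (by simp) ?_
  intro t ht htT
  have hg := (hG.weightedHolder_comp le_rfl hR).mono (by linarith) zero_le_one le_rfl
  have h1 := hS.convolution_eq_add he hg one_pos hw hwc hτ (show τ < t + τ by linarith)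
    (show t + τ ≤ T + τ by linarith)
  rw [hu.eq_convolution (t := t + τ) (by linarith) (by linarith), h1,
    hu.eq_convolution (t := τ) hτ.le (by linarith), add_sub_cancel_right, map_add,
    hS.apply_add ht.le hτ.le, add_assoc, fracIntegral_shift]
  simp only [add_sub_add_right_eq_sub]
  rfl

end Shift

/-! ### The solution map -/

section SolutionMap

variable {V : Type*} [NormedAddCommGroup V] [InnerProductSpace ℝ V] [CompleteSpace V]
  {e : HilbertBasis ℕ ℝ V} {S : ℝ → V →L[ℝ] V} {G : V → HS e} {α β γ κ θ L L' : ℝ}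

/-- The unit beyond T is the room that the forward averages need in the proof of additivity. -/
theorem exists_holderBound_of_mem_holderPaths {w : PathSpace V} (hw : w ∈ holderPaths V γ)
    (T : ℝ) : ∃ C, HolderBound γ C 0 (T + 1) w := by
  obtain ⟨k, hk⟩ := exists_nat_ge (T + 1)
  have hfin := hw k
  refine ⟨(holderSeminorm γ w (-k) k).toReal, fun s t hs hst ht => ?_⟩
  rcases hst.eq_or_lt with rfl | hst
  · rw [sub_self, norm_zero]
    have := Real.rpow_nonneg (sub_nonneg.2 (le_refl s)) γ
    positivity
  · have h1 : ENNReal.ofReal (‖w t - w s‖ / (t - s) ^ γ) ≤ holderSeminorm γ w (-k) k := by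
      have hk0 : (0 : ℝ) ≤ k := Nat.cast_nonneg k
      unfold holderSeminorm
      exact le_iSup_of_le s (le_iSup_of_le t (le_iSup_of_le (by linarith)
        (le_iSup_of_le hst (le_iSup_of_le (by linarith) le_rfl))))
    rw [← div_le_iff₀ (Real.rpow_pos_of_pos (sub_pos.2 hst) _)]
    exact (ENNReal.ofReal_le_iff_le_toReal hfin.ne).1 h1

/-- Uniqueness makes the arbitrary choice in `solutionMap` irrelevant. -/
theorem solutionMap_eq (hS : IsRegularSemigroup S)
    (he : AdmissibleExponents α β γ κ θ) (hG : SmoothBounds G L L') (hL' : 0 ≤ L')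
    {w : PathSpace V} (hw : w ∈ holderPaths V γ) {u₀ : V} {u : ℝ → V}
    (hu : ∀ T, 0 < T → IsMildSolution S G α β w u₀ T u) (t : ℝ≥0) :
    solutionMap S G α β t w u₀ = u t := by
  have hex : ∃ u : ℝ → V, ∀ T : ℝ, 0 < T → IsMildSolution S G α β w u₀ T u := ⟨u, hu⟩
  unfold solutionMap
  rw [dif_pos hex]
  have hT : (0 : ℝ) < t + 1 := by positivity
  obtain ⟨C, hC⟩ := exists_holderBound_of_mem_holderPaths hw (t + 1)
  exact IsMildSolution.unique hS he hG hL' hT hC w.1.continuous (hex.choose_spec _ hT) (hu _ hT) t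
    ⟨t.2, by linarith⟩

theorem exists_solutionMap (hS : IsRegularSemigroup S)
    (he : AdmissibleExponents α β γ κ θ) (hG : SmoothBounds G L L') (hL' : 0 ≤ L')
    {w : PathSpace V} (hw : w ∈ holderPaths V γ) (u₀ : V) :
    (∀ t : ℝ≥0, Tendsto (fun n => picard S G α w u₀ n t) atTop
      (𝓝 (solutionMap S G α β t w u₀))) ∧
    ∀ T, 0 < T → IsMildSolution S G α β w u₀ T
      (fun t => solutionMap S G α β t.toNNReal w u₀) := by
  obtain ⟨u, hu, hu'⟩ := exists_mildSolution_tendsto_picard hS he hG hL'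
    (fun T _ => exists_holderBound_of_mem_holderPaths hw T) w.1.continuous u₀
  have heq := solutionMap_eq hS he hG hL' hw hu'
  have heq' : ∀ t : ℝ, 0 ≤ t → solutionMap S G α β t.toNNReal w u₀ = u t := fun t ht => by
    rw [heq, Real.coe_toNNReal _ ht]
  refine ⟨fun t => by rw [heq]; exact hu t t.2, fun T hT => ?_⟩
  obtain ⟨C, hC⟩ := exists_holderBound_of_mem_holderPaths hw T
  obtain ⟨R, hR⟩ := (hu' T hT).exists_weightedHolder
  refine isMildSolution_of_weightedHolder hS he hG hT hC w.1.continuous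
    (hR.congr fun t ht _ => heq' t ht.le) ?_ fun t ht htT => ?_
  · rw [heq' 0 le_rfl, (hu' T hT).eq_convolution le_rfl hT.le, convolution_zero, hS.zero, add_zero]
    rfl
  · rw [heq' t ht.le, (hu' T hT).eq_convolution ht.le htT]
    congr 1
    exact fracIntegral_congr ht.le fun r hr => by simp only [heq' r hr.1.le]

theorem solutionMap_zero (hS : IsRegularSemigroup S)
    (he : AdmissibleExponents α β γ κ θ) (hG : SmoothBounds G L L') (hL' : 0 ≤ L')
    {w : PathSpace V} (hw : w ∈ holderPaths V γ) (u₀ : V) :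
    solutionMap S G α β 0 w u₀ = u₀ := by
  have h := ((exists_solutionMap hS he hG hL' hw u₀).2 1 one_pos).eq_convolution le_rfl zero_le_one
  rw [convolution_zero, hS.zero, add_zero, Real.toNNReal_zero] at h
  exact h

/-- For τ > 0 the translated solution solves the equation of the shifted path, so uniqueness
applies. The case τ = 0 is separate because additivity was established at interior points only. -/
theorem solutionMap_cocycle (hS : IsRegularSemigroup S)
    (he : AdmissibleExponents α β γ κ θ) (hG : SmoothBounds G L L') (hL' : 0 ≤ L')
    {w : PathSpace V} (hw : w ∈ holderPaths V γ) (u₀ : V) (t τ : ℝ≥0) :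
    solutionMap S G α β (t + τ) w u₀ =
      solutionMap S G α β t (shift τ w) (solutionMap S G α β τ w u₀) := by
  have hw' : shift τ w ∈ holderPaths V γ := (shiftInvariant_holderPaths γ τ).ge hw
  have hsol := (exists_solutionMap hS he hG hL' hw u₀).2
  rcases eq_or_ne τ 0 with rfl | hτ
  · have h0 : shift ((0 : ℝ≥0) : ℝ) w = w := by
      refine Subtype.ext (ContinuousMap.ext fun s => ?_)
      have h1 : w 0 = 0 := w.2
      change w (((0 : ℝ≥0) : ℝ) + s) - w ((0 : ℝ≥0) : ℝ) = w s
      simp [h1]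
    rw [h0, solutionMap_zero hS he hG hL' hw, add_zero]
  · have hτ0 : 0 < (τ : ℝ) := NNReal.coe_pos.2 (pos_iff_ne_zero.2 hτ)
    have h1 : ∀ T, 0 < T → IsMildSolution S G α β (shift τ w)
        (solutionMap S G α β τ w u₀) T
        (fun t => solutionMap S G α β (t + τ).toNNReal w u₀) := by
      intro T hT
      obtain ⟨C, hC⟩ := exists_holderBound_of_mem_holderPaths hw (T + τ)
      have h2 := isMildSolution_shift hS he hG hT hτ0 hC w.1.continuous (hsol (T + τ) (by linarith))
      rw [Real.toNNReal_coe] at h2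
      exact h2
    rw [solutionMap_eq hS he hG hL' hw' h1 t]
    congr 1
    rw [← NNReal.coe_add, Real.toNNReal_coe]

end SolutionMap

/-! ### Measurability on path space -/

section PathSpaceMeasurability

variable {V : Type*} [NormedAddCommGroup V]

theorem continuous_pathSpace_eval : Continuous fun p : PathSpace V × ℝ => p.1 p.2 := by
  have h1 : Continuous fun w : PathSpace V => w.1 := continuous_subtype_val
  have h2 : Continuous fun p : C(ℝ, V) × ℝ => p.1 p.2 := ContinuousEval.continuous_eval
  exact h2.comp ((h1.comp continuous_fst).prodMk continuous_snd)

/-- A supremum of functions each depending continuously on two values of the path. -/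
theorem lowerSemicontinuous_holderSeminorm (β a b : ℝ) :
    LowerSemicontinuous fun w : PathSpace V => holderSeminorm β w a b := by
  unfold holderSeminorm
  refine lowerSemicontinuous_iSup fun s => lowerSemicontinuous_iSup fun t =>
    lowerSemicontinuous_iSup fun _ => lowerSemicontinuous_iSup fun _ =>
    lowerSemicontinuous_iSup fun _ => Continuous.lowerSemicontinuous ?_
  have h : ∀ t : ℝ, Continuous fun w : PathSpace V => w t := fun t =>
    continuous_pathSpace_eval.comp (continuous_id.prodMk continuous_const)
  exact ENNReal.continuous_ofReal.comp ((((h t).sub (h s)).norm).div_const _)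

theorem holderSeminorm_mono (β : ℝ) (w : ℝ → V) {a b a' b' : ℝ} (ha : a' ≤ a) (hb : b ≤ b') :
    holderSeminorm β w a b ≤ holderSeminorm β w a' b' := by
  unfold holderSeminorm
  refine iSup_le fun s => iSup_le fun t => iSup_le fun hs => iSup_le fun hst => iSup_le fun ht => ?_
  exact le_iSup_of_le s (le_iSup_of_le t (le_iSup_of_le (ha.trans hs)
    (le_iSup_of_le hst (le_iSup_of_le (ht.trans hb) le_rfl))))

/-- Seminorm and power both increase with τ, so the admissible τ form an up-set. Hence the infimum
lies below c exactly when some rational q in (0, c) is admissible, and each such condition is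
measurable in the path. -/
theorem measurable_stoppingTime {β μ : ℝ} (hβ : β ≤ 1) (hμ : 0 ≤ μ) :
    Measurable fun w : PathSpace V => stoppingTime β μ w := by
  refine measurable_of_Iio fun c => ?_
  have e1 : (fun w : PathSpace V => stoppingTime β μ w) ⁻¹' Iio c =
      ⋃ (q : ℚ) (_ : 0 < (q : ℝ)) (_ : (q : ℝ) < c), {w : PathSpace V | ENNReal.ofReal μ ≤
        holderSeminorm β w 0 q + ENNReal.ofReal (μ * (q : ℝ) ^ (1 - β))} := by
    ext w
    simp only [mem_preimage, mem_Iio, mem_iUnion, mem_ofPred_eq, exists_prop]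
    unfold stoppingTime
    have hbdd : BddBelow {τ : ℝ | 0 < τ ∧ ENNReal.ofReal μ ≤
        holderSeminorm β w 0 τ + ENNReal.ofReal (μ * τ ^ (1 - β))} := ⟨0, fun τ hτ => hτ.1.le⟩
    -- τ = 1 is always admissible, as the power term alone equals μ; the default infimum of the
    -- empty set never occurs.
    have hne : Set.Nonempty {τ : ℝ | 0 < τ ∧ ENNReal.ofReal μ ≤
        holderSeminorm β w 0 τ + ENNReal.ofReal (μ * τ ^ (1 - β))} := ⟨1, one_pos, by simp⟩
    rw [csInf_lt_iff hbdd hne]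
    constructor
    · rintro ⟨τ, ⟨h1, h2⟩, h3⟩
      obtain ⟨q, h4, h5⟩ := exists_rat_btwn h3
      refine ⟨q, h1.trans h4, h5, h2.trans (add_le_add (holderSeminorm_mono _ _ le_rfl h4.le) ?_)⟩
      have : 0 ≤ 1 - β := by linarith
      gcongr
    · rintro ⟨q, h1, h2, h3⟩
      exact ⟨q, ⟨h1, h3⟩, h2⟩
  rw [e1]
  refine MeasurableSet.iUnion fun q => MeasurableSet.iUnion fun _ => MeasurableSet.iUnion fun _ => ?_
  exact measurableSet_le measurable_const
    ((lowerSemicontinuous_holderSeminorm β 0 q).measurable.add_const _)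

theorem measurable_stoppingTimeHat {β μ : ℝ} (hβ : β ≤ 1) (hμ : 0 ≤ μ) :
    Measurable fun w : PathSpace V => stoppingTimeHat β μ w := by
  refine measurable_of_Ioi fun c => ?_
  have e1 : (fun w : PathSpace V => stoppingTimeHat β μ w) ⁻¹' Ioi c =
      ⋃ (q : ℚ) (_ : (q : ℝ) < 0) (_ : c < (q : ℝ)), {w : PathSpace V | ENNReal.ofReal μ ≤
        holderSeminorm β w q 0 + ENNReal.ofReal (μ * |(q : ℝ)| ^ (1 - β))} := by
    ext w
    simp only [mem_preimage, mem_Ioi, mem_iUnion, mem_ofPred_eq, exists_prop]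
    unfold stoppingTimeHat
    have hbdd : BddAbove {τ : ℝ | τ < 0 ∧ ENNReal.ofReal μ ≤
        holderSeminorm β w τ 0 + ENNReal.ofReal (μ * |τ| ^ (1 - β))} := ⟨0, fun τ hτ => hτ.1.le⟩
    have hne : Set.Nonempty {τ : ℝ | τ < 0 ∧ ENNReal.ofReal μ ≤
        holderSeminorm β w τ 0 + ENNReal.ofReal (μ * |τ| ^ (1 - β))} := ⟨-1, by norm_num, by simp⟩
    rw [lt_csSup_iff hbdd hne]
    constructor
    · rintro ⟨τ, ⟨h1, h2⟩, h3⟩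
      obtain ⟨q, h4, h5⟩ := exists_rat_btwn h3
      have h6 : |τ| ≤ |(q : ℝ)| := by
        rw [abs_of_neg h1, abs_of_neg (h5.trans h1)]
        linarith
      refine ⟨q, h5.trans h1, h4, h2.trans (add_le_add (holderSeminorm_mono _ _ h5.le le_rfl) ?_)⟩
      have : 0 ≤ 1 - β := by linarith
      gcongr
    · rintro ⟨q, h1, h2, h3⟩
      exact ⟨q, ⟨h1, h3⟩, h2⟩
  rw [e1]
  refine MeasurableSet.iUnion fun q => MeasurableSet.iUnion fun _ => MeasurableSet.iUnion fun _ => ?_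
  exact measurableSet_le measurable_const
    ((lowerSemicontinuous_holderSeminorm β q 0).measurable.add_const _)

end PathSpaceMeasurability

/-! ### Joint measurability of the solution map -/

section JointMeasurability

variable {V : Type*} [NormedAddCommGroup V] [InnerProductSpace ℝ V] [CompleteSpace V]
  [TopologicalSpace.SeparableSpace V] [MeasurableSpace V] [BorelSpace V]
  {e : HilbertBasis ℕ ℝ V} {S : ℝ → V →L[ℝ] V} {G : V → HS e} {α β γ κ θ L L' : ℝ}

/-- Pointwise limit of the Picard iterates. These are known to be measurable for t > 0 only, so they
are replaced by the initial value at t = 0, where the solution takes that value. -/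
theorem measurable_solutionMap (hS : IsRegularSemigroup S)
    (he : AdmissibleExponents α β γ κ θ) (hG : SmoothBounds G L L') (hL' : 0 ≤ L')
    {Ω : Set (PathSpace V)} (hΩ : Ω ⊆ holderPaths V γ) :
    Measurable fun p : ℝ≥0 × Ω × V => solutionMap S G α β p.1 p.2.1.1 p.2.2 := by
  have : SecondCountableTopology V := UniformSpace.secondCountable_of_separable V
  have hev : Measurable fun p : (Ω × V) × ℝ => p.1.1.1 p.2 :=
    (continuous_pathSpace_eval (V := V)).measurable.comp
      (g := fun q : PathSpace V × ℝ => q.1 q.2)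
      (f := fun p : (Ω × V) × ℝ => ((p.1.1.1 : PathSpace V), p.2))
      ((measurable_subtype_coe.comp (measurable_fst.comp measurable_fst)).prodMk measurable_snd)
  have hpic : ∀ n, StronglyMeasurable fun p : (Ω × V) × ℝ =>
      (Ioi (0 : ℝ)).indicator (picard S G α p.1.1.1 p.1.2 n) p.2 := fun n =>
    stronglyMeasurable_picard (X := Ω × V) (w := fun x => x.1.1) (x₀ := fun x => x.2) hS
      hG.differentiable.continuous hev.stronglyMeasurable measurable_snd.stronglyMeasurable n
  have hm : ∀ n, Measurable fun p : ℝ≥0 × Ω × V => if 0 < p.1 then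
      (Ioi (0 : ℝ)).indicator (picard S G α p.2.1.1 p.2.2 n) p.1 else p.2.2 := by
    intro n
    refine Measurable.ite (measurableSet_lt measurable_const measurable_fst) ?_
      (measurable_snd.comp measurable_snd)
    exact (hpic n).measurable.comp
      (measurable_snd.prodMk (measurable_coe_nnreal_real.comp measurable_fst))
  refine measurable_of_tendsto_metrizable hm (tendsto_pi_nhds.2 fun p => ?_)
  obtain ⟨t, w, x⟩ := p
  rcases eq_or_ne t 0 with rfl | ht
  · simp only [lt_self_iff_false, if_false]
    rw [solutionMap_zero hS he hG hL' (hΩ w.2)]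
    exact tendsto_const_nhds
  · have ht0 : 0 < t := pos_iff_ne_zero.2 ht
    have ht1 : (t : ℝ) ∈ Ioi (0 : ℝ) := NNReal.coe_pos.2 ht0
    simp only [if_pos ht0, indicator_of_mem ht1]
    exact (exists_solutionMap hS he hG hL' (hΩ w.2) x).1 t

end JointMeasurability

end FBMEvolution

end

/-! ### Choice of exponents and assembly. -/

theorem lemmal17 {V : Type*} [NormedAddCommGroup V] [InnerProductSpace ℝ V] [CompleteSpace V]
    [TopologicalSpace.SeparableSpace V] [MeasurableSpace V] [BorelSpace V]
    (e : HilbertBasis ℕ ℝ V)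
    (A : V →ₗ.[ℝ] V) (hA : FBMEvolution.IsNegativeWithCompactInverse A)
    (S : ℝ → V →L[ℝ] V) (hS : FBMEvolution.IsSemigroupGeneratedBy A S)
    (G : V → FBMEvolution.HS e) (hG : ContDiff ℝ 2 G)
    (hDG : ∃ C : ℝ, ∀ u : V, ‖fderiv ℝ G u‖ ≤ C)
    (hD2G : ∃ C : ℝ, ∀ u : V, ‖fderiv ℝ (fderiv ℝ G) u‖ ≤ C)
    (H β β' β'' α μ : ℝ) (hβ : 1 / 2 < β) (hββ' : β < β') (hβ'β'' : β' < β'') (hβ''H : β'' < H)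
    (hH : H < 1) (hα : 1 - β' < α) (hαβ : α < β) (hμ : 0 < μ)
    (Q : V →L[ℝ] V) (hQ : Q.IsPositive) (hQtr : Summable fun i => inner ℝ (e i) (Q (e i)))
    (P : MeasureTheory.Measure (FBMEvolution.PathSpace V)) [MeasureTheory.IsProbabilityMeasure P]
    (hP : FBMEvolution.IsFractionalBrownianLaw H Q P)
    (Ω₁ Ω₂ : Set (FBMEvolution.PathSpace V))
    (hΩ₁ : FBMEvolution.IsErgodicSet P β' β'' μ Ω₁)
    (hΩ₂ : FBMEvolution.IsSublinearSet P β'' Ω₂) :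
    -- the solution map is well defined: its trajectories are the unique mild solutions
    (∀ (w : FBMEvolution.noiseSpace β'' Ω₁ Ω₂) (u₀ : V) (T : ℝ), 0 < T →
      FBMEvolution.IsMildSolution S G α β w.1 u₀ T
        (fun t => FBMEvolution.solutionMap S G α β t.toNNReal w.1 u₀) ∧
      ∀ u : ℝ → V, FBMEvolution.IsMildSolution S G α β w.1 u₀ T u →
        ∀ t ∈ Set.Icc 0 T, u t = FBMEvolution.solutionMap S G α β t.toNNReal w.1 u₀) ∧
    -- it is jointly measurable and a cocycle
    FBMEvolution.IsRandomDynamicalSystem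
      (FBMEvolution.shiftOn (FBMEvolution.shiftInvariant_noiseSpace hΩ₁ hΩ₂))
      (fun t w u₀ => FBMEvolution.solutionMap S G α β t w.1 u₀) ∧
    -- the stopping times are measurable
    Measurable (fun w : FBMEvolution.noiseSpace β'' Ω₁ Ω₂ =>
      FBMEvolution.stoppingTime β' μ w.1) ∧
    Measurable (fun w : FBMEvolution.noiseSpace β'' Ω₁ Ω₂ =>
      FBMEvolution.stoppingTimeHat β' μ w.1) := by
  have hreg := FBMEvolution.isRegularSemigroup_of_generator hA hS
  obtain ⟨L, hL⟩ := hDG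
  obtain ⟨L', hL'⟩ := hD2G
  have hsm := FBMEvolution.smoothBounds_of_contDiff hG hL hL'
  have hL'0 : 0 ≤ L' := (ContinuousLinearMap.opNorm_nonneg _).trans (hL' 0)
  -- The loss κ = β'' - β' leaves the effective order β', and θ exceeds α by half of the gap β' - β.
  -- Then β + θ < α + β' holds with the other half to spare, and θ < β' < 1.
  have he : FBMEvolution.AdmissibleExponents α β β'' (β'' - β') (α + (β' - β) / 2) := by
    constructor <;> linarith
  have hsub : FBMEvolution.noiseSpace β'' Ω₁ Ω₂ ⊆ FBMEvolution.holderPaths V β'' :=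
    fun w hw => hw.2
  refine ⟨fun w u₀ T hT => ?_, ⟨FBMEvolution.measurable_solutionMap hreg he hsm hL'0 hsub,
    fun w u₀ => FBMEvolution.solutionMap_zero hreg he hsm hL'0 (hsub w.2) u₀,
    fun t τ w u₀ => FBMEvolution.solutionMap_cocycle hreg he hsm hL'0 (hsub w.2) u₀ t τ⟩,
    (FBMEvolution.measurable_stoppingTime (by linarith) hμ.le).comp measurable_subtype_coe,
    (FBMEvolution.measurable_stoppingTimeHat (by linarith) hμ.le).comp measurable_subtype_coe⟩
  have hsol := (FBMEvolution.exists_solutionMap hreg he hsm hL'0 (hsub w.2) u₀).2 T hT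
  obtain ⟨C, hC⟩ := FBMEvolution.exists_holderBound_of_mem_holderPaths (hsub w.2) T
  exact ⟨hsol, fun u hu => FBMEvolution.IsMildSolution.unique hreg he hsm hL'0 hT hC
    w.1.1.continuous hu hsol⟩
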